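/- Cardinality constrained scheduling on two machines: given a positive integer $k$ and jobs of positive rational sizes $p_1,\dots,p_n$, a feasible schedule assigns every job to one of two machines so that each machine gets at most $k$ jobs; its cost (makespan) is the maximum, over the two machines, of the total size of the jobs assigned to it. Jobs are released one by one, and an algorithm has to hold, after each release, a feasible schedule of the jobs released so far (as long as one exists, i.e. $n\le 2k$), which depends only on these jobs, on $k$ and on $\varepsilon$. Its migration factor is at most $\beta$ if, whenever a job of size $p$ is released, the previously released jobs whose machine is changed have total size at most $\beta p$. Theorem. There is a robust FPTAS with migration factor $O(1/\varepsilon^5)$ for two machines and $k>1/\varepsilon^2$. That is, there are a constant $C$, polynomials $P,Q$ and a single algorithm, which gets $\lceil 1/\varepsilon\rceil$, $k$ and the jobs released so far, such that for every real $\varepsilon>0$ and every integer $k>1/\varepsilon^2$: after each release the schedule of the algorithm is feasible and its makespan is at most $(1+\varepsilon)$ times the optimal makespan for the jobs released so far; the migration factor is at most $C/\varepsilon^5$; and each schedule is computed in time at most $P(1/\varepsilon)\cdot Q(L)$, where $L$ is the binary encoding length of $k$ and of the sizes of the jobs released so far (time is the logarithmic cost on a random access machine). -/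

import Mathlib

/-! ### Cardinality constrained scheduling -/

namespace CCS

/-- `σ` assigns `n` jobs to `m` machines; it is feasible if every machine gets at most `k` jobs. -/
def Feasible {n m : ℕ} (k : ℕ) (σ : Fin n → Fin m) : Prop :=
  ∀ i : Fin m, (Finset.univ.filter fun j => σ j = i).card ≤ k

/-- Total size of the jobs that the schedule `σ` assigns to machine `i`. -/
noncomputable def load {n m : ℕ} (p : Fin n → ℚ) (σ : Fin n → Fin m) (i : Fin m) : ℝ :=
  ∑ j ∈ Finset.univ.filter (fun j => σ j = i), (p j : ℝ)

/-- Maximum load of a machine. -/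
noncomputable def makespan {n m : ℕ} (p : Fin n → ℚ) (σ : Fin n → Fin m) : ℝ :=
  ⨆ i : Fin m, load p σ i

/-- Optimal (offline) makespan of a feasible schedule on `m` machines with cardinality bound `k`.
The set is finite, and it is nonempty whenever `n ≤ m * k`. -/
noncomputable def optCost {n : ℕ} (m k : ℕ) (p : Fin n → ℚ) : ℝ :=
  sInf {c : ℝ | ∃ σ : Fin n → Fin m, Feasible k σ ∧ c = makespan p σ}

/-- A deterministic algorithm that gets the jobs one by one: to every finite sequence of job sizes
(the jobs released so far) it assigns the schedule that it holds after the last job of that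
sequence. -/
abbrev OnlineAlg (m : ℕ) := ∀ n : ℕ, (Fin n → ℚ) → Fin n → Fin m

/-- A sequence of jobs of positive size that admits a feasible schedule on `m` machines with
cardinality bound `k`. -/
def ValidInput {n : ℕ} (m k : ℕ) (p : Fin n → ℚ) : Prop :=
  (∀ j, 0 < p j) ∧ n ≤ m * k

/-- When the last job of `p` is released, the total size of the earlier jobs that are moved to
another machine. -/
noncomputable def migration {m n : ℕ} (A : OnlineAlg m) (p : Fin (n + 1) → ℚ) : ℝ :=
  ∑ j ∈ Finset.univ.filter
      (fun j : Fin n => A n (fun l => p l.castSucc) j ≠ A (n + 1) p j.castSucc),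
    (p j.castSucc : ℝ)

/-- At every time the schedule of `A` is feasible and has cost at most `α` times the optimal cost
for the jobs released so far, and the migration factor of `A` is at most `β`. -/
structure IsRobustApprox (m k : ℕ) (α β : ℝ) (A : OnlineAlg m) : Prop where
  feasible : ∀ (n : ℕ) (p : Fin n → ℚ), ValidInput m k p → Feasible k (A n p)
  approx : ∀ (n : ℕ) (p : Fin n → ℚ), ValidInput m k p →
    makespan p (A n p) ≤ α * optCost m k p
  migrate : ∀ (n : ℕ) (p : Fin (n + 1) → ℚ), ValidInput m k p →
    migration A p ≤ β * (p (Fin.last n) : ℝ)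

/-- Binary encoding length of an instance: the number of bits of `k` and of the numerators and
denominators of all job sizes. -/
def encLength {n : ℕ} (k : ℕ) (p : Fin n → ℚ) : ℕ :=
  Nat.size k + ∑ j, (Nat.size (p j).num.natAbs + Nat.size (p j).den)

/-! ### Random access machine with logarithmic cost -/

/-- Memory: registers and arrays, all of whose cells hold natural numbers. -/
structure Mem where
  reg : ℕ → ℕ
  arr : ℕ → ℕ → ℕ

/-- Arithmetic expressions; `get a e` reads the cell of array `a` with index `e`. -/
inductive Expr where
  | const (c : ℕ)
  | reg (x : ℕ)
  | get (a : ℕ) (e : Expr)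
  | add (e f : Expr)
  | sub (e f : Expr)
  | mul (e f : Expr)
  | div (e f : Expr)

/-- Value of an expression (`sub` is truncated at zero, `div` rounds down). -/
def Expr.val (M : Mem) : Expr → ℕ
  | .const c => c
  | .reg x => M.reg x
  | .get a e => M.arr a (e.val M)
  | .add e f => e.val M + f.val M
  | .sub e f => e.val M - f.val M
  | .mul e f => e.val M * f.val M
  | .div e f => e.val M / f.val M

/-- Logarithmic cost of evaluating an expression: every node is charged one unit plus the number of
bits of its value, so that the bits of all operands, indices and results are paid for. -/
def Expr.cost (M : Mem) : Expr → ℕ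
  | .const c => Nat.size c + 1
  | .reg x => Nat.size (M.reg x) + 1
  | .get a e => e.cost M + (Nat.size (M.arr a (e.val M)) + 1)
  | .add e f => e.cost M + f.cost M + (Nat.size (e.val M + f.val M) + 1)
  | .sub e f => e.cost M + f.cost M + (Nat.size (e.val M - f.val M) + 1)
  | .mul e f => e.cost M + f.cost M + (Nat.size (e.val M * f.val M) + 1)
  | .div e f => e.cost M + f.cost M + (Nat.size (e.val M / f.val M) + 1)

/-- Programs; a test succeeds if the value of its expression is nonzero. -/
inductive Prog where
  | skip
  | set (x : ℕ) (e : Expr)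
  | put (a : ℕ) (i e : Expr)
  | seq (P Q : Prog)
  | cond (e : Expr) (P Q : Prog)
  | loop (e : Expr) (P : Prog)

/-- Write `v` to register `x`. -/
def Mem.setReg (M : Mem) (x v : ℕ) : Mem :=
  { M with reg := Function.update M.reg x v }

/-- Write `v` to the cell of array `a` with index `i`. -/
def Mem.setArr (M : Mem) (a i v : ℕ) : Mem :=
  { M with arr := Function.update M.arr a (Function.update (M.arr a) i v) }

/-- `Exec P M t M'`: started in memory `M`, the program `P` halts in memory `M'` at total
cost `t`. The rules are deterministic; `loop e P` is the loop "while `e ≠ 0` do `P`". -/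
inductive Exec : Prog → Mem → ℕ → Mem → Prop where
  | skip (M : Mem) : Exec .skip M 1 M
  | set (x : ℕ) (e : Expr) (M : Mem) :
      Exec (.set x e) M (e.cost M + 1) (M.setReg x (e.val M))
  | put (a : ℕ) (i e : Expr) (M : Mem) :
      Exec (.put a i e) M (i.cost M + e.cost M + 1) (M.setArr a (i.val M) (e.val M))
  | seq {P Q : Prog} {M M' M'' : Mem} {s t : ℕ} :
      Exec P M s M' → Exec Q M' t M'' → Exec (.seq P Q) M (s + t) M''
  | condTrue {e : Expr} {P Q : Prog} {M M' : Mem} {t : ℕ} :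
      e.val M ≠ 0 → Exec P M t M' → Exec (.cond e P Q) M (e.cost M + 1 + t) M'
  | condFalse {e : Expr} {P Q : Prog} {M M' : Mem} {t : ℕ} :
      e.val M = 0 → Exec Q M t M' → Exec (.cond e P Q) M (e.cost M + 1 + t) M'
  | loopTrue {e : Expr} {P : Prog} {M M' M'' : Mem} {s t : ℕ} :
      e.val M ≠ 0 → Exec P M s M' → Exec (.loop e P) M' t M'' →
      Exec (.loop e P) M (e.cost M + 1 + s + t) M''
  | loopFalse {e : Expr} {P : Prog} {M : Mem} :
      e.val M = 0 → Exec (.loop e P) M (e.cost M + 1) M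

/-- Initial memory: register `0` holds the accuracy parameter `N`, register `1` the cardinality
bound `k`, register `2` the number `n` of jobs released so far; arrays `0` and `1` hold the
numerators and denominators of their sizes (in lowest terms). Everything else is zero. -/
def inputMem {n : ℕ} (N k : ℕ) (p : Fin n → ℚ) : Mem where
  reg x := if x = 0 then N else if x = 1 then k else if x = 2 then n else 0
  arr a i :=
    if h : i < n then
      if a = 0 then (p ⟨i, h⟩).num.natAbs else if a = 1 then (p ⟨i, h⟩).den else 0
    else 0

/-- The program, started on accuracy `N`, bound `k` and job sequence `p`, halts with cost at most
`T`, and cells `0, …, n-1` of array `2` then hold the machines of the schedule `σ`. -/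
def OutputsInTime {n m : ℕ} (prog : Prog) (N k : ℕ) (p : Fin n → ℚ) (σ : Fin n → Fin m)
    (T : ℝ) : Prop :=
  ∃ (t : ℕ) (M : Mem), Exec prog (inputMem N k p) t M ∧ (t : ℝ) ≤ T ∧
    ∀ j : Fin n, M.arr 2 j = (σ j : ℕ)

end CCS

/-! Sizes are rounded to numbers with few significant digits, and the schedule is a function of the
rounded sizes. A job is big if it makes up at least a fraction 1/Δ of the load, Δ being
`granularity`. When a new job does (`Renews`), everything may be moved, at cost Δ per unit of its
size. Between such fresh starts the partition of the big jobs depends only on the first `epoch`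
jobs, so it stays fixed and only small jobs move.

The big jobs are split by a knapsack computation on pairs (rounded weight, cardinality), which is
nearly optimal (`loads_le`). The small jobs are sorted by decreasing size, and κ slots are reserved
on each machine. The ranks i and 2κ-1-i always go to different machines, which keeps the
cardinalities feasible (`split_feasible`). The top T ranks go to the second machine, which has the
lighter big jobs up to rounding; T is least such that the accumulated gains make up for the lead D
of the first machine. The ranks between T and its mirror alternate. If the gains reach D, the loads
nearly agree, and half the total size bounds every schedule from below (`balanced_split`). Otherwise
the first machine holds, besides its big jobs, only the smallest small jobs, and the second machine
is hardly worse (`unbalanced_split`); up to small errors every schedule pays for this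
(`heavyLoad_add_tail_le`). The errors are O(S/N) for total size S: if k = O(N²), then Δ is of order
N³ and all small jobs together are negligible; if k is larger, there are at most 64N big jobs, κ is
at least of order N², and any 64N ranks beyond κ are negligible.

Among small jobs of equal size only the number on the second machine matters. With T fixed, a new
job of size x changes this number by at most one for each occurring size up to x, and these sizes
add up to O(N)x because distinct rounded sizes have relative gaps (`quota_insert`, `sum_le_of_gap`).
When T moves, the ranks in between have total gain at most (Λ+1)²x with Λ = 64N
(`IsInsertion.sum_gain_cutoff`). The gain of such a rank is at least Λ/G times its size, where 1/G
is the relative gap, unless the rank and its mirror have equal sizes, and then swapping them is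
invisible. So the migration factor is O(N²) without a fresh start and O(N³) in general, which is
O(1/ε⁵) for ε < 1. For ε ≥ 1 every feasible schedule is good enough and nothing has to move.

For the running time, all these functions are shown to belong to `Comp`, a class closed under
arithmetic and loops of polynomial length, each member of which is compiled to a polynomial time
program (`Comp.computes`). -/

/-! ### A class of functions that the random access machine computes in polynomial time -/

namespace CCS

open Polynomial

/-- The numerical data of an instance. -/
structure Inst where
  N : ℕ
  k : ℕ
  n : ℕ
  num : ℕ → ℕ
  den : ℕ → ℕ

/-- Operations that may be iterated in a counting loop. -/
inductive FoldOp where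
  | add
  | mul
  | max

def FoldOp.fn : FoldOp → ℕ → ℕ → ℕ
  | .add, x, y => x + y
  | .mul, x, y => x * y
  | .max, x, y => x + (y - x)

def FoldOp.expr : FoldOp → Expr → Expr → Expr
  | .add, x, y => .add x y
  | .mul, x, y => .mul x y
  | .max, x, y => .add x (.sub y x)

/-- `Comp true f`: the values of `f` are polynomially bounded; `Comp false f`: their bit lengths
are. In both cases `f` is built from operations of the machine and loops of polynomially bounded
length. The list holds the current values of the loop variables. -/
inductive Comp : Bool → (Inst → List ℕ → ℕ) → Prop
  | const {ty : Bool} (c : ℕ) : Comp ty fun _ _ => c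
  | N : Comp true fun I _ => I.N
  | k : Comp false fun I _ => I.k
  | n : Comp true fun I _ => I.n
  | hd : Comp true fun _ e => e.headI
  | tl {ty : Bool} {f : Inst → List ℕ → ℕ} : Comp ty f → Comp ty fun I e => f I e.tail
  | num {f : Inst → List ℕ → ℕ} : Comp true f → Comp false fun I e => I.num (f I e)
  | den {f : Inst → List ℕ → ℕ} : Comp true f → Comp false fun I e => I.den (f I e)
  | add {ty : Bool} {f g : Inst → List ℕ → ℕ} :
      Comp ty f → Comp ty g → Comp ty fun I e => f I e + g I e
  | mul {ty : Bool} {f g : Inst → List ℕ → ℕ} :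
      Comp ty f → Comp ty g → Comp ty fun I e => f I e * g I e
  | sub {ty : Bool} {f g : Inst → List ℕ → ℕ} :
      Comp ty f → Comp false g → Comp ty fun I e => f I e - g I e
  | div {ty : Bool} {f g : Inst → List ℕ → ℕ} :
      Comp ty f → Comp false g → Comp ty fun I e => f I e / g I e
  | size {f : Inst → List ℕ → ℕ} : Comp false f → Comp true fun I e => Nat.size (f I e)
  | big {f : Inst → List ℕ → ℕ} : Comp true f → Comp false f
  | fold {ty : Bool} {f g : Inst → List ℕ → ℕ} (o : FoldOp) (c : ℕ) :
      (ty = true → o ≠ .mul) → Comp true g → Comp ty f →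
      Comp ty fun I e => Nat.rec c (fun i acc => o.fn acc (f I (i :: e))) (g I e)
  | iterSub {f g c : Inst → List ℕ → ℕ} : Comp true g → Comp true c → Comp true f →
      Comp true fun I e => Nat.rec (c I e) (fun i acc => acc - f I (i :: acc :: e)) (g I e)

/-- All parameters of the instance and all loop variables are bounded by `ℓ`. -/
structure Inst.Bounded (I : Inst) (e : List ℕ) (ℓ : ℕ) : Prop where
  N_le : I.N ≤ ℓ
  n_le : I.n ≤ ℓ
  k_le : Nat.size I.k ≤ ℓ
  num_le : ∀ i, Nat.size (I.num i) ≤ ℓ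
  den_le : ∀ i, Nat.size (I.den i) ≤ ℓ
  env_le : ∀ x ∈ e, x ≤ ℓ

/-! ### Polynomial bounds on values and bit lengths -/

theorem nat_size_le_self (x : ℕ) : Nat.size x ≤ x :=
  Nat.size_le.2 Nat.lt_two_pow_self

theorem nat_size_mul_le (x y : ℕ) : Nat.size (x * y) ≤ Nat.size x + Nat.size y := by
  rw [Nat.size_le, pow_add]
  exact Nat.mul_lt_mul'' (Nat.lt_size_self x) (Nat.lt_size_self y)

theorem nat_size_add_le (x y : ℕ) : Nat.size (x + y) ≤ Nat.size x + Nat.size y + 1 := by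
  rw [Nat.size_le, pow_succ, pow_add]
  have hx := Nat.lt_size_self x
  have hy := Nat.lt_size_self y
  have h1 : 1 ≤ 2 ^ Nat.size x := Nat.one_le_two_pow
  have h2 : 1 ≤ 2 ^ Nat.size y := Nat.one_le_two_pow
  nlinarith

theorem FoldOp.size_fn_le (o : FoldOp) (x y : ℕ) :
    Nat.size (o.fn x y) ≤ Nat.size x + Nat.size y + 1 := by
  cases o with
  | add => exact nat_size_add_le x y
  | mul => exact (nat_size_mul_le x y).trans (Nat.le_succ _)
  | max =>
    have : x + (y - x) = x ∨ x + (y - x) = y := by omega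
    simp only [FoldOp.fn]
    rcases this with h | h <;> rw [h] <;> omega

/-- What is polynomially bounded for a function of the given type. -/
def gauge (ty : Bool) (x : ℕ) : ℕ := if ty then x else Nat.size x

theorem size_le_gauge (ty : Bool) (x : ℕ) : Nat.size x ≤ gauge ty x := by
  cases ty
  · exact le_rfl
  · exact nat_size_le_self x

theorem gauge_mono (ty : Bool) {x y : ℕ} (h : x ≤ y) : gauge ty x ≤ gauge ty y := by
  cases ty
  · exact Nat.size_le_size h
  · exact h

theorem Inst.Bounded.mono {I : Inst} {e : List ℕ} {ℓ ℓ' : ℕ} (h : I.Bounded e ℓ) (hl : ℓ ≤ ℓ') :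
    I.Bounded e ℓ' :=
  ⟨h.N_le.trans hl, h.n_le.trans hl, h.k_le.trans hl, fun i => (h.num_le i).trans hl,
    fun i => (h.den_le i).trans hl, fun x hx => (h.env_le x hx).trans hl⟩

theorem Inst.Bounded.cons {I : Inst} {e : List ℕ} {ℓ x : ℕ} (h : I.Bounded e ℓ) (hx : x ≤ ℓ) :
    I.Bounded (x :: e) ℓ :=
  { h with env_le := fun y hy => (List.mem_cons.1 hy).elim (fun hy => hy ▸ hx) (h.env_le y) }

theorem Inst.Bounded.tail {I : Inst} {e : List ℕ} {ℓ : ℕ} (h : I.Bounded e ℓ) :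
    I.Bounded e.tail ℓ :=
  { h with env_le := fun x hx => h.env_le x (List.mem_of_mem_tail hx) }

def GaugeBounded (ty : Bool) (f : Inst → List ℕ → ℕ) : Prop :=
  ∃ P : ℕ[X], ∀ I e ℓ, I.Bounded e ℓ → gauge ty (f I e) ≤ P.eval ℓ

theorem GaugeBounded.size {ty : Bool} {f : Inst → List ℕ → ℕ} (h : GaugeBounded ty f) :
    GaugeBounded false f := by
  obtain ⟨P, hP⟩ := h
  exact ⟨P, fun I e ℓ hb => (size_le_gauge ty _).trans (hP I e ℓ hb)⟩

/-- Every operation, multiplication included, lengthens the accumulator by at most the length of the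
operand plus one bit. So an iterated product still has polynomial length, though not polynomial
value. -/
theorem size_fold_le (o : FoldOp) (c : ℕ) (f : ℕ → ℕ) (B m : ℕ)
    (hf : ∀ i < m, Nat.size (f i) ≤ B) :
    Nat.size (Nat.rec c (fun i acc => o.fn acc (f i)) m : ℕ) ≤ Nat.size c + m * (B + 1) := by
  induction m with
  | zero => simp
  | succ m ih =>
    have h1 := ih fun i hi => hf i (by omega)
    have h2 := o.size_fn_le (Nat.rec c (fun i acc => o.fn acc (f i)) m) (f m)
    have h3 := hf m (by omega)
    simp only
    nlinarith

theorem fold_le (o : FoldOp) (ho : o ≠ .mul) (c : ℕ) (f : ℕ → ℕ) (B m : ℕ)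
    (hf : ∀ i < m, f i ≤ B) :
    (Nat.rec c (fun i acc => o.fn acc (f i)) m : ℕ) ≤ c + m * B := by
  induction m with
  | zero => simp
  | succ m ih =>
    have h1 := ih fun i hi => hf i (by omega)
    have h3 := hf m (by omega)
    have h2 : o.fn (Nat.rec c (fun i acc => o.fn acc (f i)) m) (f m) ≤
        Nat.rec c (fun i acc => o.fn acc (f i)) m + f m := by
      cases o with
      | add => exact le_rfl
      | mul => exact absurd rfl ho
      | max => simp only [FoldOp.fn]; omega
    simp only
    nlinarith

theorem iterSub_le (c : ℕ) (f : ℕ → ℕ → ℕ) (m : ℕ) :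
    (Nat.rec c (fun i acc => acc - f i acc) m : ℕ) ≤ c := by
  induction m with
  | zero => simp
  | succ m ih => exact (Nat.sub_le _ _).trans ih

/-- Induction over the construction. The two types exist because a loop may only run up to a number
of polynomial value, while sizes and generating functions merely have polynomial length. -/
theorem Comp.gaugeBounded {ty : Bool} {f : Inst → List ℕ → ℕ} (h : Comp ty f) :
    GaugeBounded ty f := by
  induction h with
  | @const ty c =>
    refine ⟨C c, fun I e ℓ _ => ?_⟩
    cases ty
    · simpa [gauge] using nat_size_le_self c
    · simp [gauge]
  | N => exact ⟨X, fun I e ℓ h => by simpa [gauge] using h.N_le⟩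
  | k => exact ⟨X, fun I e ℓ h => by simpa [gauge] using h.k_le⟩
  | n => exact ⟨X, fun I e ℓ h => by simpa [gauge] using h.n_le⟩
  | hd =>
    refine ⟨X, fun I e ℓ h => ?_⟩
    cases e with
    | nil => simp [gauge]
    | cons x e => simpa [gauge] using h.env_le x (by simp)
  | tl _ ih =>
    obtain ⟨P, hP⟩ := ih
    exact ⟨P, fun I e ℓ h => hP I _ ℓ h.tail⟩
  | num => exact ⟨X, fun I e ℓ h => by simpa [gauge] using h.num_le _⟩
  | den => exact ⟨X, fun I e ℓ h => by simpa [gauge] using h.den_le _⟩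
  | @add ty f g _ _ ihf ihg =>
    obtain ⟨P, hP⟩ := ihf
    obtain ⟨Q, hQ⟩ := ihg
    refine ⟨P + Q + 1, fun I e ℓ h => ?_⟩
    have h1 := hP I e ℓ h
    have h2 := hQ I e ℓ h
    have h3 := nat_size_add_le (f I e) (g I e)
    cases ty <;> simp [gauge] at * <;> omega
  | @mul ty f g _ _ ihf ihg =>
    obtain ⟨P, hP⟩ := ihf
    obtain ⟨Q, hQ⟩ := ihg
    -- One polynomial for both types: lengths add up, values multiply.
    refine ⟨P + Q + P * Q, fun I e ℓ h => ?_⟩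
    have h1 := hP I e ℓ h
    have h2 := hQ I e ℓ h
    cases ty <;> simp only [gauge, eval_add, eval_mul, if_true] at *
    · have h3 := nat_size_mul_le (f I e) (g I e)
      have : 0 ≤ P.eval ℓ * Q.eval ℓ := Nat.zero_le _
      simp at *
      omega
    · have := Nat.mul_le_mul h1 h2
      omega
  | @sub ty f g _ _ ihf ihg =>
    obtain ⟨P, hP⟩ := ihf
    exact ⟨P, fun I e ℓ h => (gauge_mono ty (Nat.sub_le _ _)).trans (hP I e ℓ h)⟩
  | @div ty f g _ _ ihf ihg =>
    obtain ⟨P, hP⟩ := ihf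
    exact ⟨P, fun I e ℓ h => (gauge_mono ty (Nat.div_le_self _ _)).trans (hP I e ℓ h)⟩
  | size _ ih => exact ih
  | big _ ih => exact ih.size
  | @fold ty f g o c ho _ _ ihg ihf =>
    obtain ⟨P, hP⟩ := ihf
    obtain ⟨G, hG⟩ := ihg
    -- The loop variable stays below `G.eval ℓ`, so the body is bounded by its polynomial at `ℓ +
    -- G.eval ℓ`.
    refine ⟨C c + G * (P.comp (X + G) + 1), fun I e ℓ h => ?_⟩
    have hg : g I e ≤ G.eval ℓ := hG I e ℓ h
    have hf : ∀ i < g I e, gauge ty (f I (i :: e)) ≤ P.eval (ℓ + G.eval ℓ) := fun i hi =>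
      hP I (i :: e) _ ((h.mono (Nat.le_add_right _ _)).cons (by omega))
    cases ty
    · have h1 := size_fold_le o c (fun i => f I (i :: e)) _ (g I e) hf
      have h2 := nat_size_le_self c
      simp only [gauge, Bool.false_eq_true, if_false, eval_add, eval_mul, eval_comp, eval_X,
        eval_one, eval_C]
      have := Nat.mul_le_mul hg (le_refl (P.eval (ℓ + G.eval ℓ) + 1))
      omega
    · have h1 := fold_le o (ho rfl) c (fun i => f I (i :: e)) _ (g I e) hf
      simp only [gauge, if_true, eval_add, eval_mul, eval_comp, eval_X, eval_one, eval_C]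
      have := Nat.mul_le_mul hg (Nat.le_succ (P.eval (ℓ + G.eval ℓ)))
      have h4 : g I e * (P.eval (ℓ + G.eval ℓ)) ≤ G.eval ℓ * (P.eval (ℓ + G.eval ℓ) + 1) := this
      exact h1.trans (by omega)
  | @iterSub f g c _ _ _ _ ihc _ =>
    obtain ⟨P, hP⟩ := ihc
    exact ⟨P, fun I e ℓ h => (iterSub_le (c I e) (fun i acc => f I (i :: acc :: e)) (g I e)).trans
      (hP I e ℓ h)⟩

/-! ### Compilation to programs of the random access machine -/

/-- The memory holds the instance in registers `0, 1, 2` and arrays `0, 1`. -/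
structure Inst.Rep (I : Inst) (M : Mem) : Prop where
  N : M.reg 0 = I.N
  k : M.reg 1 = I.k
  n : M.reg 2 = I.n
  num : ∀ i, M.arr 0 i = I.num i
  den : ∀ i, M.arr 1 i = I.den i

/-- Arrays and registers below `b` agree. -/
structure Agree (b : ℕ) (M M' : Mem) : Prop where
  arr : M'.arr = M.arr
  reg : ∀ x < b, M'.reg x = M.reg x

theorem Agree.trans {b : ℕ} {M M' M'' : Mem} (h : Agree b M M') (h' : Agree b M' M'') :
    Agree b M M'' :=
  ⟨h'.arr.trans h.arr, fun x hx => (h'.reg x hx).trans (h.reg x hx)⟩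

theorem Agree.mono {b c : ℕ} {M M' : Mem} (h : Agree c M M') (hbc : b ≤ c) : Agree b M M' :=
  ⟨h.arr, fun x hx => h.reg x (hx.trans_le hbc)⟩

theorem Agree.setReg (b : ℕ) (M : Mem) {x : ℕ} (v : ℕ) (hx : b ≤ x) : Agree b M (M.setReg x v) :=
  ⟨rfl, fun y hy => Function.update_of_ne (by omega) _ _⟩

theorem Inst.Rep.of_agree {I : Inst} {b : ℕ} {M M' : Mem} (h : I.Rep M) (hb : 3 ≤ b)
    (ha : Agree b M M') : I.Rep M' :=
  ⟨(ha.reg 0 (by omega)).trans h.N, (ha.reg 1 (by omega)).trans h.k,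
    (ha.reg 2 (by omega)).trans h.n, fun i => by rw [ha.arr]; exact h.num i,
    fun i => by rw [ha.arr]; exact h.den i⟩

theorem Agree.map_reg {b : ℕ} {M M' : Mem} (ha : Agree b M M') {rs : List ℕ}
    (hrs : ∀ r ∈ rs, r < b) : rs.map M'.reg = rs.map M.reg :=
  List.map_congr_left fun r hr => ha.reg r (hrs r hr)

/-- Some program writes the value of `f` to register `b`, where the loop variables are read from
the registers `rs`, in polynomial time and without changing registers below `b`. -/
def Computes (f : Inst → List ℕ → ℕ) : Prop :=
  ∀ (rs : List ℕ) (b : ℕ), 3 ≤ b → (∀ r ∈ rs, r < b) →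
    ∃ (prog : Prog) (T : ℕ[X]), ∀ (I : Inst) (M : Mem) (ℓ : ℕ), I.Rep M →
      I.Bounded (rs.map M.reg) ℓ →
      ∃ (t : ℕ) (M' : Mem), Exec prog M t M' ∧ t ≤ T.eval ℓ ∧ Agree b M M' ∧
        M'.reg b = f I (rs.map M.reg)

@[simp] theorem setReg_same (M : Mem) (x v : ℕ) : (M.setReg x v).reg x = v :=
  Function.update_self _ _ _

theorem setReg_ne (M : Mem) {x y : ℕ} (v : ℕ) (h : y ≠ x) : (M.setReg x v).reg y = M.reg y :=
  Function.update_of_ne h _ _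

theorem Exec.set_of_val {x v : ℕ} {e : Expr} {M : Mem} (h : e.val M = v) :
    Exec (.set x e) M (e.cost M + 1) (M.setReg x v) :=
  h ▸ .set x e M

theorem Computes.of_expr {f : Inst → List ℕ → ℕ} (hs : GaugeBounded false f)
    (h : ∀ rs : List ℕ, ∃ x : Expr, ∀ (I : Inst) (M : Mem), I.Rep M →
      x.val M = f I (rs.map M.reg) ∧ x.cost M = Nat.size (x.val M) + 1) : Computes f := by
  intro rs b hb hrs
  obtain ⟨x, hx⟩ := h rs
  obtain ⟨P, hP⟩ := hs
  refine ⟨.set b x, P + C 2, fun I M ℓ hI hB => ?_⟩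
  refine ⟨_, _, .set b x M, ?_, Agree.setReg b M _ le_rfl, ?_⟩
  · have := hP I _ ℓ hB
    rw [(hx I M hI).2, (hx I M hI).1]
    simp [gauge] at *
    omega
  · rw [setReg_same]
    exact (hx I M hI).1

/-- Registers from `b` on act as a stack: the first operand stays in `b` while the second is
computed with base `b + 1`. -/
theorem Computes.bin {f g : Inst → List ℕ → ℕ} (op : ℕ → ℕ → ℕ) (E : Expr → Expr → Expr)
    (hE : ∀ (M : Mem) (x y : Expr), (E x y).val M = op (x.val M) (y.val M) ∧
      (E x y).cost M = x.cost M + y.cost M + (Nat.size (op (x.val M) (y.val M)) + 1))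
    (hf : Computes f) (hg : Computes g) (sf : GaugeBounded false f) (sg : GaugeBounded false g)
    (s : GaugeBounded false fun I e => op (f I e) (g I e)) :
    Computes fun I e => op (f I e) (g I e) := by
  intro rs b hb hrs
  obtain ⟨p, T, hp⟩ := hf rs b hb hrs
  obtain ⟨q, U, hq⟩ := hg rs (b + 1) (by omega) fun r hr => (hrs r hr).trans (by omega)
  obtain ⟨P, hP⟩ := sf
  obtain ⟨Q, hQ⟩ := sg
  obtain ⟨S, hS⟩ := s
  refine ⟨.seq p (.seq q (.set b (E (.reg b) (.reg (b + 1))))), T + U + P + Q + S + C 4,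
    fun I M ℓ hI hB => ?_⟩
  obtain ⟨t, M₁, e₁, ht, a₁, v₁⟩ := hp I M ℓ hI hB
  have hm := a₁.map_reg hrs
  obtain ⟨u, M₂, e₂, hu, a₂, v₂⟩ := hq I M₁ ℓ (hI.of_agree hb a₁) (by rwa [hm])
  rw [hm] at v₂
  have v₁' : M₂.reg b = f I (rs.map M.reg) := (a₂.reg b (by omega)).trans v₁
  refine ⟨_, _, .seq e₁ (.seq e₂ (.set _ _ _)), ?_,
    (a₁.trans (a₂.mono (by omega))).trans (Agree.setReg b M₂ _ le_rfl), ?_⟩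
  · rw [(hE _ _ _).2]
    have h1 := hP I _ ℓ hB
    have h2 := hQ I _ ℓ hB
    have h3 := hS I _ ℓ hB
    simp [gauge, Expr.cost, Expr.val, v₁', v₂] at *
    omega
  · rw [setReg_same, (hE _ _ _).1]
    simp [Expr.val, v₁', v₂]

theorem Computes.arr {f g : Inst → List ℕ → ℕ} (a : ℕ) (hf : Computes f)
    (sf : GaugeBounded false f) (sg : GaugeBounded false g)
    (h : ∀ (I : Inst) (M : Mem) (e : List ℕ), I.Rep M → M.arr a (f I e) = g I e) :
    Computes g := by
  intro rs b hb hrs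
  obtain ⟨p, T, hp⟩ := hf rs b hb hrs
  obtain ⟨P, hP⟩ := sf
  obtain ⟨Q, hQ⟩ := sg
  refine ⟨.seq p (.set b (.get a (.reg b))), T + P + Q + C 3, fun I M ℓ hI hB => ?_⟩
  obtain ⟨t, M₁, e₁, ht, a₁, v₁⟩ := hp I M ℓ hI hB
  have hv := h I M₁ (rs.map M.reg) (hI.of_agree hb a₁)
  refine ⟨_, _, .seq e₁ (.set _ _ _), ?_, a₁.trans (Agree.setReg b M₁ _ le_rfl), ?_⟩
  · have h1 := hP I _ ℓ hB
    have h2 := hQ I _ ℓ hB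
    simp [gauge, Expr.cost, Expr.val, v₁, hv] at *
    omega
  · rw [setReg_same]
    simp [Expr.val, v₁, hv]

/-- The machine has no instruction for the bit length, so it is found by counting halvings. -/
theorem exec_size_loop (b : ℕ) (B : ℕ) (M₀ : Mem) : ∀ (s : ℕ) (M : Mem), s + M.reg (b + 1) ≤ B →
    Nat.size (M.reg b) = s → Agree b M₀ M →
    ∃ (t : ℕ) (M' : Mem), Exec (.loop (.reg b) (.seq (.set b (.div (.reg b) (.const 2)))
      (.set (b + 1) (.add (.reg (b + 1)) (.const 1))))) M t M' ∧ t ≤ (s + 1) * (5 * B + 20) ∧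
      Agree b M₀ M' ∧ M'.reg (b + 1) = M.reg (b + 1) + s := by
  intro s
  induction s with
  | zero =>
    intro M hB hs ha
    have h0 : M.reg b = 0 := Nat.size_eq_zero.1 hs
    refine ⟨_, M, .loopFalse h0, ?_, ha, rfl⟩
    simp only [Expr.cost, hs]
    omega
  | succ s ih =>
    intro M hB hs ha
    have h0 : M.reg b ≠ 0 := fun h => by simp [h] at hs
    have hdiv : Nat.size (M.reg b / 2) = s := by
      have h1 := Nat.size_bit (b := (M.reg b).bodd) (n := (M.reg b).div2)
        (by rwa [Nat.bit_bodd_div2])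
      rw [Nat.bit_bodd_div2, hs, Nat.div2_val] at h1
      omega
    set M₁ := M.setReg b (M.reg b / 2) with hM₁
    set M₂ := M₁.setReg (b + 1) (M.reg (b + 1) + 1) with hM₂
    have r1 : M₁.reg (b + 1) = M.reg (b + 1) := setReg_ne _ _ (by omega)
    have r2 : M₂.reg b = M.reg b / 2 := by
      rw [hM₂, setReg_ne _ _ (by omega), hM₁, setReg_same]
    have r3 : M₂.reg (b + 1) = M.reg (b + 1) + 1 := by rw [hM₂, setReg_same]
    obtain ⟨t, M', e, ht, a, v⟩ := ih M₂ (by rw [r3]; omega) (by rw [r2]; exact hdiv)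
      ((ha.trans (Agree.setReg b M _ le_rfl)).trans (Agree.setReg b M₁ _ (by omega)))
    have e1 : Exec (.set b (.div (.reg b) (.const 2))) M _ M₁ := .set b _ M
    have e2 : Exec (.set (b + 1) (.add (.reg (b + 1)) (.const 1))) M₁ _ M₂ :=
      .set_of_val (by simp only [Expr.val, r1])
    refine ⟨_, M', .loopTrue (by simpa [Expr.val] using h0) (.seq e1 e2) e, ?_, a, ?_⟩
    · have c2 : Nat.size 2 = 2 := by decide
      have c1 : Nat.size 1 = 1 := by decide
      have z1 := nat_size_le_self (M.reg (b + 1))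
      have z2 := nat_size_le_self (M.reg (b + 1) + 1)
      simp only [Expr.cost, Expr.val, r1, hs, hdiv, c1, c2]
      have : (s + 1 + 1) * (5 * B + 20) = (s + 1) * (5 * B + 20) + (5 * B + 20) := by ring
      omega
    · rw [v, r3]
      omega

theorem Computes.size {f : Inst → List ℕ → ℕ} (hf : Computes f) (sf : GaugeBounded false f) :
    Computes fun I e => Nat.size (f I e) := by
  intro rs b hb hrs
  obtain ⟨p, T, hp⟩ := hf rs b hb hrs
  obtain ⟨P, hP⟩ := sf
  refine ⟨.seq p (.seq (.set (b + 1) (.const 0)) (.seq (.loop (.reg b)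
    (.seq (.set b (.div (.reg b) (.const 2)))
      (.set (b + 1) (.add (.reg (b + 1)) (.const 1))))) (.set b (.reg (b + 1))))),
    T + (P + 1) * (5 * P + 20) + P + C 10, fun I M ℓ hI hB => ?_⟩
  obtain ⟨t, M₁, e₁, ht, a₁, v₁⟩ := hp I M ℓ hI hB
  have h1 := hP I _ ℓ hB
  simp only [gauge, Bool.false_eq_true, if_false] at h1
  set M₂ := M₁.setReg (b + 1) 0 with hM₂
  have r1 : M₂.reg b = f I (rs.map M.reg) := by rw [hM₂, setReg_ne _ _ (by omega), v₁]
  have r2 : M₂.reg (b + 1) = 0 := by rw [hM₂, setReg_same]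
  obtain ⟨u, M₃, e₃, hu, a₃, v₃⟩ := exec_size_loop b (P.eval ℓ) M _ M₂ (by rw [r1, r2]; exact h1)
    rfl (a₁.trans (Agree.setReg b M₁ _ (by omega)))
  rw [r1, r2, zero_add] at v₃
  refine ⟨_, _, .seq e₁ (.seq (.set (b + 1) (.const 0) M₁) (.seq e₃ (.set _ _ _))), ?_,
    a₃.trans (Agree.setReg b M₃ _ le_rfl), ?_⟩
  · rw [r1] at hu
    have z := nat_size_le_self (Nat.size (f I (rs.map M.reg)))
    have h2 := Nat.mul_le_mul (Nat.add_le_add_right h1 1) (le_refl (5 * P.eval ℓ + 20))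
    have z0 : Nat.size 0 = 0 := Nat.size_zero
    simp only [Expr.cost, v₃, z0, eval_add, eval_mul, eval_one, eval_C, eval_ofNat]
    omega
  · rw [setReg_same]
    simp [Expr.val, v₃]

/-- State of a counting loop after `i` rounds. -/
structure LoopInv (b m : ℕ) (acc : ℕ → ℕ) (M₀ : Mem) (i : ℕ) (M : Mem) : Prop where
  agree : Agree b M₀ M
  bound : M.reg b = m
  acc : M.reg (b + 1) = acc i
  idx : M.reg (b + 2) = i

/-- Truncated subtraction serves as the test: bound minus index is nonzero exactly while rounds
remain. -/
theorem exec_counting_loop {b m τ : ℕ} {acc : ℕ → ℕ} {M₀ : Mem} {body : Prog}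
    (hbody : ∀ i < m, ∀ M, LoopInv b m acc M₀ i M →
      ∃ (t : ℕ) (M' : Mem), Exec body M t M' ∧ t ≤ τ ∧ LoopInv b m acc M₀ (i + 1) M') :
    ∀ (d i : ℕ) (M : Mem), i + d = m → LoopInv b m acc M₀ i M →
      ∃ (t : ℕ) (M' : Mem), Exec (.loop (.sub (.reg b) (.reg (b + 2))) body) M t M' ∧
        t ≤ (d + 1) * (τ + 3 * m + 10) ∧ LoopInv b m acc M₀ m M' := by
  intro d
  induction d with
  | zero =>
    intro i M hi hM
    have him : i = m := by omega
    subst him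
    have hz : (Expr.sub (.reg b) (.reg (b + 2))).val M = 0 := by
      simp [Expr.val, hM.bound, hM.idx]
    refine ⟨_, M, .loopFalse hz, ?_, hM⟩
    have z1 := nat_size_le_self i
    simp only [Expr.cost, Expr.val, hM.bound, hM.idx, Nat.sub_self, Nat.size_zero]
    omega
  | succ d ih =>
    intro i M hi hM
    have hz : (Expr.sub (.reg b) (.reg (b + 2))).val M ≠ 0 := by
      simp [Expr.val, hM.bound, hM.idx]
      omega
    obtain ⟨t, M₁, e₁, ht, h₁⟩ := hbody i (by omega) M hM
    obtain ⟨u, M₂, e₂, hu, h₂⟩ := ih (i + 1) M₁ (by omega) h₁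
    refine ⟨_, M₂, .loopTrue hz e₁ e₂, ?_, h₂⟩
    have z1 := nat_size_le_self i
    have z2 := nat_size_le_self m
    have z3 := nat_size_le_self (m - i)
    simp only [Expr.cost, Expr.val, hM.bound, hM.idx]
    have : (d + 1 + 1) * (τ + 3 * m + 10) = (d + 1) * (τ + 3 * m + 10) + (τ + 3 * m + 10) := by
      ring
    omega

/-- A counting loop whose accumulator starts with `c` and is updated by `E`. -/
theorem Computes.loop {g c : Inst → List ℕ → ℕ} (upd : Inst → List ℕ → ℕ → ℕ → ℕ)
    (arg : Inst → List ℕ → ℕ → ℕ → ℕ) (op : ℕ → ℕ → ℕ) (E : Expr → Expr → Expr)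
    (hE : ∀ (M : Mem) (x y : ℕ), (E (.reg x) (.reg y)).val M = op (M.reg x) (M.reg y) ∧
      (E (.reg x) (.reg y)).cost M ≤ 3 * Nat.size (M.reg x) + 3 * Nat.size (M.reg y) +
        Nat.size (op (M.reg x) (M.reg y)) + 10)
    (hupd : ∀ I e i x, upd I e i x = op x (arg I e i x))
    (hg : Computes g) (hc : Computes c) (sg : GaugeBounded true g)
    (hs : ∃ S : ℕ[X], ∀ I e ℓ, I.Bounded e ℓ → ∀ m ≤ g I e,
      Nat.size (Nat.rec (c I e) (fun i acc => upd I e i acc) m : ℕ) ≤ S.eval ℓ)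
    (hf : ∀ (rs : List ℕ) (b : ℕ), 3 ≤ b → (∀ r ∈ rs, r < b) →
      ∃ (prog : Prog) (T : ℕ[X]), ∀ (I : Inst) (M : Mem) (ℓ : ℕ), I.Rep M →
        I.Bounded (rs.map M.reg) ℓ → M.reg (b + 2) < g I (rs.map M.reg) →
        M.reg (b + 1) = (Nat.rec (c I (rs.map M.reg))
          (fun i acc => upd I (rs.map M.reg) i acc) (M.reg (b + 2)) : ℕ) →
        ∃ (t : ℕ) (M' : Mem), Exec prog M t M' ∧ t ≤ T.eval ℓ ∧ Agree (b + 3) M M' ∧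
          M'.reg (b + 3) = arg I (rs.map M.reg) (M.reg (b + 2)) (M.reg (b + 1)) ∧
          Nat.size (M'.reg (b + 3)) ≤ T.eval ℓ) :
    Computes fun I e => Nat.rec (c I e) (fun i acc => upd I e i acc) (g I e) := by
  intro rs b hb hrs
  have hrs' : ∀ r ∈ rs, r < b + 1 := fun r hr => (hrs r hr).trans (by omega)
  obtain ⟨p, P, hp⟩ := hg rs b hb hrs
  obtain ⟨q, Q, hq⟩ := hc rs (b + 1) (by omega) hrs'
  obtain ⟨G, hG⟩ := sg
  obtain ⟨S, hS⟩ := hs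
  obtain ⟨w, W, hw⟩ := hf rs b hb hrs
  refine ⟨.seq p (.seq q (.seq (.set (b + 2) (.const 0)) (.seq
    (.loop (.sub (.reg b) (.reg (b + 2))) (.seq w (.seq
      (.set (b + 1) (E (.reg (b + 1)) (.reg (b + 3))))
      (.set (b + 2) (.add (.reg (b + 2)) (.const 1))))))
    (.set b (.reg (b + 1)))))),
    P + Q + S + (G + 1) * ((4 * W + 4 * S + 2 * G + 20) + 3 * G + 10) + C 10,
    fun I M ℓ hI hB => ?_⟩
  obtain ⟨t, M₁, e₁, ht, a₁, v₁⟩ := hp I M ℓ hI hB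
  have hm := a₁.map_reg hrs
  obtain ⟨u, M₂, e₂, hu, a₂, v₂⟩ := hq I M₁ ℓ (hI.of_agree hb a₁) (by rwa [hm])
  rw [hm] at v₂
  -- The loop variables lie below `b`, so they keep their values in all later memories.
  set e := rs.map M.reg with he
  have v₁' : M₂.reg b = g I e := (a₂.reg b (by omega)).trans v₁
  set M₃ := M₂.setReg (b + 2) 0 with hM₃
  have a₃ : Agree b M M₃ :=
    (a₁.trans (a₂.mono (by omega))).trans (Agree.setReg b M₂ _ (by omega))
  have hg := hG I e ℓ hB
  simp only [gauge, if_true] at hg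
  set acc : ℕ → ℕ := fun m => Nat.rec (c I e) (fun i acc => upd I e i acc) m with hacc
  have hinv : LoopInv b (g I e) acc M 0 M₃ :=
    ⟨a₃, by rw [hM₃, setReg_ne _ _ (by omega), v₁'],
      by rw [hM₃, setReg_ne _ _ (by omega)]; exact v₂, by rw [hM₃, setReg_same]⟩
  have hbody : ∀ i < g I e, ∀ M', LoopInv b (g I e) acc M i M' →
      ∃ (t : ℕ) (M'' : Mem), Exec (.seq w (.seq
      (.set (b + 1) (E (.reg (b + 1)) (.reg (b + 3))))
      (.set (b + 2) (.add (.reg (b + 2)) (.const 1))))) M' t M'' ∧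
        t ≤ 4 * W.eval ℓ + 4 * S.eval ℓ + 2 * G.eval ℓ + 20 ∧
        LoopInv b (g I e) acc M (i + 1) M'' := by
    intro i hi M' hM'
    have hm' := hM'.agree.map_reg hrs
    obtain ⟨x, N₁, d₁, hx, b₁, w₁, z₁⟩ := hw I M' ℓ (hI.of_agree hb hM'.agree) (by rwa [hm'])
      (by rw [hm', hM'.idx]; exact hi) (by rw [hm', hM'.idx, hM'.acc])
    rw [hm', hM'.idx, hM'.acc] at w₁
    have r1 : N₁.reg (b + 1) = acc i := (b₁.reg _ (by omega)).trans hM'.acc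
    have r2 : N₁.reg (b + 2) = i := (b₁.reg _ (by omega)).trans hM'.idx
    have r0 : N₁.reg b = g I e := (b₁.reg _ (by omega)).trans hM'.bound
    have hval : op (acc i) (arg I e i (acc i)) = acc (i + 1) := (hupd I e i (acc i)).symm
    set N₂ := N₁.setReg (b + 1) (acc (i + 1)) with hN₂
    set N₃ := N₂.setReg (b + 2) (i + 1) with hN₃
    have d₂ : Exec (.set (b + 1) (E (.reg (b + 1)) (.reg (b + 3)))) N₁ _ N₂ :=
      .set_of_val (by rw [(hE _ _ _).1, r1, w₁, hval])
    have r3 : N₂.reg (b + 2) = i := by rw [hN₂, setReg_ne _ _ (by omega), r2]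
    have d₃ : Exec (.set (b + 2) (.add (.reg (b + 2)) (.const 1))) N₂ _ N₃ :=
      .set_of_val (by simp only [Expr.val, r3])
    refine ⟨_, N₃, .seq d₁ (.seq d₂ d₃), ?_, ?_, ?_, ?_, ?_⟩
    · have c1 : Nat.size 1 = 1 := by decide
      have y1 := (hE N₁ (b + 1) (b + 3)).2
      rw [r1, w₁, hval] at y1
      rw [w₁] at z₁
      have y2 := hS I e ℓ hB i hi.le
      have y3 := hS I e ℓ hB (i + 1) hi
      have y4 := nat_size_le_self i
      have y5 := nat_size_le_self (i + 1)
      simp only [Expr.cost, Expr.val, r3, c1]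
      change Nat.size (acc i) ≤ _ at y2
      change Nat.size (acc (i + 1)) ≤ _ at y3
      omega
    · exact ((hM'.agree.trans (b₁.mono (by omega))).trans (Agree.setReg b N₁ _ (by omega))).trans
        (Agree.setReg b N₂ _ (by omega))
    · rw [hN₃, setReg_ne _ _ (by omega), hN₂, setReg_ne _ _ (by omega), r0]
    · rw [hN₃, setReg_ne _ _ (by omega), hN₂, setReg_same]
    · rw [hN₃, setReg_same]
  obtain ⟨x, M₄, e₄, hx, h₄⟩ := exec_counting_loop hbody (g I e) 0 M₃ (by omega) hinv
  refine ⟨_, _, .seq e₁ (.seq e₂ (.seq (.set (b + 2) (.const 0) M₂) (.seq e₄ (.set _ _ _)))), ?_,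
    h₄.agree.trans (Agree.setReg b M₄ _ le_rfl), ?_⟩
  · have y2 := hS I e ℓ hB _ le_rfl
    change Nat.size (acc (g I e)) ≤ _ at y2
    have y3 : (g I e + 1) * (4 * W.eval ℓ + 4 * S.eval ℓ + 2 * G.eval ℓ + 20 + 3 * g I e + 10) ≤
        (G.eval ℓ + 1) * (4 * W.eval ℓ + 4 * S.eval ℓ + 2 * G.eval ℓ + 20 + 3 * G.eval ℓ + 10) := by
      gcongr
    simp [Expr.cost, h₄.acc]
    omega
  · rw [setReg_same]
    simp [Expr.val, h₄.acc, hacc]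

/-- Induction over the construction. The bounds of `Comp.gaugeBounded` pay for the logarithmic cost
of every intermediate value. -/
theorem Comp.computes {ty : Bool} {f : Inst → List ℕ → ℕ} (h : Comp ty f) : Computes f := by
  induction h with
  | @const ty c =>
    exact .of_expr (Comp.const (ty := false) c).gaugeBounded fun rs =>
      ⟨.const c, fun I M hI => ⟨rfl, rfl⟩⟩
  | N => exact .of_expr Comp.N.gaugeBounded.size fun rs => ⟨.reg 0, fun I M hI => ⟨hI.N, rfl⟩⟩
  | k => exact .of_expr Comp.k.gaugeBounded.size fun rs => ⟨.reg 1, fun I M hI => ⟨hI.k, rfl⟩⟩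
  | n => exact .of_expr Comp.n.gaugeBounded.size fun rs => ⟨.reg 2, fun I M hI => ⟨hI.n, rfl⟩⟩
  | hd =>
    refine .of_expr Comp.hd.gaugeBounded.size fun rs => ?_
    cases rs with
    | nil => exact ⟨.const 0, fun I M hI => ⟨rfl, rfl⟩⟩
    | cons r rs => exact ⟨.reg r, fun I M hI => ⟨rfl, rfl⟩⟩
  | tl _ ih =>
    intro rs b hb hrs
    obtain ⟨p, T, hp⟩ := ih rs.tail b hb fun r hr => hrs r (List.mem_of_mem_tail hr)
    refine ⟨p, T, fun I M ℓ hI hB => ?_⟩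
    obtain ⟨t, M', h1, h2, h3, h4⟩ := hp I M ℓ hI (by rw [List.map_tail]; exact hB.tail)
    exact ⟨t, M', h1, h2, h3, by rw [h4, List.map_tail]⟩
  | num hf ih =>
    exact ih.arr 0 hf.gaugeBounded.size (Comp.num hf).gaugeBounded fun I M e hI => hI.num _
  | den hf ih =>
    exact ih.arr 1 hf.gaugeBounded.size (Comp.den hf).gaugeBounded fun I M e hI => hI.den _
  | add hf hg ihf ihg =>
    exact .bin (· + ·) .add (fun _ _ _ => ⟨rfl, rfl⟩) ihf ihg hf.gaugeBounded.size
      hg.gaugeBounded.size (Comp.add hf hg).gaugeBounded.size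
  | mul hf hg ihf ihg =>
    exact .bin (· * ·) .mul (fun _ _ _ => ⟨rfl, rfl⟩) ihf ihg hf.gaugeBounded.size
      hg.gaugeBounded.size (Comp.mul hf hg).gaugeBounded.size
  | sub hf hg ihf ihg =>
    exact .bin (· - ·) .sub (fun _ _ _ => ⟨rfl, rfl⟩) ihf ihg hf.gaugeBounded.size
      hg.gaugeBounded.size (Comp.sub hf hg).gaugeBounded.size
  | div hf hg ihf ihg =>
    exact .bin (· / ·) .div (fun _ _ _ => ⟨rfl, rfl⟩) ihf ihg hf.gaugeBounded.size
      hg.gaugeBounded.size (Comp.div hf hg).gaugeBounded.size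
  | size hf ih => exact ih.size hf.gaugeBounded
  | big _ ih => exact ih
  | @fold ty f g o c ho hg hf ihg ihf =>
    obtain ⟨F, hF⟩ := hf.gaugeBounded.size
    obtain ⟨G, hG⟩ := hg.gaugeBounded
    refine Computes.loop (fun I e i acc => o.fn acc (f I (i :: e))) (fun I e i _ => f I (i :: e))
      o.fn o.expr ?_ (fun _ _ _ _ => rfl) ihg
      (.of_expr (Comp.const (ty := false) c).gaugeBounded fun rs =>
        ⟨.const c, fun I M hI => ⟨rfl, rfl⟩⟩) hg.gaugeBounded ?_ ?_
    · intro M x y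
      cases o
      · exact ⟨rfl, by simp only [FoldOp.expr, FoldOp.fn, Expr.cost, Expr.val]; omega⟩
      · exact ⟨rfl, by simp only [FoldOp.expr, FoldOp.fn, Expr.cost, Expr.val]; omega⟩
      · refine ⟨rfl, ?_⟩
        have := Nat.size_le_size (Nat.sub_le (M.reg y) (M.reg x))
        simp only [FoldOp.expr, FoldOp.fn, Expr.cost, Expr.val]
        omega
    · refine ⟨C c + G * (F.comp (X + G) + 1), fun I e ℓ h m hm => ?_⟩
      have hg : g I e ≤ G.eval ℓ := hG I e ℓ h
      have h1 := size_fold_le o c (fun i => f I (i :: e)) (F.eval (ℓ + G.eval ℓ)) m fun i hi =>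
        hF I (i :: e) _ ((h.mono (Nat.le_add_right _ _)).cons (by omega))
      have h2 := nat_size_le_self c
      simp only [eval_add, eval_mul, eval_comp, eval_X, eval_one, eval_C]
      have := Nat.mul_le_mul (hm.trans hg) (le_refl (F.eval (ℓ + G.eval ℓ) + 1))
      omega
    · intro rs b hb hrs
      obtain ⟨p, P, hp⟩ := ihf ((b + 2) :: rs) (b + 3) (by omega) (by
        intro r hr
        rcases List.mem_cons.1 hr with rfl | hr
        · omega
        · exact (hrs r hr).trans (by omega))
      refine ⟨p, P.comp (X + G) + F.comp (X + G), fun I M ℓ hI hB hlt _ => ?_⟩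
      have hg : g I (rs.map M.reg) ≤ G.eval ℓ := hG I _ ℓ hB
      have hB' : I.Bounded (((b + 2) :: rs).map M.reg) (ℓ + G.eval ℓ) :=
        (hB.mono (Nat.le_add_right _ _)).cons (by omega)
      obtain ⟨t, M', h1, h2, h3, h4⟩ := hp I M _ hI hB'
      refine ⟨t, M', h1, ?_, h3, h4, ?_⟩
      · simp only [eval_add, eval_comp, eval_X]
        omega
      · have := hF I _ _ hB'
        simp only [gauge, Bool.false_eq_true, if_false] at this
        rw [h4]
        simp only [eval_add, eval_comp, eval_X]
        omega
  | @iterSub f g c hg hc hf ihg ihc ihf =>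
    obtain ⟨F, hF⟩ := hf.gaugeBounded.size
    obtain ⟨G, hG⟩ := hg.gaugeBounded
    obtain ⟨A, hA⟩ := hc.gaugeBounded
    have hacc : ∀ I e m, (Nat.rec (c I e) (fun i acc => acc - f I (i :: acc :: e)) m : ℕ) ≤ c I e :=
      fun I e m => iterSub_le (c I e) (fun i acc => f I (i :: acc :: e)) m
    refine Computes.loop (fun I e i acc => acc - f I (i :: acc :: e))
      (fun I e i acc => f I (i :: acc :: e)) (· - ·) .sub ?_ (fun _ _ _ _ => rfl) ihg ihc
      hg.gaugeBounded ?_ ?_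
    · intro M x y
      exact ⟨rfl, by simp only [Expr.cost, Expr.val]; omega⟩
    · exact ⟨A, fun I e ℓ h m hm =>
        (nat_size_le_self _).trans ((hacc I e m).trans (hA I e ℓ h))⟩
    · intro rs b hb hrs
      obtain ⟨p, P, hp⟩ := ihf ((b + 2) :: (b + 1) :: rs) (b + 3) (by omega) (by
        intro r hr
        rcases List.mem_cons.1 hr with rfl | hr
        · omega
        · rcases List.mem_cons.1 hr with rfl | hr
          · omega
          · exact (hrs r hr).trans (by omega))
      refine ⟨p, P.comp (X + G + A) + F.comp (X + G + A), fun I M ℓ hI hB hlt hav => ?_⟩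
      have hg : g I (rs.map M.reg) ≤ G.eval ℓ := hG I _ ℓ hB
      have hc : c I (rs.map M.reg) ≤ A.eval ℓ := hA I _ ℓ hB
      -- The accumulator is itself a loop variable of the body, hence must be polynomially bounded.
      -- It only decreases, so its initial value is a bound.
      have hb1 : M.reg (b + 1) ≤ c I (rs.map M.reg) := hav ▸ hacc I _ _
      have hB' : I.Bounded (((b + 2) :: (b + 1) :: rs).map M.reg) (ℓ + G.eval ℓ + A.eval ℓ) :=
        ((hB.mono (by omega)).cons (by omega)).cons (by omega)
      obtain ⟨t, M', h1, h2, h3, h4⟩ := hp I M _ hI hB'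
      refine ⟨t, M', h1, ?_, h3, h4, ?_⟩
      · simp only [eval_add, eval_comp, eval_X]
        omega
      · have := hF I _ _ hB'
        simp only [gauge, Bool.false_eq_true, if_false] at this
        rw [h4]
        simp only [eval_add, eval_comp, eval_X]
        omega

end CCS

namespace CCS

open Polynomial Finset

/-! ### Closure properties -/

theorem Comp.toFalse {ty : Bool} {f : Inst → List ℕ → ℕ} (h : Comp ty f) : Comp false f := by
  cases ty
  · exact h
  · exact h.big

theorem Comp.sum_cons {ty : Bool} {g f : Inst → List ℕ → ℕ} (hg : Comp true g) (hf : Comp ty f) :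
    Comp ty fun I e => ∑ i ∈ range (g I e), f I (i :: e) := by
  convert Comp.fold .add 0 (fun _ => by simp) hg hf using 3 with I e
  induction g I e with
  | zero => simp
  | succ m ih => rw [sum_range_succ, ih]; rfl

/-- Loop variables are kept in de Bruijn style: inside the body the head of the list is the
summation index and the tail is the outer list. -/
theorem Comp.sum {ty : Bool} {g : Inst → List ℕ → ℕ} {F : Inst → ℕ → List ℕ → ℕ}
    (hg : Comp true g) (hF : Comp ty fun I e => F I e.headI e.tail) :
    Comp ty fun I e => ∑ i ∈ range (g I e), F I i e :=
  Comp.sum_cons hg hF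

theorem Comp.prod {g : Inst → List ℕ → ℕ} {F : Inst → ℕ → List ℕ → ℕ}
    (hg : Comp true g) (hF : Comp false fun I e => F I e.headI e.tail) :
    Comp false fun I e => ∏ i ∈ range (g I e), F I i e := by
  convert Comp.fold .mul 1 (fun _ => by simp_all) hg hF using 3 with I e
  induction g I e with
  | zero => simp
  | succ m ih => rw [prod_range_succ, ih]; rfl

theorem Comp.sup {g : Inst → List ℕ → ℕ} {F : Inst → ℕ → List ℕ → ℕ}
    (hg : Comp true g) (hF : Comp false fun I e => F I e.headI e.tail) :
    Comp false fun I e => (range (g I e)).sup fun i => F I i e := by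
  convert Comp.fold .max 0 (fun _ => by simp) hg hF using 3 with I e
  induction g I e with
  | zero => simp
  | succ m ih =>
    rw [range_add_one, sup_insert, ih]
    simp only [FoldOp.fn, List.headI, List.tail]
    omega

theorem Comp.pow {f g : Inst → List ℕ → ℕ} (hf : Comp false f) (hg : Comp true g) :
    Comp false fun I e => f I e ^ g I e := by
  convert Comp.prod hg (F := fun I _ e => f I e) hf.tl using 3
  simp

/-- Only the first argument decides the type. Capping by a polynomially bounded number thus turns a
long number into a polynomially bounded one. -/
theorem Comp.min {ty : Bool} {f g : Inst → List ℕ → ℕ} (hf : Comp ty f) (hg : Comp false g) :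
    Comp ty fun I e => Min.min (f I e) (g I e) := by
  convert Comp.sub hf (Comp.sub hf.toFalse hg) using 3
  omega

theorem Comp.max {ty : Bool} {f g : Inst → List ℕ → ℕ} (hf : Comp ty f) (hg : Comp ty g) :
    Comp ty fun I e => Max.max (f I e) (g I e) := by
  convert Comp.add hf (Comp.sub hg hf.toFalse) using 3
  omega

theorem Comp.mod {ty : Bool} {f g : Inst → List ℕ → ℕ} (hf : Comp ty f) (hg : Comp false g) :
    Comp ty fun I e => f I e % g I e := by
  convert Comp.sub hf (Comp.mul (Comp.div hf.toFalse hg) hg) using 3 with I e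
  have := Nat.div_add_mod' (f I e) (g I e)
  omega

/-- Decidable properties of the machine. -/
def CompP (P : Inst → List ℕ → Prop) : Prop :=
  ∃ f : Inst → List ℕ → ℕ, Comp true f ∧ ∀ I e, (P I e ∧ f I e = 1) ∨ (¬ P I e ∧ f I e = 0)

/-- The choice is made arithmetically, as `p * f + (1 - p) * g` with the indicator `p`, so no
branching is needed. -/
theorem CompP.ite {ty : Bool} {P : Inst → List ℕ → Prop} {d : ∀ I e, Decidable (P I e)}
    {f g : Inst → List ℕ → ℕ} (hP : CompP P) (hf : Comp ty f) (hg : Comp ty g) :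
    Comp ty fun I e => @ite ℕ (P I e) (d I e) (f I e) (g I e) := by
  obtain ⟨p, hp, h⟩ := hP
  have hp' : Comp ty p := by
    cases ty
    · exact hp.big
    · exact hp
  convert (hp'.mul hf).add (Comp.mul (Comp.sub (.const 1) hp.big) hg) using 3 with I e
  rcases h I e with ⟨h1, h2⟩ | ⟨h1, h2⟩ <;> simp [h1, h2]

theorem CompP.le {f g : Inst → List ℕ → ℕ} (hf : Comp false f) (hg : Comp false g) :
    CompP fun I e => f I e ≤ g I e :=
  ⟨_, Comp.sub (.const 1) (Comp.sub hf hg), fun I e => by omega⟩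

theorem CompP.lt {f g : Inst → List ℕ → ℕ} (hf : Comp false f) (hg : Comp false g) :
    CompP fun I e => f I e < g I e :=
  CompP.le (hf.add (.const 1)) hg

theorem CompP.not {P : Inst → List ℕ → Prop} (hP : CompP P) : CompP fun I e => ¬ P I e := by
  obtain ⟨p, hp, h⟩ := hP
  refine ⟨_, Comp.sub (.const 1) hp.big, fun I e => ?_⟩
  rcases h I e with ⟨h1, h2⟩ | ⟨h1, h2⟩ <;> simp [h1, h2]

theorem CompP.and {P Q : Inst → List ℕ → Prop} (hP : CompP P) (hQ : CompP Q) :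
    CompP fun I e => P I e ∧ Q I e := by
  obtain ⟨p, hp, h⟩ := hP
  obtain ⟨q, hq, h'⟩ := hQ
  refine ⟨_, hp.mul hq, fun I e => ?_⟩
  rcases h I e with ⟨h1, h2⟩ | ⟨h1, h2⟩ <;> rcases h' I e with ⟨h3, h4⟩ | ⟨h3, h4⟩ <;>
    simp [h1, h2, h3, h4]

theorem CompP.or {P Q : Inst → List ℕ → Prop} (hP : CompP P) (hQ : CompP Q) :
    CompP fun I e => P I e ∨ Q I e := by
  convert (hP.not.and hQ.not).not using 3
  tauto

theorem CompP.eq {f g : Inst → List ℕ → ℕ} (hf : Comp false f) (hg : Comp false g) :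
    CompP fun I e => f I e = g I e := by
  convert (CompP.le hf hg).and (CompP.le hg hf) using 3
  exact le_antisymm_iff

theorem CompP.exists_lt {g : Inst → List ℕ → ℕ} {P : Inst → ℕ → List ℕ → Prop}
    (hg : Comp true g) (hP : CompP fun I e => P I e.headI e.tail) :
    CompP fun I e => ∃ i < g I e, P I i e := by
  obtain ⟨p, hp, h⟩ := hP
  have hs := Comp.sum_cons hg hp
  convert CompP.lt (.const 0) hs.big using 3 with I e
  rw [sum_pos_iff]
  refine ⟨fun ⟨i, hi, h'⟩ => ⟨i, mem_range.2 hi, ?_⟩, fun ⟨i, hi, h'⟩ => ⟨i, mem_range.1 hi, ?_⟩⟩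
  · rcases h I (i :: e) with ⟨h1, h2⟩ | ⟨h1, h2⟩
    · omega
    · exact absurd h' h1
  · rcases h I (i :: e) with ⟨h1, h2⟩ | ⟨h1, h2⟩
    · exact h1
    · omega

/-! ### Writing the output -/

/-- Register 3 counts the jobs and is the only loop variable; registers from 4 on are scratch. Array
2 is disjoint from the input arrays, so writing it does not disturb later evaluations. -/
theorem Comp.exec_output {out : Inst → ℕ → ℕ} (h : Comp true fun I e => out I e.headI) :
    ∃ (prog : Prog) (T : ℕ[X]), ∀ (I : Inst) (M : Mem) (ℓ : ℕ), I.Rep M → I.Bounded [] ℓ →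
      ∃ (t : ℕ) (M' : Mem), Exec prog M t M' ∧ t ≤ T.eval ℓ ∧
        ∀ j < I.n, M'.arr 2 j = out I j := by
  obtain ⟨p, P, hp⟩ := h.computes [3] 4 (by omega) (by simp)
  obtain ⟨Q, hQ⟩ := h.gaugeBounded.size
  refine ⟨.seq (.set 3 (.const 0)) (.loop (.sub (.reg 2) (.reg 3)) (.seq p (.seq
    (.put 2 (.reg 3) (.reg 4)) (.set 3 (.add (.reg 3) (.const 1)))))),
    2 + (X + 1) * (P + Q + 10 * X + 40), fun I M ℓ hI hB => ?_⟩
  have key : ∀ (d i : ℕ) (M : Mem), i + d = I.n → I.Rep M → M.reg 3 = i →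
      (∀ j < i, M.arr 2 j = out I j) → ∃ (t : ℕ) (M' : Mem),
      Exec (.loop (.sub (.reg 2) (.reg 3)) (.seq p (.seq
        (.put 2 (.reg 3) (.reg 4)) (.set 3 (.add (.reg 3) (.const 1)))))) M t M' ∧
      t ≤ (d + 1) * (P.eval ℓ + Q.eval ℓ + 10 * ℓ + 40) ∧
      ∀ j < I.n, M'.arr 2 j = out I j := by
    intro d
    induction d with
    | zero =>
      intro i M hi hI h3 hout
      have hz : (Expr.sub (.reg 2) (.reg 3)).val M = 0 := by
        simp [Expr.val, hI.n, h3]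
        omega
      refine ⟨_, M, .loopFalse hz, ?_, fun j hj => hout j (by omega)⟩
      have z1 := nat_size_le_self I.n
      have z2 := nat_size_le_self i
      have z3 := hB.n_le
      have z4 : I.n - i = 0 := by omega
      simp only [Expr.cost, Expr.val, hI.n, h3, z4, Nat.size_zero]
      omega
    | succ d ih =>
      intro i M hi hI h3 hout
      have hz : (Expr.sub (.reg 2) (.reg 3)).val M ≠ 0 := by
        simp [Expr.val, hI.n, h3]
        omega
      have z3 := hB.n_le
      have hB' : I.Bounded ([3].map M.reg) ℓ := hB.cons (by omega)
      obtain ⟨t, M₁, e₁, ht, a₁, v₁⟩ := hp I M ℓ hI hB'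
      have hI₁ := hI.of_agree (by omega) a₁
      have r3 : M₁.reg 3 = i := (a₁.reg 3 (by omega)).trans h3
      have v₁' : M₁.reg 4 = out I i := by simpa [h3] using v₁
      set M₂ := M₁.setArr 2 i (out I i) with hM₂
      set M₃ := M₂.setReg 3 (i + 1) with hM₃
      have e₂ := Exec.put 2 (.reg 3) (.reg 4) M₁
      rw [Expr.val, Expr.val, r3, v₁', ← hM₂] at e₂
      have r3' : M₂.reg 3 = i := r3
      have e₃ : Exec (.set 3 (.add (.reg 3) (.const 1))) M₂ _ M₃ :=
        .set_of_val (by simp only [Expr.val, r3'])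
      have harr : ∀ a ≠ 2, M₃.arr a = M₁.arr a := fun a ha => Function.update_of_ne ha _ _
      have harr2 : M₃.arr 2 = Function.update (M₁.arr 2) i (out I i) := by
        simp [hM₃, hM₂, Mem.setReg, Mem.setArr]
      have hreg : ∀ x < 3, M₃.reg x = M₁.reg x := fun x hx => setReg_ne _ _ (by omega)
      obtain ⟨u, M₄, e₄, hu, h₄⟩ := ih (i + 1) M₃ (by omega)
        ⟨(hreg 0 (by omega)).trans hI₁.N, (hreg 1 (by omega)).trans hI₁.k,
          (hreg 2 (by omega)).trans hI₁.n, fun j => by rw [harr 0 (by omega)]; exact hI₁.num j,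
          fun j => by rw [harr 1 (by omega)]; exact hI₁.den j⟩ (setReg_same _ _ _) (by
          intro j hj
          rw [harr2]
          rcases eq_or_ne j i with rfl | hji
          · simp
          · rw [Function.update_of_ne hji, a₁.arr]
            exact hout j (by omega))
      refine ⟨_, M₄, .loopTrue hz (.seq e₁ (.seq e₂ e₃)) e₄, ?_, h₄⟩
      have c1 : Nat.size 1 = 1 := by decide
      have z1 := nat_size_le_self I.n
      have z2 := nat_size_le_self i
      have z4 := nat_size_le_self (I.n - i)
      have z5 := nat_size_le_self (i + 1)
      have z6 := hQ I _ ℓ hB'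
      simp only [gauge, Bool.false_eq_true, if_false, List.map_cons, List.headI, h3] at z6
      simp only [Expr.cost, Expr.val, hI.n, h3, r3, r3', v₁', c1]
      have : (d + 1 + 1) * (P.eval ℓ + Q.eval ℓ + 10 * ℓ + 40) =
        (d + 1) * (P.eval ℓ + Q.eval ℓ + 10 * ℓ + 40) + (P.eval ℓ + Q.eval ℓ + 10 * ℓ + 40) := by
        ring
      omega
  have hreg : ∀ x < 3, (M.setReg 3 0).reg x = M.reg x := fun x hx => setReg_ne _ _ (by omega)
  obtain ⟨t, M', e, ht, h'⟩ := key I.n 0 (M.setReg 3 0) (by omega)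
    (hI.of_agree le_rfl (Agree.setReg 3 M 0 le_rfl)) (setReg_same _ _ _) (by simp)
  refine ⟨_, M', .seq (.set 3 (.const 0) M) e, ?_, h'⟩
  have : (I.n + 1) * (P.eval ℓ + Q.eval ℓ + 10 * ℓ + 40) ≤
      (ℓ + 1) * (P.eval ℓ + Q.eval ℓ + 10 * ℓ + 40) :=
    Nat.mul_le_mul_right _ (by have := hB.n_le; omega)
  simp only [Expr.cost, Nat.size_zero, eval_add, eval_mul, eval_X, eval_one, eval_ofNat]
  omega

/-! ### The algorithm

All quantities are functions of the accuracy `N`, the bound `k`, the number `n` of jobs and their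
(rounded and scaled) sizes `R 0, …, R (n - 1)`. -/

open scoped Classical in
/-- Number of natural numbers below `n` with property `P`. -/
noncomputable def countBelow (P : ℕ → Prop) (n : ℕ) : ℕ := ∑ i ∈ range n, if P i then 1 else 0

open scoped Classical in
/-- Sum of `f` over the natural numbers below `n` with property `P`. -/
noncomputable def sumBelow (P : ℕ → Prop) (f : ℕ → ℕ) (n : ℕ) : ℕ :=
  ∑ i ∈ range n, if P i then f i else 0

def prefixLoad (R : ℕ → ℕ) (t : ℕ) : ℕ := ∑ i ∈ range t, R i

/-- A job is big if its size is at least the total load divided by this number. -/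
def granularity (N k : ℕ) : ℕ := if k ≤ 8192 * (N * N) then 1048576 * (N * N * N) else 64 * N

/-- The release of job `u` makes the algorithm start afresh. -/
def Renews (Δ : ℕ) (R : ℕ → ℕ) (u : ℕ) : Prop := prefixLoad R (u + 1) ≤ Δ * R u

/-- Number of jobs at the last fresh start. -/
noncomputable def epoch (Δ : ℕ) (R : ℕ → ℕ) (n : ℕ) : ℕ :=
  countBelow (fun t => ∃ u < n, t ≤ u ∧ Renews Δ R u) n

/-- The jobs that are big at the last fresh start, which comprises the first `t` jobs. -/
def IsBig (Δ : ℕ) (R : ℕ → ℕ) (t j : ℕ) : Prop := j < t ∧ prefixLoad R t ≤ Δ * R j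

/-- Rounding down loses less than one unit per job, so at most `t` units in all. With this many
units in the total load, that is at most a fraction 1/(64N) of it. -/
def resolution (N t : ℕ) : ℕ := 64 * N * (t + 1)

/-- Size of a job in units of the dynamic program. -/
def weight (N : ℕ) (R : ℕ → ℕ) (t j : ℕ) : ℕ :=
  min (resolution N t) (R j * resolution N t / prefixLoad R t)

/-- Weight and cardinality in one number. -/
def code (N : ℕ) (R : ℕ → ℕ) (t j : ℕ) : ℕ := weight N R t j * (t + 1) + 1

open scoped Classical in
/-- Generating function of the codes of sets of big jobs below `m`, at the base `2 ^ (t + 1)`. -/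
noncomputable def genFun (N Δ : ℕ) (R : ℕ → ℕ) (t m : ℕ) : ℕ :=
  ∏ j ∈ range m, if IsBig Δ R t j then 1 + (2 ^ (t + 1)) ^ code N R t j else 1

/-- Some set of big jobs below `m` has code `v`. -/
def Reach (N Δ : ℕ) (R : ℕ → ℕ) (t m v : ℕ) : Prop :=
  0 < genFun N Δ R t m / (2 ^ (t + 1)) ^ v % 2 ^ (t + 1)

/-- `v` is the code of the heavier side of a feasible partition of the big jobs. -/
def GoodCode (N k Δ : ℕ) (R : ℕ → ℕ) (t v : ℕ) : Prop :=
  Reach N Δ R t t v ∧ v % (t + 1) ≤ k ∧ countBelow (IsBig Δ R t) t ≤ k + v % (t + 1) ∧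
    sumBelow (IsBig Δ R t) (weight N R t) t ≤ 2 * (v / (t + 1))

def codeBound (N t : ℕ) : ℕ := (t * resolution N t + 1) * (t + 1)

/-- The least good code. -/
noncomputable def bestCode (N k Δ : ℕ) (R : ℕ → ℕ) (t : ℕ) : ℕ :=
  countBelow (fun v => ¬ ∃ w < codeBound N t, w ≤ v ∧ GoodCode N k Δ R t w) (codeBound N t)

open scoped Classical in
/-- What remains of the best code after the decisions for the last `i` jobs. -/
noncomputable def residual (N k Δ : ℕ) (R : ℕ → ℕ) (t i : ℕ) : ℕ :=
  Nat.rec (bestCode N k Δ R t) (fun i acc => acc -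
    if Reach N Δ R t (t - 1 - i) acc then 0 else code N R t (t - 1 - i)) i

/-- The big jobs on the first machine. -/
def IsHeavy (N k Δ : ℕ) (R : ℕ → ℕ) (t j : ℕ) : Prop :=
  IsBig Δ R t j ∧ ¬ Reach N Δ R t j (residual N k Δ R t (t - 1 - j))

/-- Number of jobs below `n` in the class `J` of size at least `v`. -/
noncomputable def countGe (J : ℕ → Prop) (R : ℕ → ℕ) (n v : ℕ) : ℕ :=
  countBelow (fun j => J j ∧ v ≤ R j) n

open scoped Classical in
/-- The `i`-th largest size in the class `J`, and zero if there is none. -/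
noncomputable def orderStat (J : ℕ → Prop) (R : ℕ → ℕ) (n i : ℕ) : ℕ :=
  (range n).sup fun j => if J j ∧ i < countGe J R n (R j) then R j else 0

/-- Amount by which the ranks `i` and `2 * κ - 1 - i` help to balance the machines (times `Λ`),
slightly overestimated. -/
def gain (Λ κ n : ℕ) (s : ℕ → ℕ) (i : ℕ) : ℕ :=
  min (Λ * s i) ((Λ + 1) * (s i - s (min n (2 * κ - 1 - i))))

/-- Number of top ranks that go to the second machine to make up for the lead `D` of the first. -/
noncomputable def cutoff (Λ κ n D : ℕ) (s : ℕ → ℕ) : ℕ :=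
  countBelow (fun t => t < κ ∧ ∑ i ∈ range t, gain Λ κ n s i < Λ * D) n

/-- The ranks on the second machine. -/
def RankRight (κ T a b i : ℕ) : Prop :=
  i < T ∨ (T ≤ i ∧ i + T < 2 * κ ∧ i % 2 = 0) ∨ (2 * κ ≤ i ∧ b < a)

/-- Number of small jobs of size `v` on the second machine. -/
noncomputable def quota (κ T a b n : ℕ) (s : ℕ → ℕ) (v : ℕ) : ℕ :=
  countBelow (fun i => s i = v ∧ RankRight κ T a b i) n

noncomputable def heavyLoad (N k Δ : ℕ) (R : ℕ → ℕ) (t : ℕ) : ℕ :=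
  sumBelow (IsHeavy N k Δ R t) R t

noncomputable def lightLoad (N k Δ : ℕ) (R : ℕ → ℕ) (t : ℕ) : ℕ :=
  sumBelow (fun j => IsBig Δ R t j ∧ ¬ IsHeavy N k Δ R t j) R t

noncomputable def heavyCount (N k Δ : ℕ) (R : ℕ → ℕ) (t : ℕ) : ℕ :=
  countBelow (IsHeavy N k Δ R t) t

noncomputable def lightCount (N k Δ : ℕ) (R : ℕ → ℕ) (t : ℕ) : ℕ :=
  countBelow (fun j => IsBig Δ R t j ∧ ¬ IsHeavy N k Δ R t j) t

noncomputable def capacity (N k Δ : ℕ) (R : ℕ → ℕ) (t : ℕ) : ℕ :=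
  k - max (heavyCount N k Δ R t) (lightCount N k Δ R t)

/-- Sorted sizes of the small jobs. -/
noncomputable def smallStat (Δ : ℕ) (R : ℕ → ℕ) (t n i : ℕ) : ℕ :=
  orderStat (fun j => ¬ IsBig Δ R t j) R n i

/-- Number of top ranks on the second machine. -/
noncomputable def lead (N k Δ : ℕ) (R : ℕ → ℕ) (t n : ℕ) : ℕ :=
  cutoff (64 * N) (capacity N k Δ R t) n (heavyLoad N k Δ R t - lightLoad N k Δ R t)
    (smallStat Δ R t n)

/-- Small job `j` goes to the second machine. -/
def SmallRight (N k Δ : ℕ) (R : ℕ → ℕ) (t n j : ℕ) : Prop :=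
  countBelow (fun i => ¬ IsBig Δ R t i ∧ R i = R j) j <
    quota (capacity N k Δ R t) (lead N k Δ R t n) (heavyCount N k Δ R t) (lightCount N k Δ R t) n
      (smallStat Δ R t n) (R j)

/-- Job `j` goes to the second machine, given the time of the last fresh start. -/
def RightAt (N k Δ : ℕ) (R : ℕ → ℕ) (t n j : ℕ) : Prop :=
  (IsBig Δ R t j ∧ ¬ IsHeavy N k Δ R t j) ∨ (¬ IsBig Δ R t j ∧ SmallRight N k Δ R t n j)

/-- Job `j` goes to the second machine. -/
def Right (N k : ℕ) (R : ℕ → ℕ) (n j : ℕ) : Prop :=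
  RightAt N k (granularity N k) R (epoch (granularity N k) R n) n j

/-- Sizes rounded down to numbers with few significant digits, and scaled to integers. -/
def rounded (I : Inst) (j : ℕ) : ℕ :=
  8 * I.N * I.num j * 2 ^ Nat.size (I.den j) / (I.den j * 2 ^ Nat.size (I.num j)) *
    2 ^ Nat.size (I.num j) * 2 ^ (∑ i ∈ range I.n, Nat.size (I.den i) - Nat.size (I.den j))

open scoped Classical in
/-- Machine of job `j`. -/
noncomputable def machine (I : Inst) (j : ℕ) : ℕ :=
  if I.N ≤ 1 then (if I.k ≤ j then 1 else 0)
  else if Right I.N I.k (rounded I) I.n j then 1 else 0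

/-! ### The algorithm runs in polynomial time -/

/-- `R` can be evaluated at every polynomially bounded index. -/
abbrev CompFun (R : Inst → ℕ → ℕ) : Prop :=
  ∀ {a : Inst → List ℕ → ℕ}, Comp true a → Comp false fun I e => R I (a I e)

/-- A polynomially bounded number that depends on the instance only. -/
abbrev CompNum (t : Inst → ℕ) : Prop := Comp true fun I _ => t I

section

theorem Comp.countBelow {P : Inst → ℕ → List ℕ → Prop} {g : Inst → List ℕ → ℕ} (hg : Comp true g)
    (hP : CompP fun I e => P I e.headI e.tail) :
    Comp true fun I e => countBelow (fun i => P I i e) (g I e) := by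
  unfold CCS.countBelow
  exact .sum hg (hP.ite (.const 1) (.const 0))

theorem Comp.sumBelow {ty : Bool} {P : Inst → ℕ → List ℕ → Prop} {f : Inst → ℕ → List ℕ → ℕ}
    {g : Inst → List ℕ → ℕ} (hg : Comp true g) (hP : CompP fun I e => P I e.headI e.tail)
    (hf : Comp ty fun I e => f I e.headI e.tail) :
    Comp ty fun I e => sumBelow (fun i => P I i e) (fun i => f I i e) (g I e) := by
  unfold CCS.sumBelow
  exact .sum hg (hP.ite hf (.const 0))

variable {R : Inst → ℕ → ℕ} {Δ t : Inst → ℕ} {a b : Inst → List ℕ → ℕ}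

theorem comp_prefixLoad (hR : CompFun R) (ha : Comp true a) :
    Comp false fun I e => prefixLoad (R I) (a I e) := by
  unfold prefixLoad
  exact .sum ha (hR .hd)

theorem comp_granularity : Comp true fun I _ => granularity I.N I.k := by
  unfold granularity
  exact CompP.ite (.le .k (.big (.mul (.const _) (.mul .N .N))))
    (.mul (.const _) (.mul (.mul .N .N) .N)) (.mul (.const _) .N)

theorem comp_renews (hR : CompFun R) (hΔ : CompNum Δ) (ha : Comp true a) :
    CompP fun I e => Renews (Δ I) (R I) (a I e) := by
  unfold Renews
  exact .le (comp_prefixLoad hR (.add ha (.const 1))) (.mul hΔ.big (hR ha))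

theorem comp_epoch (hR : CompFun R) (hΔ : CompNum Δ) :
    Comp true fun I _ => epoch (Δ I) (R I) I.n := by
  unfold epoch
  exact .countBelow .n (.exists_lt .n (.and (.le (Comp.tl .hd).big (Comp.hd).big)
    (comp_renews hR hΔ .hd)))

theorem comp_isBig (hR : CompFun R) (hΔ : CompNum Δ) (ht : CompNum t) (ha : Comp true a) :
    CompP fun I e => IsBig (Δ I) (R I) (t I) (a I e) := by
  unfold IsBig
  exact .and (.lt ha.big ht.big) (.le (comp_prefixLoad hR ht) (.mul hΔ.big (hR ha)))

theorem comp_resolution (ht : CompNum t) : Comp true fun I _ => resolution I.N (t I) := by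
  unfold resolution
  exact .mul (.mul (.const _) .N) (.add ht (.const _))

/-- The minimum in `weight` is never active for `j < t`; it is there to make the polynomial bound on
the value syntactically evident. -/
theorem comp_weight (hR : CompFun R) (ht : CompNum t) (ha : Comp true a) :
    Comp true fun I e => weight I.N (R I) (t I) (a I e) := by
  unfold weight
  exact .min (comp_resolution ht)
    (.div (.mul (hR ha) (comp_resolution ht).big) (comp_prefixLoad hR ht))

theorem comp_code (hR : CompFun R) (ht : CompNum t) (ha : Comp true a) :
    Comp true fun I e => code I.N (R I) (t I) (a I e) := by
  unfold code
  exact .add (.mul (comp_weight hR ht ha) (.add ht (.const _))) (.const _)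

/-- Codes are polynomially bounded, so the generating function, although a huge number, has only
polynomially many bits. -/
theorem comp_reach (hR : CompFun R) (hΔ : CompNum Δ) (ht : CompNum t) (ha : Comp true a)
    (hb : Comp true b) :
    CompP fun I e => Reach I.N (Δ I) (R I) (t I) (a I e) (b I e) := by
  have hB : Comp false fun I _ => 2 ^ (t I + 1) := .pow (.const _) (.add ht (.const _))
  unfold Reach genFun
  exact .lt (.const 0) (.mod (.div (.prod ha (CompP.ite (comp_isBig hR hΔ ht .hd)
    (.add (.const _) (.pow hB (comp_code hR ht .hd))) (.const _))) (.pow hB hb)) hB)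

theorem comp_goodCode (hR : CompFun R) (hΔ : CompNum Δ) (ht : CompNum t) (ha : Comp true a) :
    CompP fun I e => GoodCode I.N I.k (Δ I) (R I) (t I) (a I e) := by
  have ht' : Comp false fun I _ => t I + 1 := .big (.add ht (.const _))
  have hm : Comp false fun I e => a I e % (t I + 1) := .mod ha.big ht'
  unfold GoodCode
  exact .and (comp_reach hR hΔ ht ht ha) (.and (.le hm .k) (.and
    (.le (Comp.countBelow ht (comp_isBig hR hΔ ht .hd)).big (.add .k hm))
    (.le (Comp.sumBelow ht (comp_isBig hR hΔ ht .hd) (comp_weight hR ht .hd)).big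
      (.mul (.const _) (.div ha.big ht')))))

theorem comp_codeBound (ht : CompNum t) : Comp true fun I _ => codeBound I.N (t I) := by
  unfold codeBound
  exact .mul (.add (.mul ht (comp_resolution ht)) (.const _)) (.add ht (.const _))

theorem comp_bestCode (hR : CompFun R) (hΔ : CompNum Δ) (ht : CompNum t) :
    Comp true fun I _ => bestCode I.N I.k (Δ I) (R I) (t I) := by
  unfold bestCode
  exact .countBelow (comp_codeBound ht) (.not (.exists_lt (comp_codeBound ht)
    (.and (.le Comp.hd.big (Comp.tl .hd).big) (comp_goodCode hR hΔ ht .hd))))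

theorem comp_residual (hR : CompFun R) (hΔ : CompNum Δ) (ht : CompNum t) (ha : Comp true a) :
    Comp true fun I e => residual I.N I.k (Δ I) (R I) (t I) (a I e) := by
  have hi : Comp true fun I e => t I - 1 - e.headI := .sub (.sub ht (.const _)) Comp.hd.big
  unfold residual
  exact .iterSub ha (comp_bestCode hR hΔ ht)
    (CompP.ite (d := fun _ _ => Classical.propDecidable _)
      (comp_reach hR hΔ ht hi (.tl .hd)) (.const 0) (comp_code hR ht hi))

theorem comp_isHeavy (hR : CompFun R) (hΔ : CompNum Δ) (ht : CompNum t) (ha : Comp true a) :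
    CompP fun I e => IsHeavy I.N I.k (Δ I) (R I) (t I) (a I e) := by
  unfold IsHeavy
  exact .and (comp_isBig hR hΔ ht ha) (.not (comp_reach hR hΔ ht ha
    (comp_residual hR hΔ ht (.sub (.sub ht (.const _)) ha.big))))

theorem comp_smallStat (hR : CompFun R) (hΔ : CompNum Δ) (ht : CompNum t) (ha : Comp false a) :
    Comp false fun I e => smallStat (Δ I) (R I) (t I) I.n (a I e) := by
  unfold smallStat orderStat countGe
  exact .sup .n (CompP.ite (.and (.not (comp_isBig hR hΔ ht .hd)) (.lt ha.tl
    (Comp.countBelow .n (.and (.not (comp_isBig hR hΔ ht .hd))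
      (.le (hR (.tl .hd)) (hR .hd)))).big)) (hR .hd) (.const 0))

theorem comp_loads (hR : CompFun R) (hΔ : CompNum Δ) (ht : CompNum t) :
    (Comp true fun I _ => heavyCount I.N I.k (Δ I) (R I) (t I)) ∧
    (Comp true fun I _ => lightCount I.N I.k (Δ I) (R I) (t I)) ∧
    (Comp false fun I _ => heavyLoad I.N I.k (Δ I) (R I) (t I)) ∧
    (Comp false fun I _ => lightLoad I.N I.k (Δ I) (R I) (t I)) := by
  unfold heavyCount lightCount heavyLoad lightLoad
  have h1 := comp_isHeavy hR hΔ ht .hd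
  have h2 := (comp_isBig hR hΔ ht .hd).and h1.not
  exact ⟨.countBelow ht h1, .countBelow ht h2, .sumBelow ht h1 (hR .hd), .sumBelow ht h2 (hR .hd)⟩

theorem comp_capacity (hR : CompFun R) (hΔ : CompNum Δ) (ht : CompNum t) :
    Comp false fun I _ => capacity I.N I.k (Δ I) (R I) (t I) := by
  unfold capacity
  exact .sub .k (.big (.max (comp_loads hR hΔ ht).1 (comp_loads hR hΔ ht).2.1))

theorem comp_lead (hR : CompFun R) (hΔ : CompNum Δ) (ht : CompNum t) :
    Comp true fun I _ => lead I.N I.k (Δ I) (R I) (t I) I.n := by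
  have hN : Comp false fun I _ => 64 * I.N := .mul (.const _) (.big .N)
  have hκ := comp_capacity hR hΔ ht
  unfold lead cutoff gain
  exact .countBelow .n (.and (.lt Comp.hd.big hκ) (.lt (.sum .hd
    (.min (.mul hN (comp_smallStat hR hΔ ht Comp.hd.big))
      (.mul (.add hN (.const _)) (.sub (comp_smallStat hR hΔ ht Comp.hd.big)
        (comp_smallStat hR hΔ ht (.min (.big .n)
          (.sub (.sub (.mul (.const _) hκ) (.const _)) Comp.hd.big)))))))
    (.mul hN (.sub (comp_loads hR hΔ ht).2.2.1 (comp_loads hR hΔ ht).2.2.2))))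

theorem comp_rightAt (hR : CompFun R) (hΔ : CompNum Δ) (ht : CompNum t) (ha : Comp true a) :
    CompP fun I e => RightAt I.N I.k (Δ I) (R I) (t I) I.n (a I e) := by
  have hκ := comp_capacity hR hΔ ht
  have hT := comp_lead hR hΔ ht
  have hb := comp_isBig hR hΔ ht ha
  have h2 : Comp false fun I _ => 2 * capacity I.N I.k (Δ I) (R I) (t I) := .mul (.const _) hκ
  unfold RightAt SmallRight quota RankRight
  exact .or (.and hb (.not (comp_isHeavy hR hΔ ht ha))) (.and (.not hb) (.lt
    (Comp.countBelow ha (.and (.not (comp_isBig hR hΔ ht .hd)) (.eq (hR .hd) (hR ha.tl)))).big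
    (Comp.countBelow .n (.and (.eq (comp_smallStat hR hΔ ht Comp.hd.big) (hR ha.tl))
      (.or (.lt Comp.hd.big hT.big) (.or (.and (.le hT.big Comp.hd.big)
        (.and (.lt (.add Comp.hd.big hT.big) h2) (.eq (.mod Comp.hd.big (.const _)) (.const _))))
        (.and (.le h2 Comp.hd.big)
          (.lt (comp_loads hR hΔ ht).2.1.big (comp_loads hR hΔ ht).1.big)))))).big))

theorem comp_rounded (ha : Comp true a) : Comp false fun I e => rounded I (a I e) := by
  have h1 : Comp false fun I e => 2 ^ Nat.size (I.den (a I e)) :=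
    .pow (.const _) (.size (.den ha))
  have h2 : Comp false fun I e => 2 ^ Nat.size (I.num (a I e)) :=
    .pow (.const _) (.size (.num ha))
  unfold rounded
  exact .mul (.mul (.div (.mul (.mul (.mul (.const _) (.big .N)) (.num ha)) h1)
    (.mul (.den ha) h2)) h2) (.pow (.const _) (.sub (.sum .n (.size (.den .hd)))
      (.big (.size (.den ha)))))

theorem comp_machine : Comp true fun I e => machine I e.headI := by
  unfold machine Right
  exact CompP.ite (.le (.big .N) (.const _)) (CompP.ite (.le .k (.big .hd)) (.const _) (.const _))
    (CompP.ite (comp_rightAt comp_rounded comp_granularity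
      (comp_epoch comp_rounded comp_granularity) .hd) (.const _) (.const _))

end

/-! ### Counting and order statistics -/

theorem countBelow_eq_card (P : ℕ → Prop) [DecidablePred P] (n : ℕ) :
    countBelow P n = #{i ∈ range n | P i} := by
  rw [countBelow, card_filter]
  congr! 2

theorem sumBelow_eq_sum (P : ℕ → Prop) [DecidablePred P] (f : ℕ → ℕ) (n : ℕ) :
    sumBelow P f n = ∑ i ∈ range n with P i, f i := by
  rw [sumBelow, sum_filter]
  congr! 2

theorem countBelow_le (P : ℕ → Prop) (n : ℕ) : countBelow P n ≤ n := by
  classical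
  rw [countBelow_eq_card]
  exact (card_filter_le _ _).trans (card_range n).le

theorem countBelow_succ (P : ℕ → Prop) [DecidablePred P] (n : ℕ) :
    countBelow P (n + 1) = countBelow P n + if P n then 1 else 0 := by
  rw [countBelow, sum_range_succ, ← countBelow]
  congr

theorem countBelow_congr {P Q : ℕ → Prop} {n : ℕ} (h : ∀ i < n, (P i ↔ Q i)) :
    countBelow P n = countBelow Q n := by
  classical
  rw [countBelow_eq_card, countBelow_eq_card]
  congr 1
  exact filter_congr fun i hi => h i (mem_range.1 hi)

theorem sumBelow_congr {P Q : ℕ → Prop} {f g : ℕ → ℕ} {n : ℕ} (h : ∀ i < n, (P i ↔ Q i))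
    (hf : ∀ i < n, f i = g i) : sumBelow P f n = sumBelow Q g n := by
  classical
  rw [sumBelow_eq_sum, sumBelow_eq_sum]
  refine sum_congr (filter_congr fun i hi => h i (mem_range.1 hi)) fun i hi => ?_
  exact hf i (mem_range.1 (mem_filter.1 hi).1)

/-- For a downward closed property the count is the first index at which it fails, so counting acts
as bounded search. `epoch`, `bestCode` and `cutoff` are of this form. -/
theorem lt_countBelow_iff {P : ℕ → Prop} (hP : ∀ i j, i ≤ j → P j → P i) {n i : ℕ} :
    i < countBelow P n ↔ i < n ∧ P i := by
  classical
  induction n generalizing i with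
  | zero => simp [countBelow]
  | succ n ih =>
    rw [countBelow_succ]
    have hle := countBelow_le P n
    split_ifs with h
    · have hn : countBelow P n = n := by
        by_contra hne
        have : ¬ countBelow P n < countBelow P n := lt_irrefl _
        rw [ih] at this
        exact this ⟨by omega, hP _ n hle h⟩
      rw [hn]
      exact ⟨fun hi => ⟨hi, hP i n (by omega) h⟩, fun hi => hi.1⟩
    · rw [add_zero, ih]
      refine ⟨fun ⟨h1, h2⟩ => ⟨by omega, h2⟩, fun ⟨h1, h2⟩ => ⟨?_, h2⟩⟩
      rcases (Nat.lt_succ_iff_lt_or_eq.1 h1) with h3 | rfl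
      · exact h3
      · exact absurd h2 h

section OrderStat

variable {J : ℕ → Prop} {R : ℕ → ℕ} {n : ℕ}

theorem countGe_anti {v w : ℕ} (h : v ≤ w) : countGe J R n w ≤ countGe J R n v := by
  classical
  rw [countGe, countGe, countBelow_eq_card, countBelow_eq_card]
  exact card_le_card (monotone_filter_right _ fun i _ hi => ⟨hi.1, h.trans hi.2⟩)

/-- This Galois connection between sizes and ranks characterizes the order statistics; everything
else about them is derived from it by counting. -/
theorem le_orderStat_iff {v i : ℕ} (hv : 0 < v) :
    v ≤ orderStat J R n i ↔ i < countGe J R n v := by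
  classical
  rw [orderStat, Finset.le_sup_iff (by simpa using hv)]
  constructor
  · rintro ⟨j, -, hj⟩
    split_ifs at hj with h
    · exact h.2.trans_le (countGe_anti hj)
    · omega
  · intro h
    have hpos : 0 < countGe J R n v := by omega
    rw [countGe, countBelow_eq_card, card_pos] at hpos
    obtain ⟨j, hj, hmin⟩ := exists_min_image _ R hpos
    simp only [mem_filter, mem_range] at hj hmin
    refine ⟨j, mem_range.2 hj.1, ?_⟩
    have : countGe J R n v ≤ countGe J R n (R j) := by
      rw [countGe, countGe, countBelow_eq_card, countBelow_eq_card]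
      refine card_le_card fun i hi => ?_
      simp only [mem_filter, mem_range] at hi ⊢
      exact ⟨hi.1, hi.2.1, hmin i hi⟩
    rw [if_pos ⟨hj.2.1, h.trans_le this⟩]
    exact hj.2.2

theorem orderStat_anti : Antitone (orderStat J R n) := by
  intro i j hij
  rcases Nat.eq_zero_or_pos (orderStat J R n j) with h | h
  · omega
  · rw [le_orderStat_iff h]
    exact hij.trans_lt ((le_orderStat_iff h).1 le_rfl)

theorem orderStat_eq_zero {i : ℕ} (h : n ≤ i) : orderStat J R n i = 0 := by
  by_contra hne
  have := (le_orderStat_iff (Nat.pos_of_ne_zero hne)).1 (le_refl (orderStat J R n i))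
  have := countBelow_le (fun j => J j ∧ orderStat J R n i ≤ R j) n
  rw [countGe] at *
  omega

theorem orderStat_le {i B : ℕ} (h : ∀ j < n, J j → R j ≤ B) : orderStat J R n i ≤ B := by
  classical
  refine Finset.sup_le fun j hj => ?_
  split_ifs with h'
  · exact h j (mem_range.1 hj) h'.1
  · exact Nat.zero_le _

theorem countGe_succ [DecidablePred J] (v : ℕ) : countGe J R (n + 1) v =
    countGe J R n v + if J n ∧ v ≤ R n then 1 else 0 := countBelow_succ _ _

theorem orderStat_insert_zero (hn : J n) :
    orderStat J R (n + 1) 0 = max (orderStat J R n 0) (R n) := by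
  classical
  refine eq_of_forall_le_iff fun v => ?_
  rcases Nat.eq_zero_or_pos v with rfl | hv
  · simp
  rw [le_orderStat_iff hv, countGe_succ, le_max_iff, le_orderStat_iff hv]
  simp only [hn, true_and]
  split_ifs with h <;> simp [h]

/-- Inserting a value into a sorted list pushes every smaller entry down by one rank. -/
theorem orderStat_insert_succ (hn : J n) (i : ℕ) : orderStat J R (n + 1) (i + 1) =
    max (orderStat J R n (i + 1)) (min (R n) (orderStat J R n i)) := by
  classical
  refine eq_of_forall_le_iff fun v => ?_
  rcases Nat.eq_zero_or_pos v with rfl | hv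
  · simp
  rw [le_orderStat_iff hv, countGe_succ, le_max_iff, le_min_iff, le_orderStat_iff hv,
    le_orderStat_iff hv]
  simp only [hn, true_and]
  split_ifs with h
  · simp only [h, true_and]
    omega
  · simp [h]

open scoped Classical in
theorem card_orderStat_ge {v : ℕ} (hv : 0 < v) :
    #{i ∈ range n | v ≤ orderStat J R n i} = #{j ∈ range n | J j ∧ v ≤ R j} := by
  have h : {i ∈ range n | v ≤ orderStat J R n i} = range (countGe J R n v) := by
    ext i
    simp only [mem_filter, mem_range, le_orderStat_iff hv]
    have := countBelow_le (fun j => J j ∧ v ≤ R j) n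
    rw [countGe]
    omega
  rw [h, card_range, countGe, countBelow_eq_card]

open scoped Classical in
theorem card_orderStat_eq {v : ℕ} (hv : 0 < v) :
    #{i ∈ range n | orderStat J R n i = v} = #{j ∈ range n | J j ∧ R j = v} := by
  have h1 := card_orderStat_ge (J := J) (R := R) (n := n) hv
  have h2 := card_orderStat_ge (J := J) (R := R) (n := n) (v := v + 1) (by omega)
  have e1 : #{i ∈ range n | v ≤ orderStat J R n i} = #{i ∈ range n | orderStat J R n i = v} +
      #{i ∈ range n | v + 1 ≤ orderStat J R n i} := by
    rw [← card_union_of_disjoint]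
    · congr 1
      ext i
      simp only [mem_filter, mem_union]
      have : v ≤ orderStat J R n i ↔ orderStat J R n i = v ∨ v + 1 ≤ orderStat J R n i := by omega
      tauto
    · rw [disjoint_filter]
      intro i _ h h'
      omega
  have e2 : #{j ∈ range n | J j ∧ v ≤ R j} = #{j ∈ range n | J j ∧ R j = v} +
      #{j ∈ range n | J j ∧ v + 1 ≤ R j} := by
    rw [← card_union_of_disjoint]
    · congr 1
      ext i
      simp only [mem_filter, mem_union]
      have : v ≤ R i ↔ R i = v ∨ v + 1 ≤ R i := by omega
      tauto
    · rw [disjoint_filter]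
      intro i _ h h'
      omega
  omega

/-- Layer cake formula: each term is counted once at every level `v` from 1 up to its value. -/
theorem sum_eq_sum_card_ge {ι : Type*} (s : Finset ι) (f : ι → ℕ) {B : ℕ} (h : ∀ i ∈ s, f i ≤ B) :
    ∑ i ∈ s, f i = ∑ v ∈ Icc 1 B, #{i ∈ s | v ≤ f i} := by
  simp only [card_filter]
  rw [sum_comm]
  refine sum_congr rfl fun i hi => ?_
  rw [← card_filter]
  have : {v ∈ Icc 1 B | v ≤ f i} = Icc 1 (f i) := by
    ext v
    have := h i hi
    simp only [mem_filter, mem_Icc]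
    omega
  rw [this, Nat.card_Icc]
  omega

/-- The first `m` order statistics dominate the total size of any `m` jobs. -/
theorem sum_le_sum_orderStat {s : Finset ℕ} {m : ℕ} (hs : ∀ j ∈ s, j < n ∧ J j)
    (hm : #s ≤ m) : ∑ j ∈ s, R j ≤ ∑ i ∈ range m, orderStat J R n i := by
  classical
  set B := (range n).sup R with hB
  have hRB : ∀ j < n, R j ≤ B := fun j hj => le_sup (f := R) (mem_range.2 hj)
  rw [sum_eq_sum_card_ge s R (B := B) fun j hj => hRB j (hs j hj).1,
    sum_eq_sum_card_ge (range m) (orderStat J R n) (B := B)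
      fun i _ => orderStat_le fun j hj _ => hRB j hj]
  refine sum_le_sum fun v hv => ?_
  have hv0 : 0 < v := by rw [mem_Icc] at hv; omega
  have h : {i ∈ range m | v ≤ orderStat J R n i} = range (min m (countGe J R n v)) := by
    ext i
    simp only [mem_filter, mem_range, le_orderStat_iff hv0, lt_min_iff]
  rw [h, card_range, le_min_iff]
  refine ⟨(card_filter_le _ _).trans hm, ?_⟩
  rw [countGe, countBelow_eq_card]
  refine card_le_card fun j hj => ?_
  simp only [mem_filter, mem_range] at hj ⊢
  exact ⟨(hs j hj.1).1, (hs j hj.1).2, hj.2⟩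

theorem sum_orderStat : ∑ i ∈ range n, orderStat J R n i = sumBelow J R n := by
  classical
  rw [sumBelow_eq_sum]
  set B := (range n).sup R with hB
  have hRB : ∀ j < n, R j ≤ B := fun j hj => le_sup (f := R) (mem_range.2 hj)
  rw [sum_eq_sum_card_ge (range n) (orderStat J R n) (B := B)
      fun i _ => orderStat_le fun j hj _ => hRB j hj,
    sum_eq_sum_card_ge {j ∈ range n | J j} R (B := B) fun j hj => hRB j
      (mem_range.1 (mem_filter.1 hj).1)]
  refine sum_congr rfl fun v hv => ?_
  rw [card_orderStat_ge (by rw [mem_Icc] at hv; omega), filter_filter]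

/-! ### Distributing a quota within each class of equal sizes -/

/-- The position within `s` is a bijection from `s` onto the numbers below `#s`; the induction
removes the maximum. -/
theorem card_filter_rank_lt (s : Finset ℕ) (y : ℕ) :
    #{j ∈ s | #{i ∈ s | i < j} < y} = min y #s := by
  induction s using Finset.induction_on_max with
  | empty => simp
  | insert a s ha ih =>
    have hna : a ∉ s := fun h => lt_irrefl _ (ha a h)
    have h1 : ∀ j ∈ s, {i ∈ insert a s | i < j} = {i ∈ s | i < j} := by
      intro j hj
      rw [filter_insert, if_neg (by have := ha j hj; omega)]
    have h2 : {i ∈ insert a s | i < a} = s := by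
      rw [filter_insert, if_neg (lt_irrefl _)]
      exact filter_true_of_mem ha
    rw [filter_insert, h2, card_insert_of_notMem hna,
      filter_congr (q := fun j => #{i ∈ s | i < j} < y) fun j hj => by rw [h1 j hj]]
    split_ifs with h
    · rw [card_insert_of_notMem (by simp [hna]), ih]
      omega
    · rw [ih]
      omega

/-- Among the jobs of class `J` with equal size, those that come first. -/
def Chosen (J : ℕ → Prop) (R : ℕ → ℕ) (y : ℕ → ℕ) (j : ℕ) : Prop :=
  countBelow (fun i => J i ∧ R i = R j) j < y (R j)

open scoped Classical in
theorem card_chosen (y : ℕ → ℕ) (v : ℕ) :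
    #{j ∈ range n | (J j ∧ R j = v) ∧ Chosen J R y j} =
      min (y v) #{j ∈ range n | J j ∧ R j = v} := by
  rw [← card_filter_rank_lt {j ∈ range n | J j ∧ R j = v}, ← filter_filter]
  congr 1
  refine filter_congr fun j hj => ?_
  simp only [mem_filter, mem_range] at hj
  rw [Chosen, countBelow_eq_card, hj.2.2]
  have : {i ∈ range j | J i ∧ R i = v} = {i ∈ {j ∈ range n | J j ∧ R j = v} | i < j} := by
    ext i
    simp only [mem_filter, mem_range]
    constructor
    · rintro ⟨h1, h2⟩
      exact ⟨⟨by omega, h2⟩, h1⟩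
    · rintro ⟨⟨-, h2⟩, h1⟩
      exact ⟨h1, h2⟩
  rw [this]

/-- If the quotas come from a set `m` of ranks, then the chosen jobs and the ranks in `m` have the
same distribution of sizes. -/
theorem sum_chosen (m : ℕ → Prop) (g : ℕ → ℕ) (hg : g 0 = 0) :
    sumBelow (fun j => J j ∧
      Chosen J R (fun v => countBelow (fun i => orderStat J R n i = v ∧ m i) n) j)
      (fun j => g (R j)) n = sumBelow m (fun i => g (orderStat J R n i)) n := by
  classical
  set B := (range n).sup R with hB
  have hRB : ∀ j < n, R j ≤ B := fun j hj => le_sup (f := R) (mem_range.2 hj)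
  set y : ℕ → ℕ := fun v => countBelow (fun i => orderStat J R n i = v ∧ m i) n with hy
  rw [sumBelow_eq_sum, sumBelow_eq_sum,
    ← sum_fiberwise_of_maps_to' (t := range (B + 1)) (g := R) (f := g) (by
      intro j hj
      simp only [mem_filter, mem_range] at hj ⊢
      exact Nat.lt_succ_of_le (hRB j hj.1)),
    ← sum_fiberwise_of_maps_to' (t := range (B + 1)) (g := orderStat J R n) (f := g) (by
      intro i _
      rw [mem_range, Nat.lt_succ_iff]
      exact orderStat_le fun j hj _ => hRB j hj)]
  refine sum_congr rfl fun v _ => ?_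
  rcases Nat.eq_zero_or_pos v with rfl | hv
  · simp [hg]
  rw [sum_const, sum_const]
  congr 1
  have h1 : {j ∈ {j ∈ range n | J j ∧ Chosen J R y j} | R j = v} =
      {j ∈ range n | (J j ∧ R j = v) ∧ Chosen J R y j} := by
    rw [filter_filter]
    exact filter_congr fun j _ => by tauto
  rw [h1, card_chosen, ← card_orderStat_eq hv, hy]
  simp only
  rw [countBelow_eq_card, filter_filter,
    filter_congr (q := fun i => orderStat J R n i = v ∧ m i) fun i _ => and_comm]
  refine min_eq_left (card_le_card fun i hi => ?_)
  simp only [mem_filter] at hi ⊢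
  exact ⟨hi.1, hi.2.1⟩

/-- Total size of the jobs that are affected by a change of the quotas. -/
theorem sum_chosen_ne_le (y y' : ℕ → ℕ) {B : ℕ} (hB : ∀ j < n, R j ≤ B) :
    sumBelow (fun j => J j ∧ ¬ (Chosen J R y j ↔ Chosen J R y' j)) R n ≤
      ∑ v ∈ Icc 1 B, v * ((y v - y' v) + (y' v - y v)) := by
  classical
  have hle : ∑ v ∈ Icc 1 B, v * ((y v - y' v) + (y' v - y v)) =
      ∑ v ∈ range (B + 1), v * ((y v - y' v) + (y' v - y v)) := by
    refine sum_subset (fun v hv => ?_) fun v hv hv' => ?_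
    · rw [mem_Icc] at hv
      rw [mem_range]
      omega
    · rw [mem_range] at hv
      rw [mem_Icc] at hv'
      have : v = 0 := by omega
      simp [this]
  rw [hle, sumBelow_eq_sum,
    ← sum_fiberwise_of_maps_to' (t := range (B + 1)) (g := R) (f := fun v => v) (by
      intro j hj
      simp only [mem_filter, mem_range] at hj ⊢
      exact Nat.lt_succ_of_le (hB j hj.1))]
  refine sum_le_sum fun v _ => ?_
  rw [sum_const, smul_eq_mul, mul_comm]
  refine Nat.mul_le_mul_left _ ?_
  clear hle
  -- The jobs chosen in a class form an initial segment in release order, so the smaller quota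
  -- selects a subset of the larger selection, and the affected jobs are the difference.
  wlog hyy : y v ≤ y' v generalizing y y'
  · have := this y' y (by omega)
    rw [add_comm]
    refine le_trans (le_of_eq ?_) this
    congr 2
    exact filter_congr fun j _ => by tauto
  have hsub : {j ∈ {j ∈ range n | J j ∧ ¬ (Chosen J R y j ↔ Chosen J R y' j)} | R j = v} ⊆
      {j ∈ range n | (J j ∧ R j = v) ∧ Chosen J R y' j} \
        {j ∈ range n | (J j ∧ R j = v) ∧ Chosen J R y j} := by
    intro j hj
    simp only [mem_filter, mem_sdiff] at hj ⊢
    obtain ⟨⟨h1, h2, h3⟩, h4⟩ := hj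
    have h5 : Chosen J R y j → Chosen J R y' j := by
      intro h
      rw [Chosen, h4] at h ⊢
      omega
    tauto
  have hsub' : {j ∈ range n | (J j ∧ R j = v) ∧ Chosen J R y j} ⊆
      {j ∈ range n | (J j ∧ R j = v) ∧ Chosen J R y' j} := by
    refine monotone_filter_right _ fun j _ h => ⟨h.1, ?_⟩
    have h' := h.2
    rw [Chosen, h.1.2] at h' ⊢
    omega
  refine (card_le_card hsub).trans ?_
  rw [card_sdiff_of_subset hsub', card_chosen, card_chosen]
  omega

end OrderStat

/-! ### Correctness of the dynamic program -/

/-- With fewer summands than the base no carries occur, so the digit at position `v` counts the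
summands with exponent `v`. -/
theorem digit_sum_pow {ι : Type*} (s : Finset ι) (w : ι → ℕ) {B : ℕ} (hB : #s < B) (v : ℕ) :
    (∑ x ∈ s, B ^ w x) / B ^ v % B = #{x ∈ s | w x = v} := by
  have hB0 : 0 < B := by omega
  have hlow : ∑ x ∈ s with w x < v, B ^ w x < B ^ v := by
    rcases Nat.eq_zero_or_pos v with rfl | hv
    · simp
    · calc ∑ x ∈ s with w x < v, B ^ w x ≤ ∑ x ∈ s with w x < v, B ^ (v - 1) := by
            refine sum_le_sum fun x hx => Nat.pow_le_pow_right hB0 ?_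
            have := (mem_filter.1 hx).2
            omega
        _ ≤ #s * B ^ (v - 1) := by
            rw [sum_const, smul_eq_mul]
            exact Nat.mul_le_mul_right _ (card_filter_le _ _)
        _ < B * B ^ (v - 1) := Nat.mul_lt_mul_of_pos_right hB (by positivity)
        _ = B ^ v := by rw [← pow_succ', Nat.sub_add_cancel hv]
  have hmid : ∑ x ∈ s with w x = v, B ^ w x = #{x ∈ s | w x = v} * B ^ v := by
    rw [sum_congr rfl (g := fun _ => B ^ v) fun x hx => by rw [(mem_filter.1 hx).2], sum_const,
      smul_eq_mul]
  obtain ⟨c, hc⟩ : B ^ (v + 1) ∣ ∑ x ∈ s with v < w x, B ^ w x :=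
    dvd_sum fun x hx => pow_dvd_pow B (mem_filter.1 hx).2
  have hsum : ∑ x ∈ s, B ^ w x = ∑ x ∈ s with w x < v, B ^ w x +
      B ^ v * (#{x ∈ s | w x = v} + B * c) := by
    rw [← sum_filter_add_sum_filter_not s (fun x => w x < v), add_right_inj,
      ← sum_filter_add_sum_filter_not _ (fun x => w x = v), filter_filter, filter_filter]
    rw [filter_congr (q := fun x => w x = v) fun x _ => by omega,
      filter_congr (p := fun x => ¬ w x < v ∧ ¬ w x = v) (q := fun x => v < w x)
        fun x _ => by omega, hmid, hc]
    ring
  rw [hsum, Nat.add_mul_div_left _ _ (by positivity), Nat.div_eq_of_lt hlow, zero_add,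
    Nat.add_mul_mod_self_left]
  exact Nat.mod_eq_of_lt ((card_filter_le _ _).trans_lt hB)

section

variable (N k Δ : ℕ) (R : ℕ → ℕ) (t : ℕ)

open scoped Classical in
/-- The big jobs below `m`. -/
noncomputable def bigJobs (m : ℕ) : Finset ℕ := {j ∈ range m | IsBig Δ R t j}

open scoped Classical in
noncomputable def heavyJobs : Finset ℕ := {j ∈ range t | IsHeavy N k Δ R t j}

variable {N k Δ R t}

theorem mem_bigJobs {m j : ℕ} : j ∈ bigJobs Δ R t m ↔ j < m ∧ IsBig Δ R t j := by
  simp [bigJobs]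

theorem mem_heavyJobs {j : ℕ} : j ∈ heavyJobs N k Δ R t ↔ j < t ∧ IsBig Δ R t j ∧
    ¬ Reach N Δ R t j (residual N k Δ R t (t - 1 - j)) := by
  classical
  rw [heavyJobs, mem_filter, mem_range, IsHeavy]

theorem card_bigJobs_le {m : ℕ} : #(bigJobs Δ R t m) ≤ m := by
  classical
  exact (card_filter_le _ _).trans (card_range m).le

/-- Expanding the product gives one power for each set of big jobs. There are at most `2 ^ t` sets,
fewer than the base `2 ^ (t + 1)`. -/
theorem reach_iff {m v : ℕ} (hm : m ≤ t) :
    Reach N Δ R t m v ↔ ∃ X ⊆ bigJobs Δ R t m, ∑ j ∈ X, code N R t j = v := by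
  classical
  have hgen : genFun N Δ R t m =
      ∑ X ∈ (bigJobs Δ R t m).powerset, (2 ^ (t + 1)) ^ ∑ j ∈ X, code N R t j := by
    rw [genFun, ← prod_filter, Finset.prod_one_add]
    refine sum_congr rfl fun X _ => ?_
    rw [prod_pow_eq_pow_sum]
  have hcard : #(bigJobs Δ R t m).powerset < 2 ^ (t + 1) := by
    rw [card_powerset]
    exact Nat.pow_lt_pow_right (by omega)
      (Nat.lt_succ_of_le ((card_bigJobs_le (Δ := Δ) (R := R) (t := t)).trans hm))
  rw [Reach, hgen, digit_sum_pow _ _ hcard, card_pos, filter_nonempty_iff]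
  simp only [mem_powerset]

theorem sum_code (X : Finset ℕ) :
    ∑ j ∈ X, code N R t j = (∑ j ∈ X, weight N R t j) * (t + 1) + #X := by
  simp only [code, sum_add_distrib, sum_mul, sum_const, smul_eq_mul, mul_one]

theorem residual_zero : residual N k Δ R t 0 = bestCode N k Δ R t := rfl

open scoped Classical in
theorem residual_succ (i : ℕ) : residual N k Δ R t (i + 1) = residual N k Δ R t i -
    if Reach N Δ R t (t - 1 - i) (residual N k Δ R t i) then 0 else code N R t (t - 1 - i) := rfl

-- Backtracking invariant: after `i` decisions the residual is still realized by the remaining big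
-- jobs, and together with the heavy jobs found so far it makes up the best code. A job is heavy
-- only when the residual cannot be realized without it.
open scoped Classical in
theorem residual_spec (h : Reach N Δ R t t (bestCode N k Δ R t)) : ∀ i ≤ t,
    Reach N Δ R t (t - i) (residual N k Δ R t i) ∧
      ∑ j ∈ heavyJobs N k Δ R t with t - i ≤ j, code N R t j + residual N k Δ R t i =
        bestCode N k Δ R t := by
  intro i
  induction i with
  | zero =>
    intro _
    refine ⟨h, ?_⟩
    rw [filter_false_of_mem (by
      intro j hj
      simp only [heavyJobs, mem_filter, mem_range] at hj
      omega), sum_empty, zero_add, residual_zero]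
  | succ i ih =>
    intro hi
    obtain ⟨h1, h2⟩ := ih (by omega)
    obtain ⟨j, hj⟩ : ∃ j, j = t - 1 - i := ⟨_, rfl⟩
    have hj1 : t - i = j + 1 := by omega
    have hj2 : t - (i + 1) = j := by omega
    have hj3 : t - 1 - j = i := by omega
    rw [hj1] at h1 h2
    rw [hj2, residual_succ, ← hj]
    by_cases hr : Reach N Δ R t j (residual N k Δ R t i)
    · rw [if_pos hr, Nat.sub_zero]
      refine ⟨hr, ?_⟩
      rw [← h2]
      congr 2
      refine filter_congr fun l hl => ?_
      rw [mem_heavyJobs] at hl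
      have : l ≠ j := by
        rintro rfl
        rw [hj3] at hl
        exact hl.2.2 hr
      omega
    · rw [if_neg hr]
      obtain ⟨X, hX, hsum⟩ := (reach_iff (by omega)).1 h1
      have hjX : j ∈ X := by
        by_contra hjX
        refine hr ((reach_iff (by omega)).2 ⟨X, fun l hl => ?_, hsum⟩)
        have := mem_bigJobs.1 (hX hl)
        have hlj : l ≠ j := fun h => hjX (h ▸ hl)
        exact mem_bigJobs.2 ⟨by omega, this.2⟩
      have hbig := (mem_bigJobs.1 (hX hjX)).2
      rw [← add_sum_erase X _ hjX] at hsum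
      have hheavy : j ∈ heavyJobs N k Δ R t := by
        rw [mem_heavyJobs, hj3]
        exact ⟨hbig.1, hbig, hr⟩
      refine ⟨(reach_iff (by omega)).2 ⟨X.erase j, fun l hl => ?_, by omega⟩, ?_⟩
      · have := mem_bigJobs.1 (hX (mem_of_mem_erase hl))
        have hlj := ne_of_mem_erase hl
        exact mem_bigJobs.2 ⟨by omega, this.2⟩
      · have hsplit : {l ∈ heavyJobs N k Δ R t | j ≤ l} =
            insert j {l ∈ heavyJobs N k Δ R t | j + 1 ≤ l} := by
          ext l
          simp only [mem_filter, mem_insert]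
          constructor
          · rintro ⟨h3, h4⟩
            rcases h4.eq_or_lt with h5 | h5
            · exact Or.inl h5.symm
            · exact Or.inr ⟨h3, h5⟩
          · rintro (rfl | ⟨h3, h4⟩)
            · exact ⟨hheavy, le_rfl⟩
            · exact ⟨h3, by omega⟩
        rw [hsplit, sum_insert (by simp)]
        omega

theorem sum_code_heavyJobs (h : Reach N Δ R t t (bestCode N k Δ R t)) :
    ∑ j ∈ heavyJobs N k Δ R t, code N R t j = bestCode N k Δ R t := by
  classical
  obtain ⟨h1, h2⟩ := residual_spec h t le_rfl
  rw [Nat.sub_self] at h1 h2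
  obtain ⟨X, hX, hs⟩ := (reach_iff (Nat.zero_le _)).1 h1
  have : X = ∅ := by
    rw [eq_empty_iff_forall_notMem]
    intro j hj
    have := (mem_bigJobs.1 (hX hj)).1
    omega
  rw [this, sum_empty] at hs
  rw [← hs, add_zero] at h2
  rw [← h2]
  congr 1
  exact (filter_true_of_mem fun j _ => Nat.zero_le j).symm

theorem heavyJobs_subset : heavyJobs N k Δ R t ⊆ bigJobs Δ R t t := by
  classical
  intro j hj
  rw [mem_heavyJobs] at hj
  exact mem_bigJobs.2 ⟨hj.1, hj.2.1⟩

/-- A set of big jobs has at most `t` elements, so quotient and remainder of its code modulo `t + 1`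
recover its weight and its cardinality. -/
theorem goodCode_iff {X : Finset ℕ} (hX : X ⊆ bigJobs Δ R t t) :
    GoodCode N k Δ R t (∑ j ∈ X, code N R t j) ↔ #X ≤ k ∧ #(bigJobs Δ R t t \ X) ≤ k ∧
      ∑ j ∈ bigJobs Δ R t t, weight N R t j ≤ 2 * ∑ j ∈ X, weight N R t j := by
  classical
  have hXt : #X < t + 1 := Nat.lt_succ_of_le ((card_le_card hX).trans card_bigJobs_le)
  have hdiv : (∑ j ∈ X, code N R t j) / (t + 1) = ∑ j ∈ X, weight N R t j := by
    rw [sum_code, mul_comm, Nat.mul_add_div (by omega), Nat.div_eq_of_lt hXt, add_zero]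
  have hmod : (∑ j ∈ X, code N R t j) % (t + 1) = #X := by
    rw [sum_code, mul_comm, Nat.mul_add_mod, Nat.mod_eq_of_lt hXt]
  have hr : Reach N Δ R t t (∑ j ∈ X, code N R t j) := (reach_iff le_rfl).2 ⟨X, hX, rfl⟩
  rw [GoodCode, hdiv, hmod, countBelow_eq_card, sumBelow_eq_sum, ← bigJobs,
    card_sdiff_of_subset hX]
  simp only [hr, true_and]
  refine and_congr_right fun _ => and_congr_left fun _ => ?_
  omega

theorem weight_le (j : ℕ) : weight N R t j ≤ resolution N t := min_le_left _ _

theorem code_lt_codeBound {X : Finset ℕ} (hX : X ⊆ bigJobs Δ R t t) :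
    ∑ j ∈ X, code N R t j < codeBound N t := by
  have hXt : #X ≤ t := (card_le_card hX).trans card_bigJobs_le
  have h1 : ∑ j ∈ X, weight N R t j ≤ t * resolution N t := by
    refine (sum_le_card_nsmul X _ _ fun j _ => weight_le j).trans ?_
    rw [smul_eq_mul]
    exact Nat.mul_le_mul_right _ hXt
  rw [sum_code, codeBound, add_mul]
  have := Nat.mul_le_mul_right (t + 1) h1
  omega

theorem bestCode_spec {v : ℕ} (hv : GoodCode N k Δ R t v) :
    GoodCode N k Δ R t (bestCode N k Δ R t) ∧ bestCode N k Δ R t ≤ v := by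
  obtain ⟨X, hX, rfl⟩ := (reach_iff le_rfl).1 hv.1
  have hlt := code_lt_codeBound (N := N) hX
  have hiff : ∀ i, i < bestCode N k Δ R t ↔ i < codeBound N t ∧
      ¬ ∃ w < codeBound N t, w ≤ i ∧ GoodCode N k Δ R t w := fun i =>
    lt_countBelow_iff fun i j hij h ⟨w, h1, h2, h3⟩ => h ⟨w, h1, h2.trans hij, h3⟩
  have hle : bestCode N k Δ R t ≤ ∑ j ∈ X, code N R t j := by
    by_contra hlt'
    exact ((hiff _).1 (not_le.1 hlt')).2 ⟨_, hlt, le_rfl, hv⟩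
  refine ⟨?_, hle⟩
  have h := mt (hiff (bestCode N k Δ R t)).2 (lt_irrefl _)
  rw [not_and, not_not] at h
  obtain ⟨w, h1, h2, h3⟩ := h (by omega)
  rcases h2.eq_or_lt with rfl | h4
  · exact h3
  · exact absurd ⟨w, h1, le_rfl, h3⟩ ((hiff w).1 h4).2

/-- Of the two sides of a partition, the one of larger weight has a good code. -/
theorem exists_goodCode {X : Finset ℕ} (hX : X ⊆ bigJobs Δ R t t) (h1 : #X ≤ k)
    (h2 : #(bigJobs Δ R t t \ X) ≤ k) : ∃ Y, (Y = X ∨ Y = bigJobs Δ R t t \ X) ∧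
      Y ⊆ bigJobs Δ R t t ∧ GoodCode N k Δ R t (∑ j ∈ Y, code N R t j) := by
  have hs := sum_sdiff (f := weight N R t) hX
  rcases le_total (∑ j ∈ bigJobs Δ R t t \ X, weight N R t j) (∑ j ∈ X, weight N R t j) with h | h
  · exact ⟨X, Or.inl rfl, hX, (goodCode_iff hX).2 ⟨h1, h2, by omega⟩⟩
  · exact ⟨_, Or.inr rfl, sdiff_subset, (goodCode_iff sdiff_subset).2
      ⟨h2, by rwa [Finset.sdiff_sdiff_eq_self hX], by omega⟩⟩

theorem goodCode_heavyJobs (hk : #(bigJobs Δ R t t) ≤ 2 * k) :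
    GoodCode N k Δ R t (∑ j ∈ heavyJobs N k Δ R t, code N R t j) ∧
      ∀ v, GoodCode N k Δ R t v → ∑ j ∈ heavyJobs N k Δ R t, code N R t j ≤ v := by
  obtain ⟨X, hX, hc⟩ := exists_subset_card_eq (min_le_right k #(bigJobs Δ R t t))
  obtain ⟨Y, -, -, hY⟩ := exists_goodCode (N := N) (k := k) hX (by omega)
    (by rw [card_sdiff_of_subset hX]; omega)
  have h := (bestCode_spec hY).1
  rw [sum_code_heavyJobs h.1]
  exact ⟨h, fun v hv => (bestCode_spec hv).2⟩

theorem heavyCount_eq : heavyCount N k Δ R t = #(heavyJobs N k Δ R t) := by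
  classical
  rw [heavyCount, countBelow_eq_card, heavyJobs]

theorem heavyLoad_eq : heavyLoad N k Δ R t = ∑ j ∈ heavyJobs N k Δ R t, R j := by
  classical
  rw [heavyLoad, sumBelow_eq_sum, heavyJobs]

theorem lightJobs_eq [DecidablePred fun j => IsBig Δ R t j ∧ ¬ IsHeavy N k Δ R t j] :
    {j ∈ range t | IsBig Δ R t j ∧ ¬ IsHeavy N k Δ R t j} =
      bigJobs Δ R t t \ heavyJobs N k Δ R t := by
  classical
  ext j
  simp only [mem_sdiff, bigJobs, heavyJobs, mem_filter]
  tauto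

theorem lightCount_eq : lightCount N k Δ R t = #(bigJobs Δ R t t \ heavyJobs N k Δ R t) := by
  classical
  rw [lightCount, countBelow_eq_card, lightJobs_eq]

theorem lightLoad_eq :
    lightLoad N k Δ R t = ∑ j ∈ bigJobs Δ R t t \ heavyJobs N k Δ R t, R j := by
  classical
  rw [lightLoad, sumBelow_eq_sum, lightJobs_eq]

theorem heavyCount_add_lightCount :
    heavyCount N k Δ R t + lightCount N k Δ R t = #(bigJobs Δ R t t) := by
  rw [heavyCount_eq, lightCount_eq, card_sdiff_of_subset heavyJobs_subset]
  have := card_le_card (heavyJobs_subset (N := N) (k := k) (Δ := Δ) (R := R) (t := t))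
  omega

theorem heavyLoad_add_lightLoad :
    heavyLoad N k Δ R t + lightLoad N k Δ R t = ∑ j ∈ bigJobs Δ R t t, R j := by
  rw [heavyLoad_eq, lightLoad_eq, add_comm, sum_sdiff heavyJobs_subset]

theorem counts_le (hk : #(bigJobs Δ R t t) ≤ 2 * k) :
    heavyCount N k Δ R t ≤ k ∧ lightCount N k Δ R t ≤ k := by
  have h := (goodCode_iff heavyJobs_subset).1 (goodCode_heavyJobs (N := N) hk).1
  rw [heavyCount_eq, lightCount_eq]
  exact ⟨h.1, h.2.1⟩

/-! ### Near optimality of the partition of the big jobs -/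

theorem prefixLoad_mono {m m' : ℕ} (h : m ≤ m') : prefixLoad R m ≤ prefixLoad R m' :=
  sum_le_sum_of_subset (range_subset_range.2 h)

theorem weight_bounds {j : ℕ} (hj : j < t) (hS : 0 < prefixLoad R t) :
    weight N R t j * prefixLoad R t ≤ R j * resolution N t ∧
      R j * resolution N t ≤ (weight N R t j + 1) * prefixLoad R t := by
  have hle : R j ≤ prefixLoad R t := single_le_sum (f := R) (fun _ _ => Nat.zero_le _)
    (mem_range.2 hj)
  have hw : weight N R t j = R j * resolution N t / prefixLoad R t := by
    rw [weight, min_eq_right]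
    exact Nat.div_le_of_le_mul (Nat.mul_le_mul_right _ hle)
  rw [hw]
  refine ⟨Nat.div_mul_le_self _ _, ?_⟩
  have := Nat.lt_div_mul_add hS (a := R j * resolution N t)
  rw [add_mul, one_mul]
  exact this.le

theorem sum_weight_bounds {X : Finset ℕ} (hX : X ⊆ bigJobs Δ R t t) (hS : 0 < prefixLoad R t) :
    (∑ j ∈ X, weight N R t j) * prefixLoad R t ≤ (∑ j ∈ X, R j) * resolution N t ∧
      (∑ j ∈ X, R j) * resolution N t ≤ (∑ j ∈ X, weight N R t j + t) * prefixLoad R t := by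
  have hlt : ∀ j ∈ X, j < t := fun j hj => (mem_bigJobs.1 (hX hj)).1
  constructor
  · rw [sum_mul, sum_mul]
    exact sum_le_sum fun j hj => (weight_bounds (hlt j hj) hS).1
  · have hXt : #X ≤ t := (card_le_card hX).trans card_bigJobs_le
    calc (∑ j ∈ X, R j) * resolution N t
        ≤ ∑ j ∈ X, (weight N R t j + 1) * prefixLoad R t := by
          rw [sum_mul]
          exact sum_le_sum fun j hj => (weight_bounds (hlt j hj) hS).2
      _ = (∑ j ∈ X, weight N R t j + #X) * prefixLoad R t := by
          rw [← sum_mul, sum_add_distrib, sum_const, smul_eq_mul, mul_one]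
      _ ≤ _ := Nat.mul_le_mul_right _ (by omega)

/-- Comparing weights instead of sizes costs at most `t` units, and `64 * N * t` units are at most
the load of the first `t` jobs. -/
theorem load_le_of_weight_le {X Y : Finset ℕ} (hX : X ⊆ bigJobs Δ R t t)
    (hY : Y ⊆ bigJobs Δ R t t) (h : ∑ j ∈ X, weight N R t j ≤ ∑ j ∈ Y, weight N R t j) :
    64 * N * ∑ j ∈ X, R j ≤ 64 * N * ∑ j ∈ Y, R j + prefixLoad R t := by
  rcases Nat.eq_zero_or_pos (prefixLoad R t) with hS | hS
  · have : ∑ j ∈ X, R j = 0 := by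
      have h1 : ∑ j ∈ X, R j ≤ prefixLoad R t := sum_le_sum_of_subset fun j hj =>
        mem_range.2 (mem_bigJobs.1 (hX hj)).1
      omega
    rw [this]
    omega
  · have h1 := (sum_weight_bounds (N := N) hX hS).2
    have h2 := (sum_weight_bounds (N := N) hY hS).1
    have h3 := Nat.mul_le_mul_right (prefixLoad R t) h
    rw [resolution] at h1 h2
    refine Nat.le_of_mul_le_mul_right (c := t + 1) ?_ (by omega)
    nlinarith

/-- The partition of the big jobs is nearly optimal among all feasible ones. -/
theorem loads_le (hk : #(bigJobs Δ R t t) ≤ 2 * k) {X : Finset ℕ} (hX : X ⊆ bigJobs Δ R t t)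
    (h1 : #X ≤ k) (h2 : #(bigJobs Δ R t t \ X) ≤ k) {c : ℕ} (hc1 : ∑ j ∈ X, R j ≤ c)
    (hc2 : ∑ j ∈ bigJobs Δ R t t \ X, R j ≤ c) :
    64 * N * heavyLoad N k Δ R t ≤ 64 * N * c + prefixLoad R t ∧
      64 * N * lightLoad N k Δ R t ≤ 64 * N * c + prefixLoad R t := by
  obtain ⟨Y, hYX, hY, hg⟩ := exists_goodCode (N := N) hX h1 h2
  have hYc : ∑ j ∈ Y, R j ≤ c := by
    rcases hYX with rfl | rfl <;> assumption
  obtain ⟨hg1, hmin⟩ := goodCode_heavyJobs (N := N) hk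
  have hle := hmin _ hg
  have hH := heavyJobs_subset (N := N) (k := k) (Δ := Δ) (R := R) (t := t)
  -- Codes are ordered lexicographically, weight before cardinality, so the least good code also has
  -- the least weight.
  have hw : ∑ j ∈ heavyJobs N k Δ R t, weight N R t j ≤ ∑ j ∈ Y, weight N R t j := by
    rw [sum_code, sum_code] at hle
    have hYt : #Y ≤ t := (card_le_card hY).trans card_bigJobs_le
    by_contra hlt
    have : (∑ j ∈ Y, weight N R t j + 1) * (t + 1) ≤
        (∑ j ∈ heavyJobs N k Δ R t, weight N R t j) * (t + 1) :=
      Nat.mul_le_mul_right _ (by omega)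
    rw [add_mul] at this
    omega
  have hl := ((goodCode_iff hH).1 hg1).2.2
  have hs := sum_sdiff (f := weight N R t) hH
  have e1 := load_le_of_weight_le hH hY hw
  have e2 := load_le_of_weight_le (sdiff_subset (t := heavyJobs N k Δ R t)) hY
    (show ∑ j ∈ bigJobs Δ R t t \ heavyJobs N k Δ R t, weight N R t j ≤ _ by omega)
  have := Nat.mul_le_mul_left (64 * N) hYc
  rw [heavyLoad_eq, lightLoad_eq]
  exact ⟨by omega, by omega⟩

theorem lightLoad_le (hk : #(bigJobs Δ R t t) ≤ 2 * k) :
    64 * N * lightLoad N k Δ R t ≤ 64 * N * heavyLoad N k Δ R t + prefixLoad R t := by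
  have hH := heavyJobs_subset (N := N) (k := k) (Δ := Δ) (R := R) (t := t)
  have hl := ((goodCode_iff hH).1 (goodCode_heavyJobs (N := N) hk).1).2.2
  have hs := sum_sdiff (f := weight N R t) hH
  rw [heavyLoad_eq, lightLoad_eq]
  exact load_le_of_weight_le sdiff_subset hH (by omega)

end

/-! ### Splitting the ranks of the small jobs -/

theorem sum_range_two_mul_mirror {M : Type*} [AddCommMonoid M] (f : ℕ → M) (κ : ℕ) :
    ∑ i ∈ range (2 * κ), f i = ∑ i ∈ range κ, (f i + f (2 * κ - 1 - i)) := by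
  rw [two_mul, sum_range_add, sum_add_distrib, ← sum_range_reflect (fun i => f (κ + i)) κ]
  congr 1
  refine sum_congr rfl fun i hi => ?_
  rw [mem_range] at hi
  congr 1
  omega

/-- Mirrored ranks have opposite parity, so the alternating zone separates them; the top `T` ranks
mirror the bottom `T`, which go to the first machine. -/
theorem rankRight_mirror {κ T a b i : ℕ} (hT : T ≤ κ) (hi : i < κ) :
    RankRight κ T a b (2 * κ - 1 - i) ↔ ¬ RankRight κ T a b i := by
  rw [RankRight, RankRight]
  omega

theorem countBelow_rankRight {κ T a b : ℕ} (hT : T ≤ κ) :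
    countBelow (RankRight κ T a b) (2 * κ) = κ := by
  classical
  rw [countBelow, sum_range_two_mul_mirror]
  rw [sum_congr rfl (g := fun _ => 1), sum_const, card_range, smul_eq_mul, mul_one]
  intro i hi
  rw [if_congr (rankRight_mirror hT (mem_range.1 hi)) rfl rfl]
  split_ifs <;> rfl

theorem countBelow_mono {P : ℕ → Prop} {m n : ℕ} (h : m ≤ n) : countBelow P m ≤ countBelow P n := by
  classical
  rw [countBelow_eq_card, countBelow_eq_card]
  exact card_le_card (filter_subset_filter _ (range_subset_range.2 h))

theorem countBelow_add_not (P : ℕ → Prop) (n : ℕ) :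
    countBelow P n + countBelow (fun i => ¬ P i) n = n := by
  classical
  rw [countBelow_eq_card, countBelow_eq_card, card_filter_add_card_filter_not, card_range]

theorem countBelow_rankRight_add {κ T a b : ℕ} (hT : T ≤ κ) (c : ℕ) :
    countBelow (RankRight κ T a b) (2 * κ + c) = κ + if b < a then c else 0 := by
  classical
  induction c with
  | zero => simp [countBelow_rankRight hT]
  | succ c ih =>
    rw [← add_assoc, countBelow_succ, ih]
    have : RankRight κ T a b (2 * κ + c) ↔ b < a := by
      rw [RankRight]
      omega
    simp only [this]
    split_ifs <;> omega

/-- With `a` and `b` big jobs and `c` small jobs, both machines get at most `k` jobs. -/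
theorem split_feasible {k a b c T : ℕ} (ha : a ≤ k) (hb : b ≤ k) (hn : a + b + c ≤ 2 * k)
    (hT : T ≤ k - max a b) :
    b + countBelow (RankRight (k - max a b) T a b) c ≤ k ∧
      a + (c - countBelow (RankRight (k - max a b) T a b) c) ≤ k := by
  set κ := k - max a b with hκ
  rcases le_total c (2 * κ) with h | h
  · have h1 := countBelow_mono (P := RankRight κ T a b) h
    have h2 := countBelow_mono (P := fun i => ¬ RankRight κ T a b i) h
    have h3 := countBelow_add_not (RankRight κ T a b) c
    have h4 := countBelow_add_not (RankRight κ T a b) (2 * κ)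
    rw [countBelow_rankRight hT] at h1 h4
    omega
  · obtain ⟨d, rfl⟩ := Nat.exists_eq_add_of_le h
    rw [countBelow_rankRight_add hT]
    split_ifs <;> omega

/-- Leibniz criterion: the alternating sum of a decreasing nonnegative sequence lies between zero
and its first term. -/
theorem alternating_sum_bounds (d : ℕ → ℤ) {T κ : ℕ} (hd : ∀ i j, T ≤ i → i ≤ j → j < κ → d j ≤ d i)
    (h0 : ∀ i, T ≤ i → i < κ → 0 ≤ d i) (hT : T < κ) :
    0 ≤ ∑ i ∈ Ico T κ, (-1) ^ (i - T) * d i ∧ ∑ i ∈ Ico T κ, (-1) ^ (i - T) * d i ≤ d T := by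
  obtain ⟨m, rfl⟩ : ∃ m, κ = T + 1 + m := ⟨κ - T - 1, by omega⟩
  clear hT
  induction m generalizing T with
  | zero => simpa using h0 T le_rfl (by omega)
  | succ m ih =>
    have hih := ih (T := T + 1) (fun i j h1 h2 h3 => hd i j (by omega) h2 (by omega))
      (fun i h1 h2 => h0 i (by omega) (by omega))
    have e1 : T + 1 + 1 + m = T + 1 + (m + 1) := by omega
    rw [e1] at hih
    have e2 : ∑ i ∈ Ico T (T + 1 + (m + 1)), (-1) ^ (i - T) * d i =
        d T - ∑ i ∈ Ico (T + 1) (T + 1 + (m + 1)), (-1) ^ (i - (T + 1)) * d i := by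
      rw [sum_eq_sum_Ico_succ_bot (by omega), Nat.sub_self, pow_zero, one_mul, sub_eq_add_neg,
        ← sum_neg_distrib]
      congr 1
      refine sum_congr rfl fun i hi => ?_
      rw [mem_Ico] at hi
      have : i - T = i - (T + 1) + 1 := by omega
      rw [this, pow_succ]
      ring
    rw [e2]
    have h1 := hd T (T + 1) le_rfl (by omega) (by omega)
    constructor <;> linarith [hih.1, hih.2, h1]

section Split

variable {s : ℕ → ℕ} {n Λ κ D T a b : ℕ}

theorem sumBelow_add_not (m : ℕ → Prop) (s : ℕ → ℕ) (n : ℕ) :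
    sumBelow m s n + sumBelow (fun i => ¬ m i) s n = ∑ i ∈ range n, s i := by
  classical
  rw [sumBelow_eq_sum, sumBelow_eq_sum, ← sum_filter_add_sum_filter_not (range n) m]

theorem sum_range_extend (h0 : ∀ i, n ≤ i → s i = 0) {m : ℕ} (h : n ≤ m) :
    ∑ i ∈ range n, s i = ∑ i ∈ range m, s i :=
  sum_subset (range_subset_range.2 h) fun i _ hi => h0 i (by simpa using hi)

theorem sumBelow_extend (m : ℕ → Prop) (h0 : ∀ i, n ≤ i → s i = 0) {n' : ℕ} (h : n ≤ n') :
    sumBelow m s n = sumBelow m s n' := by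
  classical
  rw [sumBelow_eq_sum, sumBelow_eq_sum, sum_filter, sum_filter]
  refine sum_subset (range_subset_range.2 h) fun i _ hi => ?_
  rw [h0 i (by simpa using hi), ite_self]

theorem gain_eq (h0 : ∀ i, n ≤ i → s i = 0) (i : ℕ) :
    gain Λ κ n s i = min (Λ * s i) ((Λ + 1) * (s i - s (2 * κ - 1 - i))) := by
  rw [gain]
  rcases le_total n (2 * κ - 1 - i) with h | h
  · rw [min_eq_left h, h0 n le_rfl, h0 _ h]
  · rw [min_eq_right h]

theorem lt_cutoff_iff {t : ℕ} : t < cutoff Λ κ n D s ↔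
    t < n ∧ t < κ ∧ ∑ i ∈ range t, gain Λ κ n s i < Λ * D :=
  lt_countBelow_iff fun _ _ hij h => ⟨by omega,
    (sum_le_sum_of_subset (range_subset_range.2 hij)).trans_lt h.2⟩

theorem cutoff_le : cutoff Λ κ n D s ≤ κ := by
  by_contra h
  exact lt_irrefl _ (lt_cutoff_iff.1 (not_le.1 h)).2.1

/-- Difference of the loads of the ranks below `2 * κ`. -/
theorem sumBelow_diff (hs : Antitone s) (hT : T ≤ κ) :
    |(sumBelow (RankRight κ T a b) s (2 * κ) : ℤ) -
      sumBelow (fun i => ¬ RankRight κ T a b i) s (2 * κ) -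
      ∑ i ∈ range T, ((s i : ℤ) - s (2 * κ - 1 - i))| ≤ s 0 := by
  classical
  set d : ℕ → ℤ := fun i => (s i : ℤ) - s (2 * κ - 1 - i) with hd
  have e1 : (sumBelow (RankRight κ T a b) s (2 * κ) : ℤ) -
      sumBelow (fun i => ¬ RankRight κ T a b i) s (2 * κ) =
      ∑ i ∈ range κ, (if RankRight κ T a b i then d i else - d i) := by
    rw [sumBelow_eq_sum, sumBelow_eq_sum, sum_filter, sum_filter]
    push_cast
    rw [← sum_sub_distrib, sum_range_two_mul_mirror]
    refine sum_congr rfl fun i hi => ?_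
    have hm := rankRight_mirror (a := a) (b := b) hT (mem_range.1 hi)
    by_cases h : RankRight κ T a b i <;> simp [hm, h, hd] <;> ring
  -- Beyond the top `T` pairs the signs are given by the parity of the rank; the factor `(-1) ^ T`
  -- makes the alternating sum start with a plus sign.
  have e2 : ∑ i ∈ range κ, (if RankRight κ T a b i then d i else - d i) -
      ∑ i ∈ range T, d i = (-1) ^ T * ∑ i ∈ Ico T κ, (-1) ^ (i - T) * d i := by
    rw [range_eq_Ico, ← sum_Ico_consecutive _ (Nat.zero_le T) hT,
      sum_congr rfl (g := d) (s₁ := Ico 0 T), range_eq_Ico, add_sub_cancel_left, mul_sum]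
    · refine sum_congr rfl fun i hi => ?_
      rw [mem_Ico] at hi
      rw [← mul_assoc, ← pow_add, Nat.add_sub_cancel' hi.1]
      rcases Nat.even_or_odd i with h | h
      · rw [if_pos, h.neg_one_pow, one_mul]
        rw [RankRight]
        have := Nat.even_iff.1 h
        omega
      · rw [if_neg, h.neg_one_pow, neg_one_mul]
        rw [RankRight]
        have := Nat.odd_iff.1 h
        omega
    · intro i hi
      rw [if_pos]
      exact Or.inl (mem_Ico.1 hi).2
  rw [e1, e2, abs_mul, abs_neg_one_pow, one_mul]
  rcases hT.eq_or_lt with rfl | hlt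
  · simp
  · obtain ⟨h1, h2⟩ := alternating_sum_bounds d (T := T) (κ := κ) (by
      intro i j _ hij hj
      have h1 := hs hij
      have h2 : s (2 * κ - 1 - i) ≤ s (2 * κ - 1 - j) := hs (by omega)
      simp only [hd]
      omega) (by
      intro i _ hi
      have : s (2 * κ - 1 - i) ≤ s i := hs (by omega)
      simp only [hd]
      omega) hlt
    rw [abs_of_nonneg h1]
    refine h2.trans ?_
    have := hs (Nat.zero_le T)
    simp only [hd]
    omega

/-- The gain lies between `Λ * d` and `(Λ + 1) * d` for the true difference `d ≤ s i`, so the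
overestimates add up to at most the total size. -/
theorem sum_gain_bounds (hs : Antitone s) (h0 : ∀ i, n ≤ i → s i = 0) (hT : T ≤ κ) :
    (Λ : ℤ) * ∑ i ∈ range T, ((s i : ℤ) - s (2 * κ - 1 - i)) ≤
        (∑ i ∈ range T, gain Λ κ n s i : ℕ) ∧
      ((∑ i ∈ range T, gain Λ κ n s i : ℕ) : ℤ) ≤
        Λ * ∑ i ∈ range T, ((s i : ℤ) - s (2 * κ - 1 - i)) + (∑ i ∈ range n, s i : ℕ) := by
  have hsub : ∀ i ∈ range T, ((s i - s (2 * κ - 1 - i) : ℕ) : ℤ) =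
      (s i : ℤ) - s (2 * κ - 1 - i) := fun i hi => by
    rw [mem_range] at hi
    have : s (2 * κ - 1 - i) ≤ s i := hs (by omega)
    omega
  constructor
  · rw [mul_sum]
    push_cast
    refine sum_le_sum fun i hi => ?_
    rw [← hsub i hi, gain_eq h0]
    have h1 : Λ * (s i - s (2 * κ - 1 - i)) ≤ Λ * s i := Nat.mul_le_mul_left _ (Nat.sub_le _ _)
    have h2 : Λ * (s i - s (2 * κ - 1 - i)) ≤ (Λ + 1) * (s i - s (2 * κ - 1 - i)) :=
      Nat.mul_le_mul_right _ (by omega)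
    exact_mod_cast le_min h1 h2
  · have h1 : ∑ i ∈ range T, s i ≤ ∑ i ∈ range n, s i := by
      rcases le_total T n with h | h
      · exact sum_le_sum_of_subset (range_subset_range.2 h)
      · exact (sum_range_extend h0 h).ge
    have h2 : ((∑ i ∈ range T, gain Λ κ n s i : ℕ) : ℤ) ≤
        Λ * ∑ i ∈ range T, ((s i : ℤ) - s (2 * κ - 1 - i)) + (∑ i ∈ range T, s i : ℕ) := by
      push_cast
      rw [mul_sum, ← sum_add_distrib]
      refine sum_le_sum fun i hi => ?_
      rw [← hsub i hi, gain_eq h0]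
      have h3 : min (Λ * s i) ((Λ + 1) * (s i - s (2 * κ - 1 - i))) ≤
          Λ * (s i - s (2 * κ - 1 - i)) + s i := by
        refine (min_le_right _ _).trans ?_
        rw [add_mul, one_mul]
        have := Nat.sub_le (s i) (s (2 * κ - 1 - i))
        omega
      exact_mod_cast h3
    have h3 : ((∑ i ∈ range T, s i : ℕ) : ℤ) ≤ (∑ i ∈ range n, s i : ℕ) := by exact_mod_cast h1
    linarith

theorem sumBelow_add (m : ℕ → Prop) (s : ℕ → ℕ) (q c : ℕ) :
    sumBelow m s (q + c) ≤ sumBelow m s q + ∑ i ∈ Ico q (q + c), s i ∧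
      sumBelow m s q ≤ sumBelow m s (q + c) := by
  classical
  rw [sumBelow_eq_sum, sumBelow_eq_sum, sum_filter, sum_filter, range_eq_Ico,
    ← sum_Ico_consecutive _ (Nat.zero_le q) (Nat.le_add_right q c), range_eq_Ico]
  refine ⟨Nat.add_le_add_left (sum_le_sum fun i _ => ?_) _, Nat.le_add_right _ _⟩
  split_ifs <;> omega

/-- Total size of the ranks from `q` on. -/
noncomputable def tailLoad (s : ℕ → ℕ) (n q : ℕ) : ℕ := ∑ i ∈ Ico q n, s i

theorem tailLoad_extend (h0 : ∀ i, n ≤ i → s i = 0) {n' : ℕ} (h : n ≤ n') (q : ℕ) :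
    tailLoad s n q = tailLoad s n' q :=
  sum_subset (Ico_subset_Ico_right h) fun i hi hi' => h0 i (by simp at hi hi'; omega)

/-- If the top ranks suffice to balance the machines, then the loads nearly agree. -/
theorem balanced_split (hs : Antitone s) (h0 : ∀ i, n ≤ i → s i = 0) {L₁ L₂ S : ℕ}
    (hΛ : 0 < Λ) (hL : Λ * L₂ ≤ Λ * L₁ + S) (hs0 : Λ * s 0 ≤ S) (hov : Λ * tailLoad s n (2 * κ) ≤ S)
    (hS : ∑ i ∈ range n, s i ≤ S)
    (hbal : Λ * (L₁ - L₂) ≤ ∑ i ∈ range (cutoff Λ κ n (L₁ - L₂) s), gain Λ κ n s i) :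
    Λ * (L₂ + sumBelow (RankRight κ (cutoff Λ κ n (L₁ - L₂) s) a b) s n) ≤
        Λ * (L₁ + sumBelow (fun i => ¬ RankRight κ (cutoff Λ κ n (L₁ - L₂) s) a b i) s n) + 4 * S ∧
      Λ * (L₁ + sumBelow (fun i => ¬ RankRight κ (cutoff Λ κ n (L₁ - L₂) s) a b i) s n) ≤
        Λ * (L₂ + sumBelow (RankRight κ (cutoff Λ κ n (L₁ - L₂) s) a b) s n) + 4 * S := by
  set T := cutoff Λ κ n (L₁ - L₂) s with hT
  have hTκ : T ≤ κ := cutoff_le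
  -- Before the last rank was taken the gains were still below the target, and one gain is at most
  -- `Λ * s 0 ≤ S`.
  have hup : ∑ i ∈ range T, gain Λ κ n s i ≤ Λ * (L₁ - L₂) + S := by
    rcases Nat.eq_zero_or_pos T with h | h
    · rw [h]
      simp
    · obtain ⟨T', hT'⟩ : ∃ T', T = T' + 1 := ⟨T - 1, by omega⟩
      have h1 := (lt_cutoff_iff.1 (show T' < cutoff Λ κ n (L₁ - L₂) s by omega)).2.2
      have h2 : gain Λ κ n s T' ≤ Λ * s 0 := by
        rw [gain_eq h0]
        exact (min_le_left _ _).trans (Nat.mul_le_mul_left _ (hs (Nat.zero_le _)))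
      rw [hT', sum_range_succ]
      omega
  have hdiff := sumBelow_diff (a := a) (b := b) hs hTκ
  obtain ⟨hg1, hg2⟩ := sum_gain_bounds (Λ := Λ) hs h0 hTκ
  rw [abs_le] at hdiff
  set m := RankRight κ T a b with hm
  have x1 := sumBelow_extend m h0 (Nat.le_add_left n (2 * κ))
  have x2 := sumBelow_extend (fun i => ¬ m i) h0 (Nat.le_add_left n (2 * κ))
  have x3 := tailLoad_extend h0 (Nat.le_add_left n (2 * κ)) (2 * κ)
  obtain ⟨y1, y2⟩ := sumBelow_add m s (2 * κ) n
  obtain ⟨y3, y4⟩ := sumBelow_add (fun i => ¬ m i) s (2 * κ) n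
  rw [x1, x2]
  rw [← tailLoad] at y1 y3
  rw [x3] at hov
  set d : ℤ := ∑ i ∈ range T, ((s i : ℤ) - s (2 * κ - 1 - i))
  set H := ∑ i ∈ range T, gain Λ κ n s i
  have z1 : (Λ : ℤ) * sumBelow m s (2 * κ) - Λ * sumBelow (fun i => ¬ m i) s (2 * κ) ≤
      Λ * d + Λ * s 0 := by
    have : (Λ : ℤ) * (sumBelow m s (2 * κ) - sumBelow (fun i => ¬ m i) s (2 * κ)) ≤
        Λ * (d + s 0) := mul_le_mul_of_nonneg_left (by linarith [hdiff.2]) (by positivity)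
    linarith
  have z2 : (Λ : ℤ) * d - Λ * s 0 ≤
      (Λ : ℤ) * sumBelow m s (2 * κ) - Λ * sumBelow (fun i => ¬ m i) s (2 * κ) := by
    have : (Λ : ℤ) * (d - s 0) ≤
        Λ * (sumBelow m s (2 * κ) - sumBelow (fun i => ¬ m i) s (2 * κ)) :=
      mul_le_mul_of_nonneg_left (by linarith [hdiff.1]) (by positivity)
    linarith
  have w1 := Nat.mul_le_mul_left Λ y1
  have w2 := Nat.mul_le_mul_left Λ y2
  have w3 := Nat.mul_le_mul_left Λ y3
  have w4 := Nat.mul_le_mul_left Λ y4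
  rw [mul_add] at w1 w3
  have hD : Λ * (L₁ - L₂) = Λ * L₁ - Λ * L₂ := Nat.mul_sub _ _ _
  rw [hD] at hup hbal
  rw [mul_add, mul_add]
  zify at *
  -- In the first inequality the four errors `S` come from the overshoot of the cutoff, the
  -- alternating part, the ranks beyond `2 * κ`, and the truncation of `L₁ - L₂` at zero.
  constructor
  · have : ((Λ * L₁ - Λ * L₂ : ℕ) : ℤ) ≤ Λ * L₁ - Λ * L₂ + S := by
      have : Λ * L₁ - Λ * L₂ + Λ * L₂ ≤ Λ * L₁ + S := by zify; omega
      zify at this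
      linarith
    linarith
  · have : (Λ : ℤ) * L₁ - Λ * L₂ ≤ ((Λ * L₁ - Λ * L₂ : ℕ) : ℤ) := by
      have : Λ * L₁ ≤ Λ * L₁ - Λ * L₂ + Λ * L₂ := le_tsub_add
      zify at this
      linarith
    linarith

/-- Otherwise the second machine gets the largest small jobs. -/
theorem unbalanced_split (hs : Antitone s) (h0 : ∀ i, n ≤ i → s i = 0) {L₁ L₂ : ℕ} (hΛ : 0 < Λ)
    (hbal : ∑ i ∈ range (cutoff Λ κ n (L₁ - L₂) s), gain Λ κ n s i < Λ * (L₁ - L₂)) :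
    L₁ + sumBelow (fun i => ¬ RankRight κ (cutoff Λ κ n (L₁ - L₂) s) a b i) s n ≤
        L₁ + tailLoad s n κ ∧
      L₂ + sumBelow (RankRight κ (cutoff Λ κ n (L₁ - L₂) s) a b) s n ≤
        L₁ + tailLoad s n κ + tailLoad s n (2 * κ) := by
  classical
  set T := cutoff Λ κ n (L₁ - L₂) s with hT
  have hTκ : T ≤ κ := cutoff_le
  -- The gains did not suffice, so the cutoff stopped only because the ranks or the slots were
  -- exhausted; the alternating zone then contains no job.
  have hcap : n ≤ T ∨ T = κ := by
    by_contra h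
    exact lt_irrefl T (lt_cutoff_iff.2 ⟨by omega, by omega, hbal⟩)
  constructor
  · refine Nat.add_le_add_left ?_ _
    rw [sumBelow_eq_sum, tailLoad]
    refine sum_le_sum_of_subset fun i hi => ?_
    rw [mem_filter, mem_range, RankRight] at hi
    rw [mem_Ico]
    omega
  · have h1 : sumBelow (RankRight κ T a b) s n ≤
        ∑ i ∈ range T, s i + tailLoad s n (2 * κ) := by
      rw [sumBelow_eq_sum, tailLoad]
      refine le_trans (sum_le_sum_of_subset (t := range T ∪ Ico (2 * κ) n) fun i hi => ?_)
        (sum_union_inter (f := s) ▸ Nat.le_add_right _ _)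
      rw [mem_filter, mem_range, RankRight] at hi
      rw [mem_union, mem_range, mem_Ico]
      omega
    obtain ⟨hg1, -⟩ := sum_gain_bounds (Λ := Λ) hs h0 hTκ
    have h2 : ∑ i ∈ range T, ((s i : ℤ) - s (2 * κ - 1 - i)) ≤ (L₁ - L₂ : ℕ) := by
      have : (Λ : ℤ) * ∑ i ∈ range T, ((s i : ℤ) - s (2 * κ - 1 - i)) ≤
          Λ * ((L₁ - L₂ : ℕ) : ℤ) := hg1.trans (by exact_mod_cast hbal.le)
      exact le_of_mul_le_mul_left this (by exact_mod_cast hΛ)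
    -- The mirrors of the top `T ≤ κ` ranks are distinct ranks from `κ` on.
    have h3 : ∑ i ∈ range T, s (2 * κ - 1 - i) ≤ tailLoad s n κ := by
      rw [tailLoad_extend h0 (Nat.le_add_left n (2 * κ)), tailLoad]
      rw [← sum_image (f := s) (g := fun i => 2 * κ - 1 - i) (s := range T) (by
        intro i hi j hj hij
        simp only [coe_range, Set.mem_Iio] at hi hj hij
        omega)]
      refine sum_le_sum_of_subset fun i hi => ?_
      rw [mem_image] at hi
      obtain ⟨j, hj, rfl⟩ := hi
      rw [mem_range] at hj
      rw [mem_Ico]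
      omega
    rw [sum_sub_distrib] at h2
    have h4 : 0 < L₁ - L₂ := by
      rcases Nat.eq_zero_or_pos (L₁ - L₂) with h | h
      · rw [h] at hbal
        omega
      · exact h
    have h5 : ∑ i ∈ range T, s i ≤ L₁ - L₂ + ∑ i ∈ range T, s (2 * κ - 1 - i) := by
      zify
      linarith
    omega

end Split

/-! ### Feasibility and approximation ratio -/

section

variable {N k n Δ : ℕ} {R : ℕ → ℕ}

theorem lt_epoch_iff {i : ℕ} :
    i < epoch Δ R n ↔ i < n ∧ ∃ u < n, i ≤ u ∧ Renews Δ R u :=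
  lt_countBelow_iff fun _ _ hij ⟨u, h1, h2, h3⟩ => ⟨u, h1, hij.trans h2, h3⟩

theorem epoch_le : epoch Δ R n ≤ n := countBelow_le _ _

/-- A job released before the last fresh start is small by comparison with the load at that time; a
later one is small because its release did not cause a fresh start. -/
theorem small_le {j : ℕ} (hj : j < n) (hb : ¬ IsBig Δ R (epoch Δ R n) j) :
    Δ * R j ≤ prefixLoad R n := by
  by_cases hjt : j < epoch Δ R n
  · have h : ¬ prefixLoad R (epoch Δ R n) ≤ Δ * R j := fun h => hb ⟨hjt, h⟩
    exact (not_le.1 h).le.trans (prefixLoad_mono epoch_le)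
  · have h : ¬ Renews Δ R j := fun h => hjt (lt_epoch_iff.2 ⟨hj, j, hj, le_rfl, h⟩)
    rw [Renews, not_le] at h
    exact h.le.trans (prefixLoad_mono hj)

section Fixed

variable {t : ℕ}

open scoped Classical in
/-- The small jobs below `n`. -/
noncomputable def smallJobs (Δ : ℕ) (R : ℕ → ℕ) (t n : ℕ) : Finset ℕ :=
  {j ∈ range n | ¬ IsBig Δ R t j}

theorem mem_smallJobs {j : ℕ} : j ∈ smallJobs Δ R t n ↔ j < n ∧ ¬ IsBig Δ R t j := by
  classical
  rw [smallJobs, mem_filter, mem_range]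

theorem bigJobs_eq (ht : t ≤ n) : bigJobs Δ R t t = bigJobs Δ R t n := by
  ext j
  rw [mem_bigJobs, mem_bigJobs]
  exact ⟨fun h => ⟨by omega, h.2⟩, fun h => ⟨h.2.1, h.2⟩⟩

theorem disjoint_big_small : Disjoint (bigJobs Δ R t n) (smallJobs Δ R t n) := by
  rw [disjoint_left]
  intro j h1 h2
  exact (mem_smallJobs.1 h2).2 (mem_bigJobs.1 h1).2

theorem big_union_small : bigJobs Δ R t n ∪ smallJobs Δ R t n = range n := by
  ext j
  rw [mem_union, mem_bigJobs, mem_smallJobs, mem_range]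
  tauto

theorem card_big_add_card_small (ht : t ≤ n) :
    #(bigJobs Δ R t t) + #(smallJobs Δ R t n) = n := by
  rw [bigJobs_eq ht, ← card_union_of_disjoint disjoint_big_small, big_union_small, card_range]

theorem sum_big_add_sum_small (ht : t ≤ n) :
    ∑ j ∈ bigJobs Δ R t t, R j + ∑ j ∈ smallJobs Δ R t n, R j = prefixLoad R n := by
  rw [bigJobs_eq ht, ← sum_union disjoint_big_small, big_union_small, prefixLoad]

theorem sum_smallStat : ∑ i ∈ range n, smallStat Δ R t n i = ∑ j ∈ smallJobs Δ R t n, R j := by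
  classical
  rw [smallJobs, ← sumBelow_eq_sum]
  exact sum_orderStat

theorem smallStat_pos_iff (hR : ∀ j < n, 0 < R j) {i : ℕ} :
    smallStat Δ R t n i ≠ 0 ↔ i < #(smallJobs Δ R t n) := by
  classical
  rw [← Nat.pos_iff_ne_zero, ← Nat.succ_le_iff, smallStat, le_orderStat_iff (by omega), countGe,
    countBelow_eq_card, smallJobs]
  have : {j ∈ range n | ¬ IsBig Δ R t j ∧ 1 ≤ R j} = {j ∈ range n | ¬ IsBig Δ R t j} :=
    filter_congr fun j hj => by
      have := hR j (mem_range.1 hj)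
      exact ⟨fun h => h.1, fun h => ⟨h, this⟩⟩
  rw [this]

/-- The set of ranks on the second machine. -/
def RightRank (N k Δ : ℕ) (R : ℕ → ℕ) (t n : ℕ) : ℕ → Prop :=
  RankRight (capacity N k Δ R t) (lead N k Δ R t n) (heavyCount N k Δ R t) (lightCount N k Δ R t)

theorem sumBelow_rightAt (ht : t ≤ n) (f : ℕ → ℕ) : sumBelow (RightAt N k Δ R t n) f n =
    ∑ j ∈ bigJobs Δ R t t \ heavyJobs N k Δ R t, f j +
      sumBelow (fun j => ¬ IsBig Δ R t j ∧ SmallRight N k Δ R t n j) f n := by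
  classical
  rw [sumBelow_eq_sum, sumBelow_eq_sum, ← lightJobs_eq, ← sum_union]
  · congr 1
    ext j
    rw [mem_union, mem_filter, mem_filter, mem_filter, mem_range, mem_range, RightAt]
    have : IsBig Δ R t j → j < t := fun h => h.1
    constructor
    · rintro ⟨h1, h2 | h2⟩
      · exact Or.inl ⟨this h2.1, h2⟩
      · exact Or.inr ⟨h1, h2⟩
    · rintro (⟨h1, h2⟩ | ⟨h1, h2⟩)
      · exact ⟨by omega, Or.inl h2⟩
      · exact ⟨h1, Or.inr h2⟩
  · rw [disjoint_left]
    intro j h1 h2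
    exact (mem_filter.1 h2).2.1 (mem_filter.1 h1).2.1

theorem sum_rightAt (ht : t ≤ n) : sumBelow (RightAt N k Δ R t n) R n =
    lightLoad N k Δ R t + sumBelow (RightRank N k Δ R t n) (smallStat Δ R t n) n := by
  rw [sumBelow_rightAt ht, ← lightLoad_eq]
  congr 1
  exact sum_chosen (RightRank N k Δ R t n) (fun v => v) rfl

/-- Both sides complement `sum_rightAt` to the same total, namely big jobs plus all small order
statistics. -/
theorem sum_not_rightAt (ht : t ≤ n) : sumBelow (fun j => ¬ RightAt N k Δ R t n j) R n =
    heavyLoad N k Δ R t +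
      sumBelow (fun i => ¬ RightRank N k Δ R t n i) (smallStat Δ R t n) n := by
  have h1 := sumBelow_add_not (RightAt N k Δ R t n) R n
  have h2 := sumBelow_add_not (RightRank N k Δ R t n) (smallStat Δ R t n) n
  have h3 := heavyLoad_add_lightLoad (N := N) (k := k) (Δ := Δ) (R := R) (t := t)
  have h4 := sum_big_add_sum_small (Δ := Δ) (R := R) ht
  rw [sum_rightAt ht] at h1
  rw [sum_smallStat] at h2
  rw [prefixLoad] at h4
  omega

theorem sumBelow_one (P : ℕ → Prop) (n : ℕ) : sumBelow P (fun _ => 1) n = countBelow P n := rfl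

theorem count_rightAt (ht : t ≤ n) (hR : ∀ j < n, 0 < R j) :
    countBelow (RightAt N k Δ R t n) n =
      lightCount N k Δ R t + countBelow (RightRank N k Δ R t n) #(smallJobs Δ R t n) := by
  classical
  rw [← sumBelow_one, sumBelow_rightAt ht, lightCount_eq, card_eq_sum_ones]
  congr 1
  have h := sum_chosen (J := fun j => ¬ IsBig Δ R t j) (R := R) (n := n) (RightRank N k Δ R t n)
    (fun v => if v = 0 then 0 else 1) rfl
  have hc : #(smallJobs Δ R t n) ≤ n := (card_filter_le _ _).trans (card_range n).le
  calc sumBelow (fun j => ¬ IsBig Δ R t j ∧ SmallRight N k Δ R t n j) (fun _ => 1) n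
      = _ := sumBelow_congr (fun _ _ => Iff.rfl) fun j hj => (if_neg (hR j hj).ne').symm
    _ = _ := h
    _ = countBelow (RightRank N k Δ R t n) #(smallJobs Δ R t n) := by
      rw [sumBelow, countBelow]
      symm
      refine (sum_congr rfl fun i hi => ?_).trans
        (sum_subset (range_subset_range.2 hc) fun i _ hi => ?_)
      · have := (smallStat_pos_iff (Δ := Δ) (t := t) hR).2 (mem_range.1 hi)
        rw [smallStat] at this
        rw [if_neg this]
      · have := mt (smallStat_pos_iff (Δ := Δ) (t := t) hR).1 (by simpa using hi)
        rw [not_not, smallStat] at this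
        rw [if_pos this, ite_self]

theorem smallStat_anti : Antitone (smallStat Δ R t n) := fun _ _ h => orderStat_anti h

theorem smallStat_eq_zero {i : ℕ} (h : n ≤ i) : smallStat Δ R t n i = 0 := orderStat_eq_zero h

/-- Each big job takes at least a fraction 1/Δ of the load that all of them share. -/
theorem card_big_le (hR : ∀ j < t, 0 < R j) : #(bigJobs Δ R t t) ≤ Δ := by
  rcases Nat.eq_zero_or_pos t with rfl | ht
  · exact (card_bigJobs_le).trans (Nat.zero_le _)
  have hS : 0 < prefixLoad R t := sum_pos (fun j hj => hR j (mem_range.1 hj)) ⟨0, mem_range.2 ht⟩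
  refine Nat.le_of_mul_le_mul_right (c := prefixLoad R t) ?_ hS
  calc #(bigJobs Δ R t t) * prefixLoad R t = ∑ j ∈ bigJobs Δ R t t, prefixLoad R t := by
        rw [sum_const, smul_eq_mul]
    _ ≤ ∑ j ∈ bigJobs Δ R t t, Δ * R j := sum_le_sum fun j hj => (mem_bigJobs.1 hj).2.2
    _ ≤ Δ * prefixLoad R t := by
        rw [← mul_sum]
        exact Nat.mul_le_mul_left _ (sum_le_sum_of_subset fun j hj =>
          mem_range.2 (mem_bigJobs.1 hj).1)

/-- A schedule of all jobs has at least the cost of the big jobs on one machine plus that of the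
smallest small jobs that do not fit on the other. -/
theorem heavyLoad_add_tail_le (ht : t ≤ n) (hn : n ≤ 2 * k) {X : Finset ℕ} (hX : X ⊆ range n)
    (h1 : #X ≤ k) (h2 : #(range n \ X) ≤ k) {c : ℕ} (hc1 : ∑ j ∈ X, R j ≤ c)
    (hc2 : ∑ j ∈ range n \ X, R j ≤ c) :
    64 * N * (heavyLoad N k Δ R t + tailLoad (smallStat Δ R t n) n k) ≤
      64 * N * c + prefixLoad R t := by
  have hbk : #(bigJobs Δ R t t) ≤ 2 * k := by
    have := card_big_add_card_small (Δ := Δ) (R := R) ht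
    omega
  -- The other machine holds at most `k` small jobs, hence at most the `k` largest; at least the
  -- tail from rank `k` on is left for `Y`.
  have key : ∀ Y : Finset ℕ, Y ⊆ range n → #(range n \ Y) ≤ k →
      ∑ j ∈ bigJobs Δ R t t ∩ Y, R j + tailLoad (smallStat Δ R t n) n k ≤ ∑ j ∈ Y, R j := by
    intro Y hY hYk
    have e1 : ∑ j ∈ smallJobs Δ R t n \ Y, R j ≤ ∑ i ∈ range k, smallStat Δ R t n i :=
      sum_le_sum_orderStat (fun j hj => mem_smallJobs.1 (mem_sdiff.1 hj).1)
        ((card_le_card fun j hj => by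
          rw [mem_sdiff] at hj ⊢
          exact ⟨mem_range.2 (mem_smallJobs.1 hj.1).1, hj.2⟩).trans hYk)
    have e2 : ∑ j ∈ smallJobs Δ R t n \ Y, R j + ∑ j ∈ smallJobs Δ R t n ∩ Y, R j =
        ∑ i ∈ range n, smallStat Δ R t n i := by
      rw [sum_smallStat, add_comm, sum_inter_add_sum_sdiff]
    have e3 : ∑ i ∈ range k, smallStat Δ R t n i + tailLoad (smallStat Δ R t n) n k =
        ∑ i ∈ range n, smallStat Δ R t n i := by
      rw [tailLoad]
      rcases le_total k n with h | h
      · rw [sum_range_add_sum_Ico _ h]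
      · rw [Ico_eq_empty_of_le h, sum_empty, add_zero]
        exact (sum_range_extend (fun _ => smallStat_eq_zero) h).symm
    have e4 : ∑ j ∈ bigJobs Δ R t t ∩ Y, R j + ∑ j ∈ smallJobs Δ R t n ∩ Y, R j =
        ∑ j ∈ Y, R j := by
      rw [bigJobs_eq ht, ← sum_union (disjoint_big_small.mono inter_subset_left inter_subset_left),
        ← union_inter_distrib_right, big_union_small, inter_eq_right.2 hY]
    omega
  have k1 := key X hX h2
  have k2 := key (range n \ X) sdiff_subset (by rwa [Finset.sdiff_sdiff_eq_self hX])
  have e : bigJobs Δ R t t \ (bigJobs Δ R t t ∩ X) = bigJobs Δ R t t ∩ (range n \ X) := by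
    ext j
    rw [mem_sdiff, mem_inter, mem_inter, mem_sdiff, mem_bigJobs, mem_range]
    constructor
    · rintro ⟨h3, h4⟩
      exact ⟨h3, by omega, fun h5 => h4 ⟨h3, h5⟩⟩
    · rintro ⟨h3, h4, h5⟩
      exact ⟨h3, fun h6 => h5 h6.2⟩
  obtain ⟨c', hc'⟩ : ∃ c', c' = c - tailLoad (smallStat Δ R t n) n k := ⟨_, rfl⟩
  -- After subtracting the tail, `c'` bounds the big jobs on both sides of the given schedule, so
  -- near optimality applies with `c'`.
  have h := (loads_le (N := N) (k := k) hbk (X := bigJobs Δ R t t ∩ X) inter_subset_left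
    ((card_le_card inter_subset_right).trans h1)
    (by rw [e]; exact (card_le_card inter_subset_right).trans h2) (c := c')
    (by omega) (by rw [e]; omega)).1
  have hcc : c' + tailLoad (smallStat Δ R t n) n k = c := by omega
  rw [mul_add, ← hcc, mul_add]
  omega

end Fixed

theorem right_feasible (hn : n ≤ 2 * k) (hR : ∀ j < n, 0 < R j) :
    countBelow (Right N k R n) n ≤ k ∧ countBelow (fun j => ¬ Right N k R n j) n ≤ k := by
  set Δ := granularity N k with hΔ
  set t := epoch Δ R n with ht
  have htn : t ≤ n := epoch_le
  have hc := card_big_add_card_small (Δ := Δ) (R := R) htn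
  obtain ⟨ha, hb⟩ := counts_le (N := N) (k := k) (Δ := Δ) (R := R) (t := t) (by omega)
  have hab := heavyCount_add_lightCount (N := N) (k := k) (Δ := Δ) (R := R) (t := t)
  have h := split_feasible ha hb (c := #(smallJobs Δ R t n)) (by omega)
    (T := lead N k Δ R t n) (by rw [lead, capacity]; exact cutoff_le)
  have e1 : countBelow (Right N k R n) n = lightCount N k Δ R t +
      countBelow (RightRank N k Δ R t n) #(smallJobs Δ R t n) := count_rightAt htn hR
  have e2 := countBelow_add_not (Right N k R n) n
  have e3 : countBelow (RankRight (k - max (heavyCount N k Δ R t) (lightCount N k Δ R t))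
      (lead N k Δ R t n) (heavyCount N k Δ R t) (lightCount N k Δ R t)) #(smallJobs Δ R t n) =
      countBelow (RightRank N k Δ R t n) #(smallJobs Δ R t n) := rfl
  simp only [e3] at h
  have := countBelow_le (RightRank N k Δ R t n) #(smallJobs Δ R t n)
  omega

/-- The cost of the schedule exceeds that of any feasible one by at most a fraction of the total
size of all jobs. -/
theorem right_approx (hN : 0 < N) (hn : n ≤ 2 * k) (hR : ∀ j < n, 0 < R j) {X : Finset ℕ}
    (hX : X ⊆ range n) (h1 : #X ≤ k) (h2 : #(range n \ X) ≤ k) {c : ℕ} (hc1 : ∑ j ∈ X, R j ≤ c)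
    (hc2 : ∑ j ∈ range n \ X, R j ≤ c) :
    4 * N * sumBelow (Right N k R n) R n ≤ 4 * N * c + prefixLoad R n ∧
      4 * N * sumBelow (fun j => ¬ Right N k R n j) R n ≤ 4 * N * c + prefixLoad R n := by
  set Δ := granularity N k with hΔ
  set t := epoch Δ R n with ht
  have htn : t ≤ n := epoch_le
  have hcard := card_big_add_card_small (Δ := Δ) (R := R) htn
  have hbk : #(bigJobs Δ R t t) ≤ 2 * k := by omega
  have e1 : sumBelow (Right N k R n) R n = _ := sum_rightAt htn
  have e2 : sumBelow (fun j => ¬ Right N k R n j) R n = _ := sum_not_rightAt htn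
  have hSt : prefixLoad R t ≤ prefixLoad R n := prefixLoad_mono htn
  set S := prefixLoad R n with hS
  set L₁ := heavyLoad N k Δ R t with hL₁
  set L₂ := lightLoad N k Δ R t with hL₂
  set s := smallStat Δ R t n with hs
  set m := RightRank N k Δ R t n with hm
  have hanti : Antitone s := smallStat_anti
  have h0 : ∀ i, n ≤ i → s i = 0 := fun i => smallStat_eq_zero
  have hssum : ∑ i ∈ range n, s i ≤ S := by
    rw [sum_smallStat, hS, ← sum_big_add_sum_small (Δ := Δ) (R := R) htn]
    exact Nat.le_add_left _ _
  -- Each of the cases below has an error of at most `3 * S` at scale `64 * N`; dividing by 16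
  -- leaves less than `S`.
  suffices h : 64 * N * (L₂ + sumBelow m s n) ≤ 64 * N * c + 3 * S ∧
      64 * N * (L₁ + sumBelow (fun i => ¬ m i) s n) ≤ 64 * N * c + 3 * S by
    rw [e1, e2]
    constructor
    · nlinarith [h.1]
    · nlinarith [h.2]
  have hmain := heavyLoad_add_tail_le (N := N) (Δ := Δ) (R := R) htn hn hX h1 h2 hc1 hc2
  rw [mul_add, ← hL₁, ← hs] at hmain
  by_cases hk : k ≤ 8192 * (N * N)
  · have hΔ' : Δ = 1048576 * (N * N * N) := if_pos hk
    -- At most `2 * k ≤ 16384 * N ^ 2` small jobs, each of size at most `S / Δ`; this is why the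
    -- constant in Δ is 1048576 = 16384 * 64. Hence the placement of the small jobs is irrelevant
    -- here.
    have hsm : 64 * N * ∑ i ∈ range n, s i ≤ S := by
      rw [sum_smallStat]
      refine le_of_mul_le_mul_left ?_ (by positivity : 0 < 16384 * (N * N))
      calc 16384 * (N * N) * (64 * N * ∑ j ∈ smallJobs Δ R t n, R j)
          = ∑ j ∈ smallJobs Δ R t n, Δ * R j := by
            rw [hΔ', ← mul_sum]
            ring
        _ ≤ ∑ j ∈ smallJobs Δ R t n, S := sum_le_sum fun j hj =>
            small_le (mem_smallJobs.1 hj).1 (mem_smallJobs.1 hj).2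
        _ = #(smallJobs Δ R t n) * S := by rw [sum_const, smul_eq_mul]
        _ ≤ 16384 * (N * N) * S := Nat.mul_le_mul_right _ (by omega)
    have hsplit := sumBelow_add_not m s n
    have hle1 := Nat.mul_le_mul_left (64 * N)
      (show sumBelow m s n ≤ ∑ i ∈ range n, s i by omega)
    have hle2 := Nat.mul_le_mul_left (64 * N)
      (show sumBelow (fun i => ¬ m i) s n ≤ ∑ i ∈ range n, s i by omega)
    have e : bigJobs Δ R t t \ (bigJobs Δ R t t ∩ X) ⊆ range n \ X := by
      intro j hj
      rw [mem_sdiff, mem_inter, mem_bigJobs] at hj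
      rw [mem_sdiff, mem_range]
      exact ⟨by omega, fun h => hj.2 ⟨hj.1, h⟩⟩
    have hl := (loads_le (N := N) (k := k) hbk (X := bigJobs Δ R t t ∩ X) inter_subset_left
      ((card_le_card inter_subset_right).trans h1) ((card_le_card e).trans h2) (c := c)
      ((sum_le_sum_of_subset inter_subset_right).trans hc1)
      ((sum_le_sum_of_subset e).trans hc2))
    rw [← hL₁, ← hL₂] at hl
    rw [mul_add, mul_add]
    omega
  · have hΔ' : Δ = 64 * N := if_neg hk
    have hf : #(bigJobs Δ R t t) ≤ 64 * N := hΔ' ▸ card_big_le fun j hj => hR j (by omega)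
    have hab := heavyCount_add_lightCount (N := N) (k := k) (Δ := Δ) (R := R) (t := t)
    obtain ⟨κ, hκ⟩ : ∃ κ, κ = capacity N k Δ R t := ⟨_, rfl⟩
    have hκ' : κ = k - max (heavyCount N k Δ R t) (lightCount N k Δ R t) := hκ
    have hmx : max (heavyCount N k Δ R t) (lightCount N k Δ R t) ≤ #(bigJobs Δ R t t) := by omega
    have hNN : N ≤ N * N := Nat.le_mul_self N
    -- The big jobs block at most `64 * N` of more than `8192 * N ^ 2` slots.
    have hκN : 4096 * (N * N) ≤ κ := by omega
    have hsκ : 4096 * (N * N) * s κ ≤ S := by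
      calc 4096 * (N * N) * s κ ≤ κ * s κ := Nat.mul_le_mul_right _ hκN
        _ = ∑ i ∈ range κ, s κ := by rw [sum_const, card_range, smul_eq_mul]
        _ ≤ ∑ i ∈ range κ, s i := sum_le_sum fun i hi => hanti (mem_range.1 hi).le
        _ ≤ ∑ i ∈ range n, s i := by
            rcases le_total κ n with h | h
            · exact sum_le_sum_of_subset (range_subset_range.2 h)
            · exact (sum_range_extend h0 h).ge
        _ ≤ S := hssum
    -- The ranks below `κ` are no smaller than `s κ`, so `s κ` is at most `S / (64 * N) ^ 2`, and
    -- `64 * N` ranks beyond are negligible.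
    have hfew : ∀ A : Finset ℕ, (∀ i ∈ A, κ ≤ i) → #A ≤ 64 * N →
        64 * N * ∑ i ∈ A, s i ≤ S := by
      intro A hA hAc
      calc 64 * N * ∑ i ∈ A, s i ≤ 64 * N * (#A * s κ) := by
            refine Nat.mul_le_mul_left _ ?_
            have := sum_le_card_nsmul A s (s κ) fun i hi => hanti (hA i hi)
            rwa [smul_eq_mul] at this
        _ ≤ 64 * N * (64 * N * s κ) := by gcongr
        _ = 4096 * (N * N) * s κ := by ring
        _ ≤ S := hsκ
    -- The number of ranks from `2 * κ` on is at most the difference of the numbers of big jobs on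
    -- the two machines.
    have hov : 64 * N * tailLoad s n (2 * κ) ≤ S := by
      have : tailLoad s n (2 * κ) = ∑ i ∈ Ico (2 * κ) #(smallJobs Δ R t n), s i := by
        rw [tailLoad]
        symm
        refine sum_subset (Ico_subset_Ico_right (by omega)) fun i hi hi' => ?_
        rw [mem_Ico] at hi hi'
        by_contra hne
        have := (smallStat_pos_iff hR).1 hne
        omega
      rw [this]
      refine hfew _ (fun i hi => ?_) ?_
      · rw [mem_Ico] at hi
        omega
      · rw [Nat.card_Ico]
        omega
    have htail : 64 * N * tailLoad s n κ ≤ 64 * N * tailLoad s n k + S := by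
      have h3 : tailLoad s n κ ≤ ∑ i ∈ Ico κ k, s i + tailLoad s n k := by
        rw [tailLoad, tailLoad]
        refine le_trans (sum_le_sum_of_subset (t := Ico κ k ∪ Ico k n) fun i hi => ?_)
          (sum_union_inter (f := s) ▸ Nat.le_add_right _ _)
        rw [mem_Ico] at hi
        rw [mem_union, mem_Ico, mem_Ico]
        omega
      have h4 := hfew (Ico κ k) (fun i hi => (mem_Ico.1 hi).1) (by rw [Nat.card_Ico]; omega)
      have h5 := Nat.mul_le_mul_left (64 * N) h3
      rw [mul_add] at h5
      omega
    have hmT : m = RankRight κ (cutoff (64 * N) κ n (L₁ - L₂) s) (heavyCount N k Δ R t)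
        (lightCount N k Δ R t) := by rw [hκ]; rfl
    rw [hmT]
    rcases le_or_gt (64 * N * (L₁ - L₂))
      (∑ i ∈ range (cutoff (64 * N) κ n (L₁ - L₂) s), gain (64 * N) κ n s i) with hbal | hbal
    · have hs0 : 64 * N * s 0 ≤ S := by
        rcases Nat.eq_zero_or_pos (s 0) with h | h
        · rw [h]
          omega
        · have : s 0 ≤ S / (64 * N) := by
            refine orderStat_le fun j hj hJ => ?_
            rw [Nat.le_div_iff_mul_le (by omega), mul_comm, ← hΔ']
            exact small_le hj hJ
          rw [mul_comm]
          exact (Nat.le_div_iff_mul_le (by omega)).1 this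
      have hll := (lightLoad_le (N := N) hbk).trans (Nat.add_le_add_left hSt _)
      rw [← hL₁, ← hL₂] at hll
      have hb := balanced_split (a := heavyCount N k Δ R t) (b := lightCount N k Δ R t) hanti h0
        (by omega) hll hs0 hov hssum hbal
      rw [← hmT] at hb ⊢
      have hsum : L₂ + sumBelow m s n + (L₁ + sumBelow (fun i => ¬ m i) s n) = S := by
        rw [← e1, ← e2, sumBelow_add_not, hS, prefixLoad]
      -- Equal loads are at most `c`. A difference of at most `4 * S` between the scaled loads puts
      -- each within `2 * S` of the average.
      have hSc : S ≤ 2 * c := by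
        have := sum_sdiff (f := R) hX
        rw [hS, prefixLoad]
        omega
      have h3 := Nat.mul_le_mul_left (64 * N) hSc
      have h4 := congrArg (fun x => 64 * N * x) hsum
      simp only [mul_add] at h4 hb ⊢
      have h5 : 64 * N * (2 * c) = 2 * (64 * N * c) := by ring
      omega
    · have hu := unbalanced_split (a := heavyCount N k Δ R t) (b := lightCount N k Δ R t) hanti h0
        (by omega) hbal
      have u1 := Nat.mul_le_mul_left (64 * N) hu.1
      have u2 := Nat.mul_le_mul_left (64 * N) hu.2
      simp only [mul_add] at u1 u2 ⊢
      omega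

end

/-! ### Migration -/

/-- Numbers with a relative gap between any two of them have a geometrically bounded sum. -/
theorem sum_le_of_gap {G : ℕ} (hG : 0 < G) (V : Finset ℕ)
    (hV : ∀ v ∈ V, ∀ w ∈ V, v < w → w ≤ G * (w - v)) {B : ℕ} (hB : ∀ v ∈ V, v ≤ B) :
    ∑ v ∈ V, v ≤ G * B := by
  induction V using Finset.induction_on_max generalizing B with
  | empty => simp
  | insert a V ha ih =>
    rw [sum_insert fun h => lt_irrefl _ (ha a h)]
    have haB := Nat.mul_le_mul_left G (hB a (mem_insert_self _ _))
    rcases V.eq_empty_or_nonempty with rfl | hne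
    · have := Nat.le_mul_of_pos_left a hG
      rw [sum_empty]
      omega
    · have h1 := ih (fun v hv w hw => hV v (mem_insert_of_mem hv) w (mem_insert_of_mem hw))
        (B := V.max' hne) fun v hv => le_max' V v hv
      have hm := max'_mem V hne
      have h2 := hV _ (mem_insert_of_mem hm) a (mem_insert_self _ _) (ha _ hm)
      have h3 : G * (V.max' hne) + G * (a - V.max' hne) = G * a := by
        rw [← mul_add, Nat.add_sub_cancel' (ha _ hm).le]
      omega

section Insertion

variable {s s' : ℕ → ℕ} {n x Λ κ D : ℕ}

/-- The second decreasing sequence arises from the first by inserting `x`. -/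
structure IsInsertion (s s' : ℕ → ℕ) (n x : ℕ) : Prop where
  anti : Antitone s
  anti' : Antitone s'
  eq_zero : ∀ i, n ≤ i → s i = 0
  eq_zero' : ∀ i, n + 1 ≤ i → s' i = 0
  head : s' 0 = max (s 0) x
  succ : ∀ i, s' (i + 1) = max (s (i + 1)) (min x (s i))

theorem IsInsertion.le (h : IsInsertion s s' n x) (i : ℕ) : s i ≤ s' i := by
  cases i with
  | zero => rw [h.head]; exact le_max_left _ _
  | succ i => rw [h.succ]; exact le_max_left _ _

theorem IsInsertion.le_of_ne (h : IsInsertion s s' n x) {i : ℕ} (hi : s i < s' i) : s' i ≤ x := by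
  cases i with
  | zero => rw [h.head] at *; omega
  | succ i => rw [h.succ] at *; omega

theorem IsInsertion.last_le (h : IsInsertion s s' n x) : s' n ≤ x := by
  have h1 := h.le_of_ne (i := n)
  have h2 := h.eq_zero n le_rfl
  omega

/-- The first `t + 1` ranks gain `x` and lose whatever is pushed out at the end, which is the
smaller of `x` and `s t`. -/
theorem IsInsertion.sum_add_min (h : IsInsertion s s' n x) (t : ℕ) :
    ∑ i ∈ range (t + 1), s' i + min x (s t) = ∑ i ∈ range (t + 1), s i + x := by
  induction t with
  | zero =>
    simp only [zero_add, sum_range_one, h.head]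
    omega
  | succ t ih =>
    rw [sum_range_succ, sum_range_succ _ (t + 1), h.succ]
    have : s (t + 1) ≤ s t := h.anti (Nat.le_succ t)
    omega

theorem IsInsertion.sum_sub_le (h : IsInsertion s s' n x) (A : Finset ℕ) :
    ∑ i ∈ A, (s' i - s i) ≤ x := by
  obtain ⟨m, hm⟩ := A.exists_nat_subset_range
  refine (sum_le_sum_of_subset (hm.trans (range_subset_range.2 (show m ≤ m + 1 by omega)))).trans ?_
  have h1 := h.sum_add_min m
  have h2 : ∑ i ∈ range (m + 1), (s' i - s i) + ∑ i ∈ range (m + 1), s i =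
      ∑ i ∈ range (m + 1), s' i := by
    rw [← sum_add_distrib]
    exact sum_congr rfl fun i _ => Nat.sub_add_cancel (h.le i)
  omega

theorem IsInsertion.gain_le (h : IsInsertion s s' n x) (i : ℕ) :
    gain Λ κ (n + 1) s' i ≤ gain Λ κ n s i + (Λ + 1) * (s' i - s i) := by
  rw [gain_eq h.eq_zero, gain_eq h.eq_zero']
  have h1 := h.le i
  have h2 := h.le (2 * κ - 1 - i)
  rw [← Nat.add_min_add_right]
  refine min_le_min ?_ ?_
  · calc Λ * s' i = Λ * s i + Λ * (s' i - s i) := by rw [← mul_add, Nat.add_sub_cancel' h1]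
      _ ≤ _ := by gcongr; omega
  · rw [← mul_add]
    gcongr
    omega

theorem IsInsertion.le_gain (h : IsInsertion s s' n x) (i : ℕ) : gain Λ κ n s i ≤
    gain Λ κ (n + 1) s' i + (Λ + 1) * (s' (2 * κ - 1 - i) - s (2 * κ - 1 - i)) := by
  rw [gain_eq h.eq_zero, gain_eq h.eq_zero']
  have h1 := h.le i
  have h2 := h.le (2 * κ - 1 - i)
  rw [← Nat.add_min_add_right]
  refine min_le_min ?_ ?_
  · exact (Nat.mul_le_mul_left _ h1).trans (Nat.le_add_right _ _)
  · rw [← mul_add]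
    gcongr
    omega

theorem IsInsertion.sum_gain_le (h : IsInsertion s s' n x) (t : ℕ) :
    ∑ i ∈ range t, gain Λ κ (n + 1) s' i ≤ ∑ i ∈ range t, gain Λ κ n s i + (Λ + 1) * x := by
  refine (sum_le_sum fun i _ => h.gain_le i).trans ?_
  rw [sum_add_distrib, ← mul_sum]
  gcongr
  exact h.sum_sub_le _

theorem IsInsertion.le_sum_gain (h : IsInsertion s s' n x) {t : ℕ} (ht : t ≤ κ) :
    ∑ i ∈ range t, gain Λ κ n s i ≤ ∑ i ∈ range t, gain Λ κ (n + 1) s' i + (Λ + 1) * x := by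
  refine (sum_le_sum fun i _ => h.le_gain i).trans ?_
  rw [sum_add_distrib, ← mul_sum]
  gcongr
  rw [← sum_image (s := range t) (g := fun i => 2 * κ - 1 - i) (f := fun i => s' i - s i)]
  · exact h.sum_sub_le _
  · intro i hi j hj hij
    simp only [coe_range, Set.mem_Iio] at hi hj
    dsimp only at hij
    omega

/-- A decrease of a gain is possible only for ranks of moderate size. -/
theorem IsInsertion.le_of_gain_lt (h : IsInsertion s s' n x) {i : ℕ}
    (hi : gain Λ κ (n + 1) s' i < gain Λ κ n s i) : s' i ≤ (Λ + 1) * x := by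
  have h3 := h.le_gain (Λ := Λ) (κ := κ) i
  rw [gain_eq h.eq_zero, gain_eq h.eq_zero'] at hi h3
  have h1 := Nat.mul_le_mul_left Λ (h.le i)
  -- The mirror rank must have grown, and ranks that grow end up at most `x`. For larger `s' i` the
  -- cap `Λ * s' i` in the gain would be active, and the cap never decreases.
  have hx : s' (2 * κ - 1 - i) ≤ x := by
    refine h.le_of_ne (lt_of_not_ge fun hge => ?_)
    rw [Nat.sub_eq_zero_of_le hge, mul_zero] at h3
    omega
  have h4 : (Λ + 1) * (s' i - s' (2 * κ - 1 - i)) ≤ Λ * s' i := by omega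
  have h5 : (Λ + 1) * s' i ≤ (Λ + 1) * (s' i - s' (2 * κ - 1 - i)) +
      (Λ + 1) * s' (2 * κ - 1 - i) := by
    rw [← mul_add]
    gcongr
    omega
  have h6 : (Λ + 1) * s' i = Λ * s' i + s' i := by ring
  have h7 := Nat.mul_le_mul_left (Λ + 1) hx
  omega

theorem gain_le_mul (i : ℕ) : gain Λ κ n s i ≤ Λ * s i := min_le_left _ _

/-- Both cutoffs aim at the same target `Λ * D`, and an insertion changes prefix sums of gains by at
most `(Λ + 1) * x`. What remains is the overshoot by the last rank, which is controlled by
comparison with an earlier rank whose gain has changed and whose size is therefore at most `(Λ + 1)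
* x`. -/
theorem IsInsertion.sum_gain_cutoff (h : IsInsertion s s' n x) {T T' : ℕ}
    (hT : T = cutoff Λ κ n D s) (hT' : T' = cutoff Λ κ (n + 1) D s') :
    ∑ i ∈ Ico (min T T') (max T T'), gain Λ κ (n + 1) s' i ≤ (Λ + 1) * (Λ + 1) * x := by
  have e : (Λ + 1) * (Λ + 1) * x = (Λ + 1) * x + Λ * ((Λ + 1) * x) := by ring
  have e' : Λ * x ≤ Λ * ((Λ + 1) * x) :=
    Nat.mul_le_mul_left _ (Nat.le_mul_of_pos_left x (Nat.succ_pos _))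
  have hTκ : T ≤ κ := hT ▸ cutoff_le
  have hTκ' : T' ≤ κ := hT' ▸ cutoff_le
  have hTn : T ≤ n := hT ▸ countBelow_le _ _
  have hTn' : T' ≤ n + 1 := hT' ▸ countBelow_le _ _
  rcases lt_trichotomy T T' with hlt | heq | hgt
  · rw [min_eq_left hlt.le, max_eq_right hlt.le]
    obtain ⟨m, rfl⟩ : ∃ m, T' = m + 1 := ⟨T' - 1, by omega⟩
    have hm := lt_cutoff_iff.1 (show m < cutoff Λ κ (n + 1) D s' by omega)
    have hnot : ¬ (T < n ∧ T < κ ∧ ∑ i ∈ range T, gain Λ κ n s i < Λ * D) := fun hh =>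
      (lt_cutoff_iff.2 hh).ne hT
    rw [sum_Ico_succ_top (by omega)]
    have hg := gain_le_mul (Λ := Λ) (κ := κ) (n := n + 1) (s := s') m
    rcases Nat.lt_or_ge T n with hn | hn
    · have hD : Λ * D ≤ ∑ i ∈ range T, gain Λ κ n s i := by
        by_contra hcon
        exact hnot ⟨hn, by omega, by omega⟩
      have h1 := sum_range_add_sum_Ico (gain Λ κ (n + 1) s') (show T ≤ m by omega)
      have h2 := h.le_sum_gain (Λ := Λ) hTκ
      -- The old prefix reached the target and the new one does not, so some gain dropped.
      obtain ⟨i, hi, hi'⟩ : ∃ i ∈ range T, gain Λ κ (n + 1) s' i < gain Λ κ n s i :=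
        exists_lt_of_sum_lt (by omega)
      have h3 := h.le_of_gain_lt hi'
      rw [mem_range] at hi
      have h4 : s' m ≤ s' i := h.anti' (by omega)
      have h5 := Nat.mul_le_mul_left Λ (h4.trans h3)
      omega
    -- The old cutoff used all ranks, so the only additional rank is the last one, of size at most
    -- `x`.
    · have hTm : T = m := by omega
      have hmn : m = n := by omega
      rw [hTm, Ico_self, sum_empty]
      rw [hmn] at hg ⊢
      have := Nat.mul_le_mul_left Λ h.last_le
      omega
  · rw [heq, min_self, max_self, Ico_self, sum_empty]
    exact Nat.zero_le _
  · rw [min_eq_right hgt.le, max_eq_left hgt.le]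
    obtain ⟨m, rfl⟩ : ∃ m, T = m + 1 := ⟨T - 1, by omega⟩
    have hm := lt_cutoff_iff.1 (show m < cutoff Λ κ n D s by omega)
    have hD : Λ * D ≤ ∑ i ∈ range T', gain Λ κ (n + 1) s' i := by
      by_contra hcon
      exact (lt_cutoff_iff.2 ⟨by omega, by omega, by omega⟩).ne hT'
    have h1 := sum_range_add_sum_Ico (gain Λ κ (n + 1) s') hgt.le
    have h2 := h.sum_gain_le (Λ := Λ) (κ := κ) (m + 1)
    rw [sum_range_succ (gain Λ κ n s)] at h2
    have h3 : ∑ i ∈ range T', gain Λ κ n s i ≤ ∑ i ∈ range m, gain Λ κ n s i :=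
      sum_le_sum_of_subset (range_subset_range.2 (by omega))
    -- The new prefix reaches the target and the old one did not, so some gain rose; that rank has
    -- size at most `x`.
    obtain ⟨i, hi, hi'⟩ : ∃ i ∈ range T', gain Λ κ n s i < gain Λ κ (n + 1) s' i :=
      exists_lt_of_sum_lt (by omega)
    rw [mem_range] at hi
    have h4 : s i < s' i := by
      by_contra hcon
      have := h.gain_le (Λ := Λ) (κ := κ) i
      rw [Nat.sub_eq_zero_of_le (not_lt.1 hcon), mul_zero] at this
      omega
    have h5 : s m ≤ s i := h.anti (by omega)
    have h6 := Nat.mul_le_mul_left Λ (h5.trans (h4.le.trans (h.le_of_ne h4)))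
    have h7 := gain_le_mul (Λ := Λ) (κ := κ) (n := n) (s := s) m
    omega

end Insertion

/-! ### Effect of a new job and of a new cutoff on the quotas -/

section

variable {J : ℕ → Prop} {R : ℕ → ℕ} {n : ℕ}

theorem countBelow_le_orderStat_and (m : ℕ → Prop) {v : ℕ} (hv : 0 < v) :
    countBelow (fun i => v ≤ orderStat J R n i ∧ m i) n = countBelow m (countGe J R n v) := by
  classical
  rw [countBelow_eq_card, countBelow_eq_card]
  congr 1
  ext i
  simp only [mem_filter, mem_range, le_orderStat_iff hv]
  have h : countGe J R n v ≤ n := countBelow_le _ _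
  constructor
  · exact fun h' => h'.2
  · exact fun h' => ⟨by omega, h'⟩

/-- The ranks of size `v` form an interval between two values of `countGe`, so a quota is a
difference of two counts of the fixed set `m` of ranks. -/
theorem countBelow_orderStat_eq (m : ℕ → Prop) {v : ℕ} (hv : 0 < v) :
    countBelow (fun i => orderStat J R n i = v ∧ m i) n + countBelow m (countGe J R n (v + 1)) =
      countBelow m (countGe J R n v) := by
  classical
  rw [← countBelow_le_orderStat_and m hv, ← countBelow_le_orderStat_and m (Nat.succ_pos v),
    countBelow_eq_card, countBelow_eq_card, countBelow_eq_card, ← card_union_of_disjoint]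
  · congr 1
    ext i
    simp only [mem_filter, mem_union]
    have : v ≤ orderStat J R n i ↔ orderStat J R n i = v ∨ v + 1 ≤ orderStat J R n i := by omega
    tauto
  · rw [disjoint_filter]
    intro i _ h h'
    omega

open scoped Classical in
/-- A new job changes the quotas for a fixed set of ranks by at most one in each class. -/
theorem quota_insert (m : ℕ → Prop) {v : ℕ} (hv : 0 < v) (hn : J n) {y y' : ℕ}
    (hy : y = countBelow (fun i => orderStat J R n i = v ∧ m i) n)
    (hy' : y' = countBelow (fun i => orderStat J R (n + 1) i = v ∧ m i) (n + 1)) :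
    (y - y') + (y' - y) ≤ if v ∈ (range (n + 1)).image R ∧ v ≤ R n then 1 else 0 := by
  have h1 := countBelow_orderStat_eq (J := J) (R := R) (n := n) m hv
  have h2 := countBelow_orderStat_eq (J := J) (R := R) (n := n + 1) m hv
  rw [← hy] at h1
  rw [← hy', countGe_succ, countGe_succ] at h2
  have hs := countBelow_succ m
  have e1 := hs (countGe J R n v)
  have e2 := hs (countGe J R n (v + 1))
  have hmono : countBelow m (countGe J R n (v + 1)) ≤ countBelow m (countGe J R n v) :=
    countBelow_mono (countGe_anti (Nat.le_succ v))
  split_ifs with h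
  · by_cases hv' : v + 1 ≤ R n
    · rw [if_pos ⟨hn, hv'⟩, if_pos ⟨hn, h.2⟩] at h2
      split_ifs at e1 e2 <;> omega
    · rw [if_neg fun hh => hv' hh.2, if_pos ⟨hn, h.2⟩] at h2
      rw [add_zero] at h2
      split_ifs at e1 <;> omega
  · by_cases hx : v ≤ R n
    · have hne : ∀ j < n + 1, R j ≠ v := fun j hj hjv =>
        h ⟨mem_image.2 ⟨j, mem_range.2 hj, hjv⟩, hx⟩
      have hv' : v + 1 ≤ R n := by
        have := hne n (by omega)
        omega
      have hc : countGe J R n v = countGe J R n (v + 1) := countBelow_congr fun j hj => by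
        have := hne j (by omega)
        have h3 : v ≤ R j ↔ v + 1 ≤ R j := by omega
        rw [h3]
      rw [if_pos ⟨hn, hv'⟩, if_pos ⟨hn, hx⟩, hc] at h2
      rw [hc] at h1
      omega
    · rw [if_neg fun hh => hx (by omega), if_neg fun hh => hx hh.2, add_zero, add_zero] at h2
      omega

theorem exists_orderStat_eq {i : ℕ} (hi : orderStat J R n i ≠ 0) :
    ∃ j < n, R j = orderStat J R n i := by
  classical
  have hpos := Nat.pos_of_ne_zero hi
  have h : i ∈ ({i' ∈ range n | orderStat J R n i' = orderStat J R n i} : Finset ℕ) := by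
    rw [mem_filter, mem_range]
    refine ⟨?_, rfl⟩
    by_contra hcon
    exact hi (orderStat_eq_zero (not_lt.1 hcon))
  have hc := card_pos.2 ⟨i, h⟩
  rw [card_orderStat_eq hpos, card_pos] at hc
  obtain ⟨j, hj⟩ := hc
  rw [mem_filter, mem_range] at hj
  exact ⟨j, hj.1, hj.2.2⟩

end

section

variable {s : ℕ → ℕ} {n κ T T' a b : ℕ}

-- Pairing each rank with its mirror: changing the cutoff only swaps pairs. The second factor
-- vanishes for a pair of equal sizes, so such a swap does not change any quota.
open scoped Classical in
theorem quota_sub_quota (h0 : ∀ i, n ≤ i → s i = 0) (hT : T ≤ κ) (hT' : T' ≤ κ) {v : ℕ}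
    (hv : 0 < v) : (quota κ T a b n s v : ℤ) - quota κ T' a b n s v =
      ∑ i ∈ range κ, ((if RankRight κ T a b i then 1 else 0) -
        (if RankRight κ T' a b i then 1 else 0)) *
        ((if s i = v then 1 else 0) - (if s (2 * κ - 1 - i) = v then 1 else 0)) := by
  have hq : ∀ T, (quota κ T a b n s v : ℤ) = ∑ i ∈ range (n + 2 * κ),
      (if s i = v then 1 else 0) * (if RankRight κ T a b i then 1 else 0) := by
    intro T
    rw [quota, countBelow]
    push_cast
    rw [sum_congr rfl (g := fun i => (if s i = v then (1 : ℤ) else 0) *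
      (if RankRight κ T a b i then 1 else 0))]
    · refine sum_subset (range_subset_range.2 (by omega)) fun i _ hi => ?_
      rw [h0 i (by simpa using hi), if_neg hv.ne, zero_mul]
    · intro i _
      by_cases h1 : s i = v <;> simp [h1]
  rw [hq, hq, ← sum_sub_distrib]
  have hsub : range (2 * κ) ⊆ range (n + 2 * κ) := range_subset_range.2 (by omega)
  rw [← sum_subset hsub, sum_range_two_mul_mirror]
  · refine sum_congr rfl fun i hi => ?_
    rw [mem_range] at hi
    have e1 := rankRight_mirror (a := a) (b := b) hT hi
    have e2 := rankRight_mirror (a := a) (b := b) hT' hi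
    by_cases h1 : RankRight κ T a b i <;> by_cases h2 : RankRight κ T' a b i <;>
      simp [e1, e2, h1, h2] <;> ring
  · intro i _ hi
    rw [mem_range, not_lt] at hi
    have : RankRight κ T a b i ↔ RankRight κ T' a b i := by
      rw [RankRight, RankRight]
      omega
    simp only [this, sub_self]

theorem abs_indicator_mul_le (p q : Prop) [Decidable p] [Decidable q] (x y v : ℕ) :
    |((if p then (1 : ℤ) else 0) - (if q then 1 else 0)) *
      ((if x = v then 1 else 0) - (if y = v then 1 else 0))| ≤
      if x = y then 0 else (if x = v then 1 else 0) + (if y = v then 1 else 0) := by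
  rw [abs_mul]
  by_cases h : x = y
  · rw [h, sub_self, abs_zero, mul_zero, if_pos rfl]
  · rw [if_neg h]
    have h1 : |(if p then (1 : ℤ) else 0) - (if q then 1 else 0)| ≤ 1 := by
      split_ifs <;> norm_num
    refine (mul_le_of_le_one_left (abs_nonneg _) h1).trans ?_
    split_ifs <;> norm_num

/-- Effect of a change of the cutoff on the quotas. -/
theorem sum_quota_cutoff (hs : Antitone s) (h0 : ∀ i, n ≤ i → s i = 0) (hT : T ≤ κ) (hT' : T' ≤ κ)
    (B : ℕ) : ∑ v ∈ Icc 1 B, v * ((quota κ T a b n s v - quota κ T' a b n s v) +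
      (quota κ T' a b n s v - quota κ T a b n s v)) ≤
      ∑ i ∈ Ico (min T T') (max T T'), if s i = s (2 * κ - 1 - i) then 0 else 2 * s i := by
  classical
  have hstep : ∀ v ∈ Icc 1 B, v * ((quota κ T a b n s v - quota κ T' a b n s v) +
      (quota κ T' a b n s v - quota κ T a b n s v)) ≤
      ∑ i ∈ Ico (min T T') (max T T'), v * if s i = s (2 * κ - 1 - i) then 0 else
        (if s i = v then 1 else 0) + (if s (2 * κ - 1 - i) = v then 1 else 0) := by
    intro v hv
    rw [← mul_sum]
    refine Nat.mul_le_mul_left _ ?_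
    have hcast : (((quota κ T a b n s v - quota κ T' a b n s v) +
        (quota κ T' a b n s v - quota κ T a b n s v) : ℕ) : ℤ) =
        |(quota κ T a b n s v : ℤ) - quota κ T' a b n s v| := by
      rw [abs_eq_max_neg]
      omega
    zify
    rw [← Nat.cast_add, hcast, quota_sub_quota h0 hT hT' (by rw [mem_Icc] at hv; omega)]
    refine (abs_sum_le_sum_abs _ _).trans ?_
    rw [← sum_subset (s₁ := Ico (min T T') (max T T'))]
    · simp only [Nat.cast_inj]
      exact sum_le_sum fun i _ => abs_indicator_mul_le _ _ _ _ _
    · intro i hi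
      rw [mem_Ico] at hi
      rw [mem_range]
      omega
    · intro i hi hi'
      rw [mem_Ico] at hi'
      rw [mem_range] at hi
      have : RankRight κ T a b i ↔ RankRight κ T' a b i := by
        rw [RankRight, RankRight]
        omega
      simp only [this, sub_self, zero_mul, abs_zero]
  refine (sum_le_sum hstep).trans ?_
  rw [sum_comm]
  refine sum_le_sum fun i hi => ?_
  have hmir : s (2 * κ - 1 - i) ≤ s i := by
    rw [mem_Ico] at hi
    exact hs (by omega)
  split_ifs with h
  · simp
  -- A swap of different sizes affects the classes of both ranks; the mirror rank is the smaller
  -- one, hence the bound `2 * s i`.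
  · have h1 : ∀ w, ∑ v ∈ Icc 1 B, v * (if w = v then 1 else 0) ≤ w := by
      intro w
      simp only [mul_ite, mul_one, mul_zero, sum_ite_eq]
      split_ifs <;> omega
    simp only [mul_add, sum_add_distrib]
    have := h1 (s i)
    have := h1 (s (2 * κ - 1 - i))
    omega

end

/-! ### Total migration after the release of a job -/

section

variable {N k n G : ℕ} {R : ℕ → ℕ}

theorem epoch_succ {Δ : ℕ} (h : ¬ Renews Δ R n) : epoch Δ R (n + 1) = epoch Δ R n := by
  refine eq_of_forall_lt_iff fun i => ?_
  rw [lt_epoch_iff, lt_epoch_iff]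
  constructor
  · rintro ⟨-, u, h1, h2, h3⟩
    have : u ≠ n := fun hu => h (hu ▸ h3)
    exact ⟨by omega, u, by omega, h2, h3⟩
  · rintro ⟨h1, u, h2, h3⟩
    exact ⟨by omega, u, by omega, h3⟩

theorem sumBelow_le (P : ℕ → Prop) (f : ℕ → ℕ) (n : ℕ) : sumBelow P f n ≤ ∑ i ∈ range n, f i := by
  classical
  rw [sumBelow_eq_sum]
  exact sum_le_sum_of_subset (filter_subset _ _)

theorem granularity_le (hN : 0 < N) : granularity N k ≤ 1048576 * (N * N * N) := by
  rw [granularity]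
  split_ifs
  · exact le_rfl
  · have : N ≤ N * N * N := by nlinarith [Nat.le_mul_self N]
    omega

/-- If the algorithm does not start afresh, little is moved. -/
theorem sumBelow_rightAt_ne_le {Δ t : ℕ} (hN : 0 < N) (hG : 0 < G) (htn : t ≤ n)
    (hgap : ∀ i ≤ n, ∀ j ≤ n, R i < R j → R j ≤ G * (R j - R i)) :
    sumBelow (fun j => ¬ (RightAt N k Δ R t n j ↔ RightAt N k Δ R t (n + 1) j)) R n ≤
      576 * (N * G) * R n := by
  classical
  have hJn : ¬ IsBig Δ R t n := fun h => by
    have := h.1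
    omega
  set J : ℕ → Prop := fun j => ¬ IsBig Δ R t j with hJ
  set s := orderStat J R n with hs
  set s' := orderStat J R (n + 1) with hs'
  have hins : IsInsertion s s' n (R n) :=
    ⟨orderStat_anti, orderStat_anti, fun _ => orderStat_eq_zero, fun _ => orderStat_eq_zero,
      orderStat_insert_zero hJn, orderStat_insert_succ hJn⟩
  obtain ⟨κ, hκ⟩ : ∃ κ, κ = capacity N k Δ R t := ⟨_, rfl⟩
  obtain ⟨a, ha⟩ : ∃ a, a = heavyCount N k Δ R t := ⟨_, rfl⟩
  obtain ⟨b, hb⟩ : ∃ b, b = lightCount N k Δ R t := ⟨_, rfl⟩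
  obtain ⟨D, hD⟩ : ∃ D, D = heavyLoad N k Δ R t - lightLoad N k Δ R t := ⟨_, rfl⟩
  set T := cutoff (64 * N) κ n D s with hT
  set T' := cutoff (64 * N) κ (n + 1) D s' with hT'
  have hTκ : T ≤ κ := cutoff_le
  have hTκ' : T' ≤ κ := cutoff_le
  set y := quota κ T a b n s with hy
  set y₁ := quota κ T a b (n + 1) s' with hy₁
  set y₂ := quota κ T' a b (n + 1) s' with hy₂
  have hold : ∀ j, SmallRight N k Δ R t n j ↔ Chosen J R y j := fun j => by
    rw [hy, hT, hκ, ha, hb, hD]; rfl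
  have hnew : ∀ j, SmallRight N k Δ R t (n + 1) j ↔ Chosen J R y₂ j := fun j => by
    rw [hy₂, hT', hκ, ha, hb, hD]; rfl
  set B := (range n).sup R with hB
  have hRB : ∀ j < n, R j ≤ B := fun j hj => le_sup (f := R) (mem_range.2 hj)
  have hmove : sumBelow (fun j => ¬ (RightAt N k Δ R t n j ↔ RightAt N k Δ R t (n + 1) j)) R n =
      sumBelow (fun j => J j ∧ ¬ (Chosen J R y j ↔ Chosen J R y₂ j)) R n :=
    sumBelow_congr (fun j _ => by
      rw [RightAt, RightAt, hold, hnew]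
      by_cases h : IsBig Δ R t j <;> simp [hJ, h]) fun _ _ => rfl
  rw [hmove]
  refine (sum_chosen_ne_le y y₂ hRB).trans ?_
  -- The change is made in two stages: `y₁` has the new job but the old cutoff.
  have htri : ∑ v ∈ Icc 1 B, v * ((y v - y₂ v) + (y₂ v - y v)) ≤
      ∑ v ∈ Icc 1 B, v * ((y v - y₁ v) + (y₁ v - y v)) +
        ∑ v ∈ Icc 1 B, v * ((y₁ v - y₂ v) + (y₂ v - y₁ v)) := by
    rw [← sum_add_distrib]
    refine sum_le_sum fun v _ => ?_
    rw [← mul_add]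
    refine Nat.mul_le_mul_left _ ?_
    omega
  have hrank : ∑ v ∈ Icc 1 B, v * ((y v - y₁ v) + (y₁ v - y v)) ≤ G * R n := by
    calc _ ≤ ∑ v ∈ Icc 1 B, v * (if v ∈ (range (n + 1)).image R ∧ v ≤ R n then 1 else 0) := by
          refine sum_le_sum fun v hv => Nat.mul_le_mul_left _ ?_
          rw [mem_Icc] at hv
          exact quota_insert (RankRight κ T a b) (by omega) hJn rfl rfl
      _ = ∑ v ∈ Icc 1 B with v ∈ (range (n + 1)).image R ∧ v ≤ R n, v := by
          rw [sum_filter]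
          exact sum_congr rfl fun v _ => by split_ifs <;> simp
      _ ≤ G * R n := by
          refine sum_le_of_gap hG _ (fun v hv w hw hvw => ?_) fun v hv => (mem_filter.1 hv).2.2
          obtain ⟨i, hi, rfl⟩ := mem_image.1 (mem_filter.1 hv).2.1
          obtain ⟨j, hj, rfl⟩ := mem_image.1 (mem_filter.1 hw).2.1
          rw [mem_range] at hi hj
          exact hgap i (by omega) j (by omega) hvw
  have hcut : ∑ v ∈ Icc 1 B, v * ((y₁ v - y₂ v) + (y₂ v - y₁ v)) ≤ 8 * G * (64 * N) * R n := by
    refine le_of_mul_le_mul_left ?_ (by positivity : 0 < 64 * N)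
    calc 64 * N * ∑ v ∈ Icc 1 B, v * ((y₁ v - y₂ v) + (y₂ v - y₁ v))
        ≤ 64 * N * ∑ i ∈ Ico (min T T') (max T T'),
            if s' i = s' (2 * κ - 1 - i) then 0 else 2 * s' i :=
          Nat.mul_le_mul_left _ (sum_quota_cutoff hins.anti' hins.eq_zero' hTκ hTκ' B)
      _ ≤ ∑ i ∈ Ico (min T T') (max T T'), 2 * G * gain (64 * N) κ (n + 1) s' i := by
          rw [mul_sum]
          refine sum_le_sum fun i hi => ?_
          split_ifs with h
          · simp
          · rw [gain_eq hins.eq_zero']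
            have hmir : s' (2 * κ - 1 - i) ≤ s' i := by
              rw [mem_Ico] at hi
              exact hins.anti' (by omega)
            -- The gap between distinct sizes makes the gain of a rank comparable to its size; an
            -- empty mirror rank has size zero and needs no gap.
            have hgp : s' i ≤ G * (s' i - s' (2 * κ - 1 - i)) := by
              rcases Nat.eq_zero_or_pos (s' (2 * κ - 1 - i)) with h0 | h0
              · rw [h0]
                exact Nat.le_mul_of_pos_left _ hG
              · obtain ⟨j, hj, hj'⟩ := exists_orderStat_eq (show s' i ≠ 0 by omega)
                obtain ⟨l, hl, hl'⟩ := exists_orderStat_eq h0.ne'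
                have := hgap l (by omega) j (by omega)
                  (by rw [hj', hl']; exact lt_of_le_of_ne hmir (Ne.symm h))
                rwa [hj', hl'] at this
            rw [mul_min_of_nonneg _ _ (Nat.zero_le _)]
            refine le_min ?_ ?_
            · calc 64 * N * (2 * s' i) = 1 * (2 * (64 * N * s' i)) := by ring
                _ ≤ G * (2 * (64 * N * s' i)) := Nat.mul_le_mul_right _ hG
                _ = 2 * G * (64 * N * s' i) := by ring
            · calc 64 * N * (2 * s' i)
                  ≤ (64 * N + 1) * (2 * (G * (s' i - s' (2 * κ - 1 - i)))) := by
                    gcongr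
                    omega
                _ = _ := by ring
      _ = 2 * G * ∑ i ∈ Ico (min T T') (max T T'), gain (64 * N) κ (n + 1) s' i := by
          rw [mul_sum]
      _ ≤ 2 * G * ((64 * N + 1) * (64 * N + 1) * R n) :=
          Nat.mul_le_mul_left _ (hins.sum_gain_cutoff hT hT')
      _ ≤ 2 * G * ((2 * (64 * N)) * (2 * (64 * N)) * R n) := by
          gcongr <;> omega
      _ = 64 * N * (8 * G * (64 * N) * R n) := by ring
  have hfin : G * R n + 8 * G * (64 * N) * R n ≤ 576 * (N * G) * R n := by
    calc G * R n + 8 * G * (64 * N) * R n = 1 * (G * R n) + 512 * (N * G) * R n := by ring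
      _ ≤ 64 * N * (G * R n) + 512 * (N * G) * R n := by
          gcongr
          omega
      _ = _ := by ring
  omega

/-- Total size of the jobs that are moved when job `n` is released. -/
theorem right_migration (hN : 0 < N) (hgap : ∀ i ≤ n, ∀ j ≤ n, R i < R j →
    R j ≤ (16 * N + 1) * (R j - R i)) :
    sumBelow (fun j => ¬ (Right N k R n j ↔ Right N k R (n + 1) j)) R n ≤
      1048576 * (N * N * N) * R n := by
  by_cases h : Renews (granularity N k) R n
  · calc _ ≤ prefixLoad R n := sumBelow_le _ _ _
      _ ≤ prefixLoad R (n + 1) := prefixLoad_mono (Nat.le_succ n)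
      _ ≤ granularity N k * R n := h
      _ ≤ _ := Nat.mul_le_mul_right _ (granularity_le hN)
  · have := sumBelow_rightAt_ne_le (k := k) (Δ := granularity N k) hN (Nat.succ_pos (16 * N))
      (epoch_le (Δ := granularity N k) (R := R) (n := n)) hgap
    simp only [Right, epoch_succ h]
    refine this.trans (Nat.mul_le_mul_right _ ?_)
    -- Since `16 * N + 1 ≤ 17 * N`, the factor is at most `576 * 17 * N ^ 2`.
    nlinarith [Nat.mul_le_mul_left (N * N) hN, Nat.mul_le_mul_left N hN]

end

/-! ### Scaling -/

section Scaling

variable {N k n c t Δ : ℕ} {R R' : ℕ → ℕ}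

theorem prefixLoad_scale (h : ∀ j < n, R' j = c * R j) {m : ℕ} (hm : m ≤ n) :
    prefixLoad R' m = c * prefixLoad R m := by
  rw [prefixLoad, prefixLoad, mul_sum]
  exact sum_congr rfl fun j hj => h j ((mem_range.1 hj).trans_le hm)

theorem renews_scale (hc : 0 < c) (h : ∀ j < n, R' j = c * R j) {u : ℕ} (hu : u < n) :
    Renews Δ R' u ↔ Renews Δ R u := by
  rw [Renews, Renews, prefixLoad_scale h hu, h u hu, mul_left_comm]
  exact Nat.mul_le_mul_left_iff hc

theorem epoch_scale (hc : 0 < c) (h : ∀ j < n, R' j = c * R j) : epoch Δ R' n = epoch Δ R n :=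
  countBelow_congr fun _ _ => exists_congr fun _ => and_congr_right fun hu =>
    and_congr_right fun _ => renews_scale hc h hu

theorem isBig_scale (hc : 0 < c) (h : ∀ j < n, R' j = c * R j) (ht : t ≤ n) :
    IsBig Δ R' t = IsBig Δ R t := by
  refine funext fun j => propext (and_congr_right fun hj => ?_)
  rw [prefixLoad_scale h ht, h j (by omega), mul_left_comm]
  exact Nat.mul_le_mul_left_iff hc

theorem weight_scale (hc : 0 < c) (h : ∀ j < n, R' j = c * R j) (ht : t ≤ n) {j : ℕ}
    (hj : j < n) : weight N R' t j = weight N R t j := by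
  rw [weight, weight, prefixLoad_scale h ht, h j hj, mul_assoc, Nat.mul_div_mul_left _ _ hc]

theorem code_scale (hc : 0 < c) (h : ∀ j < n, R' j = c * R j) (ht : t ≤ n) {j : ℕ}
    (hj : j < n) : code N R' t j = code N R t j := by
  rw [code, code, weight_scale hc h ht hj]

theorem reach_scale (hc : 0 < c) (h : ∀ j < n, R' j = c * R j) (ht : t ≤ n) {m v : ℕ}
    (hm : m ≤ n) : Reach N Δ R' t m v ↔ Reach N Δ R t m v := by
  have : genFun N Δ R' t m = genFun N Δ R t m := by
    rw [genFun, genFun]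
    refine prod_congr rfl fun j hj => ?_
    rw [isBig_scale hc h ht, code_scale hc h ht ((mem_range.1 hj).trans_le hm)]
  rw [Reach, Reach, this]

theorem bestCode_scale (hc : 0 < c) (h : ∀ j < n, R' j = c * R j) (ht : t ≤ n) :
    bestCode N k Δ R' t = bestCode N k Δ R t := by
  have hw : sumBelow (IsBig Δ R t) (weight N R' t) t = sumBelow (IsBig Δ R t) (weight N R t) t :=
    sumBelow_congr (fun _ _ => Iff.rfl) fun j hj => weight_scale hc h ht (by omega)
  refine countBelow_congr fun v _ => not_congr (exists_congr fun w => ?_)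
  rw [GoodCode, GoodCode, reach_scale hc h ht ht, isBig_scale hc h ht, hw]

theorem residual_scale (hc : 0 < c) (hn : 0 < n) (h : ∀ j < n, R' j = c * R j) (ht : t ≤ n)
    (i : ℕ) : residual N k Δ R' t i = residual N k Δ R t i := by
  induction i with
  | zero => exact bestCode_scale hc h ht
  | succ i ih =>
    have h1 : residual N k Δ R' t (i + 1) = residual N k Δ R' t i -
      (open scoped Classical in if Reach N Δ R' t (t - 1 - i) (residual N k Δ R' t i) then 0
        else code N R' t (t - 1 - i)) := rfl
    have h2 : residual N k Δ R t (i + 1) = residual N k Δ R t i -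
      (open scoped Classical in if Reach N Δ R t (t - 1 - i) (residual N k Δ R t i) then 0
        else code N R t (t - 1 - i)) := rfl
    rw [h1, h2, ih, code_scale hc h ht (by omega),
      propext (reach_scale (N := N) (Δ := Δ) hc h ht (show t - 1 - i ≤ n by omega))]

theorem isHeavy_scale (hc : 0 < c) (hn : 0 < n) (h : ∀ j < n, R' j = c * R j) (ht : t ≤ n) :
    IsHeavy N k Δ R' t = IsHeavy N k Δ R t := by
  refine funext fun j => propext ?_
  rw [IsHeavy, IsHeavy, isBig_scale hc h ht, residual_scale hc hn h ht]
  refine and_congr_right fun hj => not_congr (reach_scale hc h ht ?_)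
  have := hj.1
  omega

theorem sumBelow_scale {P : ℕ → Prop} (h : ∀ j < n, R' j = c * R j) (ht : t ≤ n) :
    sumBelow P R' t = c * sumBelow P R t := by
  classical
  rw [sumBelow_eq_sum, sumBelow_eq_sum, mul_sum]
  refine sum_congr rfl fun j hj => h j ?_
  have := mem_range.1 (mem_filter.1 hj).1
  omega

theorem orderStat_scale {J : ℕ → Prop} (hc : 0 < c) (h : ∀ j < n, R' j = c * R j) (i : ℕ) :
    orderStat J R' n i = c * orderStat J R n i := by
  classical
  have hg : ∀ j < n, countGe J R' n (R' j) = countGe J R n (R j) := fun j hj =>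
    countBelow_congr fun l hl => by rw [h j hj, h l hl, Nat.mul_le_mul_left_iff hc]
  rw [orderStat, orderStat, apply_sup_eq_sup_comp (c * ·)
    (fun _ _ => (Nat.mul_max_mul_left _ _ _).symm) (mul_zero c)]
  refine sup_congr rfl fun j hj => ?_
  rw [mem_range] at hj
  rw [hg j hj, h j hj, Function.comp_apply]
  split_ifs <;> simp

theorem gain_scale {Λ κ : ℕ} (s : ℕ → ℕ) (i : ℕ) :
    gain Λ κ n (fun i => c * s i) i = c * gain Λ κ n s i := by
  rw [gain, gain, ← Nat.mul_sub, mul_left_comm, mul_left_comm (Λ + 1), Nat.mul_min_mul_left]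

theorem lead_scale (hc : 0 < c) (hn : 0 < n) (h : ∀ j < n, R' j = c * R j) (ht : t ≤ n) :
    lead N k Δ R' t n = lead N k Δ R t n := by
  have hs : smallStat Δ R' t n = fun i => c * smallStat Δ R t n i := by
    funext i
    rw [smallStat, smallStat, isBig_scale hc h ht, orderStat_scale hc h]
  rw [lead, lead, capacity, capacity, heavyCount, heavyCount, lightCount, lightCount, heavyLoad,
    heavyLoad, lightLoad, lightLoad, isHeavy_scale hc hn h ht, isBig_scale hc h ht,
    sumBelow_scale h ht, sumBelow_scale h ht, hs, cutoff, cutoff]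
  refine countBelow_congr fun i _ => and_congr_right fun _ => ?_
  rw [sum_congr rfl fun i _ => gain_scale _ i, ← mul_sum, ← Nat.mul_sub, mul_left_comm,
    Nat.mul_lt_mul_left hc]

/-- The common factor that makes the rounded sizes integral changes with every new job. The
schedules before and after a release are comparable because all decisions depend only on ratios of
sizes. -/
theorem right_scale (hc : 0 < c) (h : ∀ j < n, R' j = c * R j) {j : ℕ} (hj : j < n) :
    Right N k R' n j ↔ Right N k R n j := by
  have hn : 0 < n := by omega
  rw [Right, Right, epoch_scale hc h]
  have ht : epoch (granularity N k) R n ≤ n := epoch_le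
  rw [RightAt, RightAt, isHeavy_scale hc hn h ht, isBig_scale hc h ht, SmallRight, SmallRight,
    lead_scale hc hn h ht, capacity, capacity, heavyCount, heavyCount, lightCount, lightCount,
    isHeavy_scale hc hn h ht, isBig_scale hc h ht]
  refine or_congr_right (and_congr_right fun _ => ?_)
  have e1 : ∀ t, countBelow (fun i => ¬ IsBig (granularity N k) R t i ∧ R' i = R' j) j =
      countBelow (fun i => ¬ IsBig (granularity N k) R t i ∧ R i = R j) j := fun t =>
    countBelow_congr fun i hi => by
      rw [h i (by omega), h j hj, Nat.mul_right_inj hc.ne']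
  rw [e1]
  have e2 : ∀ κ T a b, quota κ T a b n
      (smallStat (granularity N k) R' (epoch (granularity N k) R n) n) (R' j) = quota κ T a b n
      (smallStat (granularity N k) R (epoch (granularity N k) R n) n) (R j) := fun κ T a b =>
    countBelow_congr fun i _ => by
      rw [smallStat, smallStat, isBig_scale hc h ht, orderStat_scale hc h, h j hj,
        Nat.mul_right_inj hc.ne']
  rw [e2]

end Scaling

/-! ### Rounding -/

section Rounding

variable {I : Inst} {j : ℕ}

theorem two_pow_size_le {x : ℕ} (hx : 0 < x) : 2 ^ Nat.size x ≤ 2 * x := by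
  have h : 0 < Nat.size x := Nat.size_pos.2 hx
  obtain ⟨m, hm⟩ : ∃ m, Nat.size x = m + 1 := ⟨Nat.size x - 1, by omega⟩
  have := Nat.lt_size.1 (show m < Nat.size x by omega)
  rw [hm, pow_succ]
  omega

/-- The significant digits of a rounded size. -/
def mantissa (I : Inst) (j : ℕ) : ℕ :=
  8 * I.N * I.num j * 2 ^ Nat.size (I.den j) / (I.den j * 2 ^ Nat.size (I.num j))

/-- The quotient of `num` by its power of two is less than 1, and that of the power of two by `den`
is at most 2. -/
theorem mantissa_le (hd : 0 < I.den j) : mantissa I j ≤ 16 * I.N := by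
  refine Nat.div_le_of_le_mul ?_
  calc 8 * I.N * I.num j * 2 ^ Nat.size (I.den j)
      ≤ 8 * I.N * 2 ^ Nat.size (I.num j) * (2 * I.den j) := by
        gcongr
        · exact (Nat.lt_size_self _).le
        · exact two_pow_size_le hd
    _ = _ := by ring

/-- The same two quotients are at least 1/2 and greater than 1. The lower bound `4 * N` limits the
relative rounding error to 1/(4N). -/
theorem le_mantissa (hn : 0 < I.num j) (hd : 0 < I.den j) : 4 * I.N ≤ mantissa I j := by
  rw [mantissa, Nat.le_div_iff_mul_le (by positivity)]
  calc 4 * I.N * (I.den j * 2 ^ Nat.size (I.num j))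
      ≤ 4 * I.N * (2 ^ Nat.size (I.den j) * (2 * I.num j)) := by
        gcongr
        · exact (Nat.lt_size_self _).le
        · exact two_pow_size_le hn
    _ = _ := by ring

/-- The exponent of a rounded size. -/
def exponent (I : Inst) (j : ℕ) : ℕ :=
  Nat.size (I.num j) + (∑ i ∈ range I.n, Nat.size (I.den i) - Nat.size (I.den j))

theorem rounded_eq : rounded I j = mantissa I j * 2 ^ exponent I j := by
  rw [rounded, exponent, mantissa, pow_add]
  ring

theorem rounded_pos (hN : 0 < I.N) (hn : 0 < I.num j) (hd : 0 < I.den j) : 0 < rounded I j := by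
  rw [rounded_eq]
  have := le_mantissa hn hd
  have : 0 < mantissa I j := by omega
  positivity

/-- Both numbers are multiples of the smaller power of two, so their difference is at least that
power, and the number with the smaller exponent is at most `16 * N` times it. -/
theorem rounded_gap {i : ℕ} (hdi : 0 < I.den i) (hdj : 0 < I.den j)
    (h : rounded I i < rounded I j) :
    rounded I j ≤ (16 * I.N + 1) * (rounded I j - rounded I i) := by
  have hi : rounded I i ≤ 16 * I.N * 2 ^ exponent I i := by
    rw [rounded_eq]
    exact Nat.mul_le_mul_right _ (mantissa_le hdi)
  have hj : rounded I j ≤ 16 * I.N * 2 ^ exponent I j := by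
    rw [rounded_eq]
    exact Nat.mul_le_mul_right _ (mantissa_le hdj)
  have hdvd : ∀ {e l : ℕ}, e ≤ exponent I l → 2 ^ e ∣ rounded I l := fun he =>
    rounded_eq ▸ (pow_dvd_pow 2 he).mul_left _
  have hle : ∀ {e : ℕ}, e ≤ exponent I i → e ≤ exponent I j →
      2 ^ e ≤ rounded I j - rounded I i := fun h1 h2 =>
    Nat.le_of_dvd (by omega) (Nat.dvd_sub (hdvd h2) (hdvd h1))
  rw [add_mul, one_mul]
  rcases le_total (exponent I i) (exponent I j) with he | he
  · have := Nat.mul_le_mul_left (16 * I.N) (hle le_rfl he)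
    omega
  · have := Nat.mul_le_mul_left (16 * I.N) (hle he le_rfl)
    omega

/-- The factor by which sizes are scaled. -/
def scale (I : Inst) : ℕ := 8 * I.N * 2 ^ ∑ i ∈ range I.n, Nat.size (I.den i)

theorem size_den_le (hj : j < I.n) : Nat.size (I.den j) ≤ ∑ i ∈ range I.n, Nat.size (I.den i) :=
  single_le_sum (f := fun i => Nat.size (I.den i)) (fun _ _ => Nat.zero_le _) (mem_range.2 hj)

theorem scale_eq (hj : j < I.n) : scale I = 8 * I.N * 2 ^ Nat.size (I.den j) *
    2 ^ (∑ i ∈ range I.n, Nat.size (I.den i) - Nat.size (I.den j)) := by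
  rw [scale, mul_assoc (8 * I.N), ← pow_add, Nat.add_sub_cancel' (size_den_le hj)]

theorem rounded_mul_den_le (hj : j < I.n) : rounded I j * I.den j ≤ scale I * I.num j := by
  rw [rounded_eq, scale_eq hj, exponent, pow_add]
  set E := 2 ^ (∑ i ∈ range I.n, Nat.size (I.den i) - Nat.size (I.den j))
  calc mantissa I j * (2 ^ Nat.size (I.num j) * E) * I.den j
      = mantissa I j * (I.den j * 2 ^ Nat.size (I.num j)) * E := by ring
    _ ≤ 8 * I.N * I.num j * 2 ^ Nat.size (I.den j) * E :=
        Nat.mul_le_mul_right _ (Nat.div_mul_le_self _ _)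
    _ = _ := by ring

/-- Rounding down loses less than one unit of a mantissa that is at least `4 * N`. -/
theorem scale_mul_num_le (hj : j < I.n) (hn : 0 < I.num j) (hd : 0 < I.den j) :
    4 * I.N * (scale I * I.num j) ≤ (4 * I.N + 1) * (rounded I j * I.den j) := by
  rw [rounded_eq, scale_eq hj, exponent, pow_add]
  set E := 2 ^ (∑ i ∈ range I.n, Nat.size (I.den i) - Nat.size (I.den j))
  have h1 : 8 * I.N * I.num j * 2 ^ Nat.size (I.den j) ≤
      (mantissa I j + 1) * (I.den j * 2 ^ Nat.size (I.num j)) := by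
    rw [mul_comm (mantissa I j + 1)]
    exact (Nat.lt_mul_div_succ _ (by positivity)).le
  have h2 := le_mantissa hn hd
  have h3 : 4 * I.N * (mantissa I j + 1) ≤ (4 * I.N + 1) * mantissa I j := by
    rw [mul_add, add_mul]
    omega
  calc 4 * I.N * (8 * I.N * 2 ^ Nat.size (I.den j) * E * I.num j)
      = 4 * I.N * (8 * I.N * I.num j * 2 ^ Nat.size (I.den j)) * E := by ring
    _ ≤ 4 * I.N * ((mantissa I j + 1) * (I.den j * 2 ^ Nat.size (I.num j))) * E := by gcongr
    _ = 4 * I.N * (mantissa I j + 1) * (I.den j * 2 ^ Nat.size (I.num j)) * E := by ring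
    _ ≤ (4 * I.N + 1) * mantissa I j * (I.den j * 2 ^ Nat.size (I.num j)) * E := by gcongr
    _ = _ := by ring

end Rounding

end CCS

namespace CCS

open Finset

/-! ### The online algorithm -/

section

variable {N k n : ℕ}

/-- The instance that is stored in the initial memory. -/
def instOf (N k : ℕ) (p : Fin n → ℚ) : Inst where
  N := N
  k := k
  n := n
  num := (inputMem N k p).arr 0
  den := (inputMem N k p).arr 1

theorem instOf_num (p : Fin n → ℚ) (j : Fin n) : (instOf N k p).num j = (p j).num.natAbs := by
  simp [instOf, inputMem]

theorem instOf_den (p : Fin n → ℚ) (j : Fin n) : (instOf N k p).den j = (p j).den := by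
  simp [instOf, inputMem]

theorem instOf_rep (p : Fin n → ℚ) : (instOf N k p).Rep (inputMem N k p) :=
  ⟨rfl, rfl, rfl, fun _ => rfl, fun _ => rfl⟩

theorem instOf_bounded (p : Fin n → ℚ) : (instOf N k p).Bounded [] (N + encLength k p) := by
  have hle : ∀ j : Fin n, Nat.size (p j).num.natAbs + Nat.size (p j).den ≤ encLength k p :=
    fun j => (single_le_sum (f := fun j => Nat.size (p j).num.natAbs + Nat.size (p j).den)
      (fun _ _ => Nat.zero_le _) (mem_univ j)).trans (Nat.le_add_left _ _)
  have hn : n ≤ encLength k p := by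
    calc n = ∑ _j : Fin n, 1 := by simp
      _ ≤ ∑ j, (Nat.size (p j).num.natAbs + Nat.size (p j).den) := sum_le_sum fun j _ => by
          have := Nat.size_pos.2 (p j).den_pos
          omega
      _ ≤ encLength k p := Nat.le_add_left _ _
  refine ⟨Nat.le_add_right _ _, hn.trans (Nat.le_add_left _ _), ?_, fun i => ?_, fun i => ?_,
    by simp⟩
  · exact (Nat.le_add_right _ _).trans (Nat.le_add_left _ N)
  · by_cases h : i < n
    · have h1 := hle ⟨i, h⟩
      have h2 := instOf_num (N := N) (k := k) p ⟨i, h⟩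
      rw [show i = ((⟨i, h⟩ : Fin n) : ℕ) from rfl, h2]
      omega
    · simp [instOf, inputMem, h]
  · by_cases h : i < n
    · have h1 := hle ⟨i, h⟩
      have h2 := instOf_den (N := N) (k := k) p ⟨i, h⟩
      rw [show i = ((⟨i, h⟩ : Fin n) : ℕ) from rfl, h2]
      omega
    · simp [instOf, inputMem, h]

theorem machine_of_le {I : Inst} (h : I.N ≤ 1) (j : ℕ) :
    machine I j = if I.k ≤ j then 1 else 0 := if_pos h

open scoped Classical in
theorem machine_of_lt {I : Inst} (h : 1 < I.N) (j : ℕ) :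
    machine I j = if Right I.N I.k (rounded I) I.n j then 1 else 0 := if_neg (not_le.2 h)

theorem machine_lt_two (I : Inst) (j : ℕ) : machine I j < 2 := by
  rw [machine]
  split_ifs <;> omega

/-- The online algorithm with accuracy `N`. -/
noncomputable def schedule (N k : ℕ) : OnlineAlg 2 :=
  fun _ p j => ⟨machine (instOf N k p) j, machine_lt_two _ _⟩

theorem schedule_eq_one_iff (hN : 1 < N) (p : Fin n → ℚ) (j : Fin n) :
    schedule N k n p j = 1 ↔ Right N k (rounded (instOf N k p)) n j := by
  classical
  rw [Fin.ext_iff, schedule]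
  simp only [machine_of_lt (I := instOf N k p) hN]
  split_ifs with h
  · exact iff_of_true rfl h
  · exact iff_of_false (by simp) h

theorem schedule_eq_zero_iff (hN : 1 < N) (p : Fin n → ℚ) (j : Fin n) :
    schedule N k n p j = 0 ↔ ¬ Right N k (rounded (instOf N k p)) n j := by
  rw [← schedule_eq_one_iff hN]
  generalize schedule N k n p j = i
  fin_cases i <;> simp

theorem sumBelow_eq_sum_fin (P : ℕ → Prop) [DecidablePred P] (f : ℕ → ℕ) (n : ℕ) :
    sumBelow P f n = ∑ j ∈ univ.filter (fun j : Fin n => P j), f j := by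
  rw [sumBelow, sum_range, sum_filter]
  congr! 2

theorem countBelow_eq_card_fin (P : ℕ → Prop) [DecidablePred P] (n : ℕ) :
    countBelow P n = #(univ.filter fun j : Fin n => P j) := by
  rw [countBelow, sum_range, card_filter]
  congr! 2

theorem load_le_makespan {m : ℕ} (p : Fin n → ℚ) (σ : Fin n → Fin m) (i : Fin m) :
    load p σ i ≤ makespan p σ := le_ciSup (f := load p σ) (Set.finite_range _).bddAbove i

/-- To bound the approximation ratio it suffices to compare with every feasible schedule. -/
theorem makespan_le_mul_optCost {m : ℕ} {p : Fin n → ℚ} {σ : Fin n → Fin m} {α : ℝ} (hα : 0 < α)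
    (hσ : Feasible k σ) (h : ∀ τ : Fin n → Fin m, Feasible k τ → makespan p σ ≤ α * makespan p τ) :
    makespan p σ ≤ α * optCost m k p := by
  rw [← div_le_iff₀' hα]
  refine le_csInf ⟨_, σ, hσ, rfl⟩ ?_
  rintro _ ⟨τ, hτ, rfl⟩
  rw [div_le_iff₀' hα]
  exact h τ hτ

theorem load_zero_add_load_one (p : Fin n → ℚ) (σ : Fin n → Fin 2) :
    load p σ 0 + load p σ 1 = ∑ j, (p j : ℝ) := by
  rw [← Fin.sum_univ_two (load p σ)]
  exact sum_fiberwise univ σ fun j => (p j : ℝ)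

theorem load_nonneg {m : ℕ} {p : Fin n → ℚ} (hp : ∀ j, 0 < p j) (σ : Fin n → Fin m) (i : Fin m) :
    0 ≤ load p σ i := sum_nonneg fun j _ => by exact_mod_cast (hp j).le

section Sizes

variable {p : Fin n → ℚ}

theorem instOf_num_pos (hp : ∀ j, 0 < p j) {j : ℕ} (hj : j < n) : 0 < (instOf N k p).num j := by
  rw [show j = ((⟨j, hj⟩ : Fin n) : ℕ) from rfl, instOf_num, Int.natAbs_pos]
  exact (Rat.num_pos.2 (hp _)).ne'

theorem instOf_den_pos {j : ℕ} (hj : j < n) : 0 < (instOf N k p).den j := by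
  rw [show j = ((⟨j, hj⟩ : Fin n) : ℕ) from rfl, instOf_den]
  exact (p _).den_pos

theorem size_mul_den (hp : ∀ j, 0 < p j) (j : Fin n) :
    (p j : ℝ) * (instOf N k p).den j = (instOf N k p).num j := by
  rw [instOf_num, instOf_den]
  have h1 : (p j) * (p j).den = ((p j).num.natAbs : ℚ) := by
    rw [Rat.mul_den_eq_num, Nat.cast_natAbs, abs_of_pos (Rat.num_pos.2 (hp j))]
  exact_mod_cast h1

theorem rounded_le_scale_mul (hp : ∀ j, 0 < p j) (j : Fin n) :
    (rounded (instOf N k p) j : ℝ) ≤ scale (instOf N k p) * p j := by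
  have h : (rounded (instOf N k p) j * (instOf N k p).den j : ℝ) ≤
      scale (instOf N k p) * (instOf N k p).num j := by
    exact_mod_cast rounded_mul_den_le (I := instOf N k p) j.2
  have hd : (0 : ℝ) < (instOf N k p).den j := by exact_mod_cast instOf_den_pos j.2
  rw [← size_mul_den hp, ← mul_assoc] at h
  exact le_of_mul_le_mul_right h hd

theorem scale_mul_le_rounded (hp : ∀ j, 0 < p j) (j : Fin n) :
    4 * N * (scale (instOf N k p) * p j) ≤ (4 * N + 1) * (rounded (instOf N k p) j : ℝ) := by
  have h : (4 * N * (scale (instOf N k p) * (instOf N k p).num j) : ℝ) ≤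
      (4 * N + 1) * (rounded (instOf N k p) j * (instOf N k p).den j) := by
    exact_mod_cast scale_mul_num_le (I := instOf N k p) j.2 (instOf_num_pos hp j.2)
      (instOf_den_pos j.2)
  have hd : (0 : ℝ) < (instOf N k p).den j := by exact_mod_cast instOf_den_pos j.2
  rw [← size_mul_den hp] at h
  refine le_of_mul_le_mul_right ?_ hd
  linarith

theorem scale_pos (hN : 0 < N) : (0 : ℝ) < scale (instOf N k p) := by
  have : 0 < scale (instOf N k p) := by
    have : 0 < (instOf N k p).N := hN
    rw [scale]
    positivity
  exact_mod_cast this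

end Sizes

theorem schedule_feasible (hN : 0 < N) {p : Fin n → ℚ} (hp : ValidInput 2 k p) :
    Feasible k (schedule N k n p) := by
  classical
  rcases Nat.lt_or_ge 1 N with h | h
  · have hR : ∀ j < n, 0 < rounded (instOf N k p) j := fun j hj =>
      rounded_pos hN (instOf_num_pos hp.1 hj) (instOf_den_pos hj)
    obtain ⟨h1, h2⟩ := right_feasible (N := N) hp.2 hR
    rw [countBelow_eq_card_fin] at h1 h2
    refine Fin.forall_fin_two.2 ⟨?_, ?_⟩
    · refine le_trans (le_of_eq ?_) h2
      exact congrArg card (filter_congr fun j _ => schedule_eq_zero_iff h p j)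
    · refine le_trans (le_of_eq ?_) h1
      exact congrArg card (filter_congr fun j _ => schedule_eq_one_iff h p j)
  · have hm : ∀ j : Fin n, (schedule N k n p j : ℕ) = if k ≤ j then 1 else 0 := fun j => by
      exact machine_of_le (I := instOf N k p) h j
    have hn : n ≤ 2 * k := hp.2
    refine Fin.forall_fin_two.2 ⟨?_, ?_⟩
    · calc _ ≤ #(range k) := card_le_card_of_injOn Fin.val (fun j hj => by
            have h0 := congrArg Fin.val (mem_filter.1 hj).2
            rw [hm] at h0
            split_ifs at h0 with h3
            · simp at h0
            · simpa using h3) (Fin.val_injective.injOn)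
        _ = k := card_range k
    · calc _ ≤ #(Ico k n) := card_le_card_of_injOn Fin.val (fun j hj => by
            have h0 := congrArg Fin.val (mem_filter.1 hj).2
            rw [hm] at h0
            split_ifs at h0 with h3
            · simpa using h3
            · simp at h0) (Fin.val_injective.injOn)
        _ ≤ k := by rw [Nat.card_Ico]; omega

theorem schedule_approx {ε : ℝ} (hε : 0 < ε) (hN : 1 ≤ ε * N) {p : Fin n → ℚ}
    (hp : ValidInput 2 k p) : makespan p (schedule N k n p) ≤ (1 + ε) * optCost 2 k p := by
  classical
  have hN0 : 0 < N := by
    rcases Nat.eq_zero_or_pos N with rfl | h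
    · norm_num at hN
    · exact h
  refine makespan_le_mul_optCost (by linarith) (schedule_feasible hN0 hp) fun τ hτ => ?_
  refine ciSup_le fun i => ?_
  set m := makespan p τ with hm
  have hm0 : load p τ 0 ≤ m := load_le_makespan p τ 0
  have hm1 : load p τ 1 ≤ m := load_le_makespan p τ 1
  have hmn : 0 ≤ m := (load_nonneg hp.1 τ 0).trans hm0
  -- The competing schedule is transferred to the rounded sizes: `X` is its second machine and `c`
  -- its rounded makespan, at most the scaled `m` since sizes are rounded down.
  rcases Nat.lt_or_ge 1 N with h | h
  · obtain ⟨R, hR⟩ : ∃ R, R = rounded (instOf N k p) := ⟨_, rfl⟩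
    set P : ℕ → Prop := fun j => ∃ hj : j < n, τ ⟨j, hj⟩ = 1 with hP
    have hP1 : ∀ j : Fin n, P j ↔ τ j = 1 := fun j => by simp [hP]
    have hP0 : ∀ j : Fin n, ¬ P j ↔ τ j = 0 := fun j => by
      rw [hP1]
      generalize τ j = i
      fin_cases i <;> simp
    set X : Finset ℕ := {j ∈ range n | P j} with hX
    have hXc : range n \ X = {j ∈ range n | ¬ P j} := by rw [hX, filter_not]
    have hc1 : #X ≤ k := by
      rw [hX, ← countBelow_eq_card, countBelow_eq_card_fin]
      simpa only [hP1] using hτ 1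
    have hc0 : #(range n \ X) ≤ k := by
      rw [hXc, ← countBelow_eq_card, countBelow_eq_card_fin]
      simpa only [hP0] using hτ 0
    have hsum : ∀ i : Fin 2, ((∑ j ∈ univ.filter (fun j => τ j = i), R j : ℕ) : ℝ) ≤
        scale (instOf N k p) * load p τ i := by
      intro i
      rw [load, mul_sum]
      push_cast
      exact sum_le_sum fun j _ => hR ▸ rounded_le_scale_mul hp.1 j
    obtain ⟨c, hc⟩ : ∃ c, c = max (∑ j ∈ X, R j) (∑ j ∈ range n \ X, R j) := ⟨_, rfl⟩
    have e1 : ∑ j ∈ X, R j = ∑ j ∈ univ.filter (fun j => τ j = 1), R j := by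
      rw [hX, ← sumBelow_eq_sum, sumBelow_eq_sum_fin]
      simp only [hP1]
    have e0 : ∑ j ∈ range n \ X, R j = ∑ j ∈ univ.filter (fun j => τ j = 0), R j := by
      rw [hXc, ← sumBelow_eq_sum, sumBelow_eq_sum_fin]
      simp only [hP0]
    have hs0 := scale_pos (k := k) (p := p) hN0
    have hcm : (c : ℝ) ≤ scale (instOf N k p) * m := by
      rw [hc, e0, e1, Nat.cast_max]
      exact max_le ((hsum 1).trans (by gcongr)) ((hsum 0).trans (by gcongr))
    obtain ⟨h1, h2⟩ := right_approx (N := N) (R := R) hN0 hp.2 (fun j hj => by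
      rw [hR]
      exact rounded_pos hN0 (instOf_num_pos hp.1 hj) (instOf_den_pos hj))
      (X := X) (filter_subset _ _) hc1 hc0 (c := c) (by omega) (by omega)
    have hS : prefixLoad R n ≤ 2 * c := by
      have := sum_sdiff (f := R) (show X ⊆ range n from filter_subset _ _)
      rw [prefixLoad]
      omega
    have hW : 4 * N * ∑ j ∈ univ.filter (fun j => schedule N k n p j = i), R j ≤
        4 * N * c + 2 * c := by
      rw [sumBelow_eq_sum_fin] at h1 h2
      have hz : ∀ j, schedule N k n p j = 0 ↔ ¬ Right N k R n j := fun j =>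
        hR ▸ schedule_eq_zero_iff h p j
      have ho : ∀ j, schedule N k n p j = 1 ↔ Right N k R n j := fun j =>
        hR ▸ schedule_eq_one_iff h p j
      revert i
      refine Fin.forall_fin_two.2 ⟨?_, ?_⟩
      · rw [filter_congr fun j _ => hz j]
        exact h2.trans (Nat.add_le_add_left hS _)
      · rw [filter_congr fun j _ => ho j]
        exact h1.trans (Nat.add_le_add_left hS _)
    obtain ⟨W, hWdef⟩ : ∃ W, W = ∑ j ∈ univ.filter (fun j => schedule N k n p j = i), R j :=
      ⟨_, rfl⟩
    have hload : 4 * N * (scale (instOf N k p) * load p (schedule N k n p) i) ≤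
        (4 * N + 1) * (W : ℝ) := by
      rw [hWdef, load, mul_sum, mul_sum]
      push_cast
      rw [mul_sum]
      exact sum_le_sum fun j _ => hR ▸ scale_mul_le_rounded hp.1 j
    rw [← hWdef] at hW
    have hW' : (4 * N * W : ℝ) ≤ 4 * N * c + 2 * c := by exact_mod_cast hW
    have hNr : (1 : ℝ) ≤ N := by exact_mod_cast hN0
    set q : ℝ := ((scale (instOf N k p) : ℕ) : ℝ)
    -- The factors `1 + 1/(4N)` for rounding and `1 + 2/(4N)` for the algorithm multiply to at most
    -- `1 + 1/N ≤ 1 + ε`, because `12 * N + 2 ≤ 16 * N` for `N` at least 1.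
    have h3 : (4 * N) * (4 * N) * q * load p (schedule N k n p) i ≤
        (4 * N) * (4 * N) * q * ((1 + ε) * m) := by
      calc (4 * N) * (4 * N) * q * load p (schedule N k n p) i
          = 4 * N * (4 * N * (q * load p (schedule N k n p) i)) := by ring
        _ ≤ 4 * N * ((4 * N + 1) * W) := by gcongr
        _ = (4 * N + 1) * (4 * N * W) := by ring
        _ ≤ (4 * N + 1) * (4 * N * c + 2 * c) := by gcongr
        _ = (4 * N + 1) * (4 * N + 2) * c := by ring
        _ ≤ (4 * N + 1) * (4 * N + 2) * (q * m) := by gcongr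
        _ ≤ 16 * N * (N + ε * N) * (q * m) := by
            refine mul_le_mul_of_nonneg_right ?_ (by positivity)
            nlinarith
        _ = _ := by ring
    exact le_of_mul_le_mul_left h3 (by positivity)
  -- Here `ε ≥ 1`, and every load is at most the sum of the two loads of `τ`, hence at most `2 * m`.
  · have h1 : N = 1 := by omega
    rw [h1, Nat.cast_one, mul_one] at hN
    have h2 := load_zero_add_load_one p (schedule N k n p)
    rw [← load_zero_add_load_one p τ] at h2
    have h3 := load_nonneg hp.1 (schedule N k n p) 0
    have h4 := load_nonneg hp.1 (schedule N k n p) 1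
    have h5 : load p (schedule N k n p) i ≤ 2 * m := by
      fin_cases i <;> simp only [Fin.zero_eta, Fin.mk_one] <;> linarith
    nlinarith

/-- The exponents contain the bit lengths of all denominators, so the last job contributes a common
power of two. -/
theorem rounded_succ (p : Fin (n + 1) → ℚ) {j : ℕ} (hj : j < n) :
    rounded (instOf N k p) j = 2 ^ Nat.size (p (Fin.last n)).den *
      rounded (instOf N k fun l => p l.castSucc) j := by
  obtain ⟨I, hI⟩ : ∃ I, I = instOf N k p := ⟨_, rfl⟩
  obtain ⟨I', hI'⟩ : ∃ I', I' = instOf N k fun l => p l.castSucc := ⟨_, rfl⟩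
  have hnum : ∀ i < n, I.num i = I'.num i := fun i hi => by
    rw [hI, hI']
    exact (instOf_num p (Fin.castSucc ⟨i, hi⟩)).trans
      (instOf_num (fun l => p l.castSucc) ⟨i, hi⟩).symm
  have hden : ∀ i < n, I.den i = I'.den i := fun i hi => by
    rw [hI, hI']
    exact (instOf_den p (Fin.castSucc ⟨i, hi⟩)).trans
      (instOf_den (fun l => p l.castSucc) ⟨i, hi⟩).symm
  have hlast : I.den n = (p (Fin.last n)).den := by
    rw [hI]
    exact instOf_den p (Fin.last n)
  have hn : I.n = n + 1 := by rw [hI]; rfl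
  have hn' : I'.n = n := by rw [hI']; rfl
  have hN : I.N = I'.N := by rw [hI, hI']; rfl
  have hle := size_den_le (I := I') (hj.trans_eq hn'.symm)
  rw [← hI, ← hI', rounded_eq, rounded_eq, mantissa, mantissa, exponent, exponent, hn, hn', hN,
    hnum j hj, hden j hj, sum_range_succ, hlast,
    sum_congr rfl fun i hi => by rw [hden i (mem_range.1 hi)], mul_left_comm, ← pow_add]
  rw [hn'] at hle
  congr 2
  omega

theorem schedule_migrate (h : 1 < N) {p : Fin (n + 1) → ℚ} (hp : ∀ j, 0 < p j) :
    migration (schedule N k) p ≤ 2097152 * N ^ 3 * (p (Fin.last n) : ℝ) := by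
  classical
  have hN : 0 < N := by omega
  have hlast : (0 : ℝ) < p (Fin.last n) := by exact_mod_cast hp _
  obtain ⟨R, hR⟩ : ∃ R, R = rounded (instOf N k p) := ⟨_, rfl⟩
  have hmig := right_migration (N := N) (k := k) (n := n) (R := R) hN fun i hi j hj hij => by
    rw [hR] at hij ⊢
    exact rounded_gap (instOf_den_pos (by omega)) (instOf_den_pos (by omega)) hij
  rw [sumBelow_eq_sum_fin] at hmig
  have hiff : ∀ j : Fin n, (schedule N k n (fun l => p l.castSucc) j ≠
      schedule N k (n + 1) p j.castSucc) ↔ ¬ (Right N k R n j ↔ Right N k R (n + 1) j) := by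
    intro j
    have h1 := schedule_eq_one_iff (k := k) h (fun l => p l.castSucc) j
    -- The old schedule is re-expressed in the rounded sizes of the enlarged instance.
    rw [← right_scale (Nat.two_pow_pos _) (fun j hj => rounded_succ p hj) j.2, ← hR] at h1
    have h2 := schedule_eq_one_iff (k := k) h p j.castSucc
    rw [← hR, Fin.val_castSucc] at h2
    rw [← h1, ← h2, ne_eq, not_iff_not]
    generalize schedule N k n (fun l => p l.castSucc) j = x
    generalize schedule N k (n + 1) p j.castSucc = y
    fin_cases x <;> fin_cases y <;> simp
  have hs0 := scale_pos (k := k) (p := p) hN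
  set q : ℝ := ((scale (instOf N k p) : ℕ) : ℝ)
  set A : Finset (Fin n) := univ.filter (fun j => schedule N k n (fun l => p l.castSucc) j ≠
    schedule N k (n + 1) p j.castSucc) with hA
  have hAeq : A = univ.filter (fun j : Fin n => ¬ (Right N k R n j ↔ Right N k R (n + 1) j)) :=
    filter_congr fun j _ => hiff j
  have hm : ((∑ j ∈ A, R j : ℕ) : ℝ) ≤ 1048576 * (N * N * N) * (q * p (Fin.last n)) := by
    have h1 : ((∑ j ∈ A, R j : ℕ) : ℝ) ≤ 1048576 * (N * N * N) * R n := by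
      rw [hAeq]
      exact_mod_cast hmig
    refine h1.trans ?_
    gcongr
    rw [hR]
    exact rounded_le_scale_mul hp (Fin.last n)
  have hload : 4 * N * (q * migration (schedule N k) p) ≤
      (4 * N + 1) * ((∑ j ∈ A, R j : ℕ) : ℝ) := by
    rw [migration, mul_sum, mul_sum]
    push_cast
    rw [mul_sum]
    exact sum_le_sum fun j _ => hR ▸ scale_mul_le_rounded hp j.castSucc
  have hNr : (1 : ℝ) ≤ N := by exact_mod_cast hN
  have h3 : 4 * N * q * migration (schedule N k) p ≤
      4 * N * q * (2097152 * N ^ 3 * (p (Fin.last n) : ℝ)) := by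
    calc 4 * N * q * migration (schedule N k) p
        = 4 * N * (q * migration (schedule N k) p) := by ring
      _ ≤ (4 * N + 1) * ((∑ j ∈ A, R j : ℕ) : ℝ) := hload
      _ ≤ (8 * N) * (1048576 * (N * N * N) * (q * p (Fin.last n))) := by
          gcongr
          linarith
      _ = _ := by ring
  exact le_of_mul_le_mul_left h3 (by positivity)

/-- With accuracy 1 the machine of a job depends only on its position, so it never changes. -/
theorem migration_eq_zero (h : N ≤ 1) (p : Fin (n + 1) → ℚ) : migration (schedule N k) p = 0 := by
  rw [migration, filter_false_of_mem, sum_empty]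
  intro j _
  rw [not_not, Fin.ext_iff]
  exact (machine_of_le (I := instOf N k fun l => p l.castSucc) h j).trans
    (machine_of_le (I := instOf N k p) h j.castSucc).symm

end

/-! ### Assembly of the main theorem -/

/-- A pure power can be split into a factor for the accuracy and a factor for the input length,
unlike a general polynomial in their sum. -/
theorem eval_le_pow (T : Polynomial ℕ) : ∃ c : ℕ, ∀ ℓ : ℕ, T.eval ℓ ≤ (ℓ + 2) ^ c := by
  refine ⟨∑ i ∈ range (T.natDegree + 1), T.coeff i + T.natDegree, fun ℓ => ?_⟩
  rw [Polynomial.eval_eq_sum_range, pow_add]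
  calc ∑ i ∈ range (T.natDegree + 1), T.coeff i * ℓ ^ i
      ≤ ∑ i ∈ range (T.natDegree + 1), T.coeff i * (ℓ + 2) ^ T.natDegree := by
        refine sum_le_sum fun i hi => Nat.mul_le_mul_left _ ?_
        rw [mem_range] at hi
        exact (Nat.pow_le_pow_left (by omega) i).trans (Nat.pow_le_pow_right (by omega) (by omega))
    _ = (∑ i ∈ range (T.natDegree + 1), T.coeff i) * (ℓ + 2) ^ T.natDegree := by rw [sum_mul]
    _ ≤ _ := Nat.mul_le_mul_right _
        (Nat.lt_two_pow_self.le.trans (Nat.pow_le_pow_left (by omega) _))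

end CCS

/-- On two machines there is a robust FPTAS with migration factor `O(1/ε⁵)` for `k > 1/ε²`: one
program, given `⌈1/ε⌉`, `k` and the jobs released so far, computes the current schedule of a robust
`(1+ε)`-approximation algorithm, in time bounded by a polynomial in `1/ε` times a polynomial in the
binary encoding length of the input. -/
theorem mainTheorem6 :
    ∃ (prog : CCS.Prog) (C : ℝ) (P Q : Polynomial ℝ),
      ∀ (ε : ℝ) (k : ℕ), 0 < ε → 1 / ε ^ 2 < (k : ℝ) →
        ∃ A : CCS.OnlineAlg 2,
          CCS.IsRobustApprox 2 k (1 + ε) (C / ε ^ 5) A ∧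
          ∀ (n : ℕ) (p : Fin n → ℚ), CCS.ValidInput 2 k p →
            CCS.OutputsInTime prog ⌈1 / ε⌉₊ k p (A n p)
              (P.eval (1 / ε) * Q.eval (CCS.encLength k p : ℝ)) := by
  obtain ⟨prog, T, hT⟩ := CCS.comp_machine.exec_output
  obtain ⟨c, hc⟩ := CCS.eval_le_pow T
  refine ⟨prog, 16777216, (Polynomial.X + 3) ^ c, (Polynomial.X + 1) ^ c, fun ε k hε _ => ?_⟩
  obtain ⟨N, hN⟩ : ∃ N, N = ⌈1 / ε⌉₊ := ⟨_, rfl⟩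
  have hε' : 0 < 1 / ε := by positivity
  have hN0 : 0 < N := hN ▸ Nat.ceil_pos.2 hε'
  have hN1 : 1 / ε ≤ N := hN ▸ Nat.le_ceil _
  have hN2 : (N : ℝ) ≤ 1 / ε + 1 := hN ▸ (Nat.ceil_lt_add_one hε'.le).le
  rw [← hN]
  refine ⟨CCS.schedule N k, ⟨fun n p hp => CCS.schedule_feasible hN0 hp,
    fun n p hp => CCS.schedule_approx hε (by rwa [div_le_iff₀' hε] at hN1) hp, fun n p hp => ?_⟩,
    fun n p _ => ?_⟩
  · have hlast : (0 : ℝ) < p (Fin.last n) := by exact_mod_cast hp.1 _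
    rcases Nat.lt_or_ge 1 N with h | h
    · refine (CCS.schedule_migrate h hp.1).trans ?_
      -- From `N > 1` follows `ε < 1`, so `N ≤ 2 / ε` and the cube of `1 / ε` is at most its fifth
      -- power. The constant is 2097152 * 8.
      have hε1 : 1 < 1 / ε := by
        rw [hN, Nat.lt_ceil, Nat.cast_one] at h
        exact h
      have hN3 : (N : ℝ) ^ 3 ≤ (2 * (1 / ε)) ^ 3 := by
        gcongr
        linarith
      have h5 : (1 / ε) ^ 3 ≤ (1 / ε) ^ 5 := pow_le_pow_right₀ hε1.le (by norm_num)
      refine mul_le_mul_of_nonneg_right ?_ hlast.le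
      calc 2097152 * (N : ℝ) ^ 3 ≤ 2097152 * (2 * (1 / ε)) ^ 3 := by gcongr
        _ = 16777216 * (1 / ε) ^ 3 := by ring
        _ ≤ 16777216 * (1 / ε) ^ 5 := by gcongr
        _ = 16777216 / ε ^ 5 := by rw [one_div, inv_pow, div_eq_mul_inv]
    · rw [CCS.migration_eq_zero h]
      positivity
  · obtain ⟨t, M, h1, h2, h3⟩ := hT (CCS.instOf N k p) _ _ (CCS.instOf_rep p) (CCS.instOf_bounded p)
    refine ⟨t, M, h1, ?_, fun j => h3 j j.2⟩
    have h4 : (t : ℝ) ≤ (N + CCS.encLength k p + 2) ^ c := by exact_mod_cast h2.trans (hc _)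
    refine h4.trans ?_
    simp only [Polynomial.eval_pow, Polynomial.eval_add, Polynomial.eval_X, Polynomial.eval_one,
      Polynomial.eval_ofNat]
    -- With `N ≤ 1 / ε + 1` and input length `L`, the base `N + L + 2` is at most `(1 / ε + 3) * (L
    -- + 1)`.
    rw [← mul_pow]
    gcongr
    have : (0 : ℝ) ≤ CCS.encLength k p := Nat.cast_nonneg _
    nlinarith
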